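/- Let $s\ge\frac12$ and let $W\in C^2(\mathbb R)$ be real-valued. Write $W(r)=E_0r^2+N(r)$ with $E_0=\frac12W''(0)$ (no sign condition on $E_0$), and assume: (W-0) $W(0)=W'(0)=0$; (W-1) $N(r_0)<0$ for some $r_0\in\mathbb R$; (W-2) there are $2<q_1\le q_2$ and $c_1$ with $|N'(r)|\le c_1(|r|^{q_1-1}+|r|^{q_2-1})$ for all $r\in\mathbb R$; (W-3) there are $p\in(2,4s+2)$ and $c\ge0$ with $N(r)\ge -c|r|^p$ for all $|r|$ large. Consider the fractional KdV equation $$\partial_tu+\partial_x\left[D^{2s}u+W'(u)\right]=0,\qquad u(t,x)\in\mathbb R,\quad D^{\sigma}w(x)=\tfrac1{\sqrt{2\pi}}\int|\xi|^{\sigma}\hat w(\xi)e^{ix\xi}\,d\xi .\tag{FKdV}$$ *Definitions.* The phase space is $X=H^s(\mathbb R)$ (real-valued), with norm $\|u\|_{H^s}^2=\int(1+|\xi|^{2s})|\hat u|^2d\xi$. A solution on a time interval $I$ is a $u\in C(I;H^s)$ such that, for all $\varphi\in C_c^\infty(\mathbb R)$ and $t\in I$, $\frac{d}{dt}\int u\varphi\,dx=\int\left(u\,\partial_xD^{2s}\varphi+W'(u)\,\partial_x\varphi\right)dx$.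 The energy and the charge are $$E(u)=\int\left(\tfrac12|D^su|^2+W(u)\right)dx,\qquad C(u)=\tfrac12\int u^2dx .$$ Say that $u_0\in X$ has a trajectory on $[0,\tau)$ if there is a solution on $[0,\tau)$ with initial value $u_0$, it is unique on $[0,\tau)$ and on every shorter interval $[0,\sigma)$, and $E$ and $C$ are constant along it; then $\gamma_tu_0$ $(0\le t<\tau)$ denotes its value at time $t$. Let $T(u_0)\in[0,\infty]$ be the supremum of the $\tau\ge0$ such that $u_0$ has a trajectory on $[0,\tau)$ and, for every $t\in[0,\tau)$, the map $(t',v)\mapsto\gamma_{t'}v$ (on the set of all pairs for which it is defined) is continuous at $(t,u_0)$ in the topology of $\mathbb R\times X$. Put $X_0=\{u_0\in X: T(u_0)=\infty\}$. Let $d$ be the distance of $X$. A set $\Gamma\subset X$ is *invariant* if $\gamma_tu\in\Gamma$ for all $u\in\Gamma$, $t\in[0,T(u))$; *stable* if for every $\varepsilon>0$ there is $\delta>0$ such that $u\in X$, $d(u,\Gamma)\le\delta$ imply $d(\gamma_tu,\Gamma)\le\varepsilon$ for all $t\in[0,T(u))$; *compact up to translations* if every sequence in $\Gamma$ has a subsequence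 which, after suitable translations in $x$, converges in $X$. A *hylomorphic soliton* is an element $u$ of a set $\Gamma=\{v\in X: E(v)=e_0,\ |C(v)|=c_0\}$ with $e_0=\min\{E(v): v\in X,\ |C(v)|=c_0\}$ such that $\Gamma\subset X_0$ and $\Gamma$ is invariant, stable and compact up to translations. (FKdV) is said to be globally well posed in $H^{2s}$ if $H^{2s}\subset X_0$. **Theorem.** There are $\delta_\infty>0$, functions $u_\delta\in H^{2s}(\mathbb R)$ and numbers $\lambda_\delta\in\mathbb R$, $\delta\in(0,\delta_\infty)$, such that $C(u_\delta)>0$, $C(u_{\delta_1})>C(u_{\delta_2})$ whenever $\delta_1<\delta_2$, and for every $\delta\in(0,\delta_\infty)$: 1. $E(u_\delta)=\min\{E(v): v\in X,\ |C(v)|=C(u_\delta)\}$, and the set $\Gamma_\delta$ of all $v\in X$ with $E(v)=E(u_\delta)$, $|C(v)|=C(u_\delta)$ is contained in $H^{2s}$ and is invariant, stable and compact up to translations. Consequently, if (FKdV) is globally well posed in $H^{2s}$, then $u_\delta$ is a hylomorphic soliton of (FKdV). 2. $u_\delta$ is a weak solution of $\partial_xD^{2s}u+\partial_xW'(u)=\lambda_\delta\,\partial_xu$,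 that is, $\int\left(u_\delta\,\partial_xD^{2s}\varphi+W'(u_\delta)\,\partial_x\varphi\right)dx=\lambda_\delta\int u_\delta\,\partial_x\varphi\,dx$ for all $\varphi\in C_c^\infty(\mathbb R)$. 3. $U_\delta(t,x)=u_\delta(x-\lambda_\delta t)$ solves (FKdV) on the time interval $\mathbb R$, in the sense defined above. -/

import Mathlib

open MeasureTheory Filter Topology Set
open scoped ENNReal NNReal FourierTransform ContDiff

noncomputable section

namespace FKdV

/-- Real-valued square-integrable functions on the line (up to a.e. equality). -/
abbrev L2R : Type := Lp ℝ 2 (volume : Measure ℝ)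

/-- The `L²` (Plancherel) Fourier transform of a real-valued function; Mathlib's kernel is
`exp (-2πixξ)`, so that the frequency variable of the kernel `exp (-ixξ)` is `2πξ`. -/
def fourierL2 (u : L2R) : Lp ℂ 2 (volume : Measure ℝ) :=
  𝓕 (Complex.ofRealCLM.compLp u : Lp ℂ 2 (volume : Measure ℝ))

/-- The operator `D^σ` on test functions, `D^σ φ = 𝓕⁻¹ (|2πξ|^σ 𝓕 φ)`. (For real `φ` the inverse
transform is real-valued, because the symbol is even; `re` only changes its type.) -/
def fracD (σ : ℝ) (φ : ℝ → ℝ) (x : ℝ) : ℝ :=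
  (𝓕⁻ (fun ξ : ℝ => ((|2 * Real.pi * ξ| ^ σ : ℝ) : ℂ) * 𝓕 (fun y : ℝ => (φ y : ℂ)) ξ) x).re

/-- The norm of `H^s`, `‖u‖² = ∫ (1 + |2πξ|^(2s)) |𝓕 u (ξ)|² dξ`, with value `∞` outside `H^s`. -/
def sobolevNorm (s : ℝ) (u : L2R) : ℝ≥0∞ :=
  (∫⁻ ξ : ℝ, ENNReal.ofReal (1 + |2 * Real.pi * ξ| ^ (2 * s)) * ‖fourierL2 u ξ‖ₑ ^ 2) ^ (1 / 2 : ℝ)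

/-- The Sobolev space `H^s = H^s(ℝ)`, for `s ≥ 0`, as a set of square-integrable functions. -/
def H (s : ℝ) : Set L2R := {u | sobolevNorm s u < ⊤}

/-- The distance in `H^s` of a function from a set. -/
def distToSet (s : ℝ) (u : L2R) (Γ : Set L2R) : ℝ≥0∞ := ⨅ v ∈ Γ, sobolevNorm s (u - v)

/-- The translate `x ↦ u (x - a)`. -/
def translate (a : ℝ) (u : L2R) : L2R :=
  Lp.compMeasurePreserving (fun x : ℝ => x - a) (measurePreserving_sub_right volume a) u

/-- The energy `E(u) = ∫ (½ |D^s u|² + W(u)) dx`, where `∫ |D^s u|² dx = ∫ |2πξ|^(2s) |𝓕 u|² dξ`. -/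
def energy (s : ℝ) (W : ℝ → ℝ) (u : L2R) : ℝ :=
  1 / 2 * (∫ ξ : ℝ, |2 * Real.pi * ξ| ^ (2 * s) * ‖fourierL2 u ξ‖ ^ 2) + ∫ x : ℝ, W (u x)

/-- The hylenic charge `C(u) = ½ ∫ u² dx`. -/
def charge (u : L2R) : ℝ := 1 / 2 * ∫ x : ℝ, (u x) ^ 2

/-- Test functions on the line. -/
def IsTest (φ : ℝ → ℝ) : Prop := ContDiff ℝ ∞ φ ∧ HasCompactSupport φ

/-- `u` is, on the time set `I`, a weak solution of `∂ₜu + ∂ₓ[D^(2s) u + W'(u)] = 0`, continuous in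
time with values in `H^s`:
`d/dt ∫ u φ dx = ∫ (u ∂ₓ D^(2s) φ + W'(u) ∂ₓ φ) dx` for every test function `φ`. -/
def IsSolution (s : ℝ) (W : ℝ → ℝ) (I : Set ℝ) (u : ℝ → L2R) : Prop :=
  (∀ t ∈ I, u t ∈ H s) ∧
  (∀ t ∈ I, Tendsto (fun t' => sobolevNorm s (u t' - u t)) (𝓝[I] t) (𝓝 0)) ∧
  ∀ φ : ℝ → ℝ, IsTest φ → ∀ t ∈ I,
    HasDerivWithinAt (fun t' => ∫ x : ℝ, u t' x * φ x)
      (∫ x : ℝ, (u t x * deriv (fracD (2 * s) φ) x + deriv W (u t x) * deriv φ x)) I t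

/-- `u` solves `∂ₓ D^(2s) u + ∂ₓ W'(u) = lam ∂ₓ u` in the weak sense (both sides are tested with
`φ` and the derivatives are moved to `φ`). -/
def IsWeakProfile (s : ℝ) (W : ℝ → ℝ) (lam : ℝ) (u : L2R) : Prop :=
  ∀ φ : ℝ → ℝ, IsTest φ →
    ∫ x : ℝ, (u x * deriv (fracD (2 * s) φ) x + deriv W (u x) * deriv φ x)
      = lam * ∫ x : ℝ, u x * deriv φ x

/-- `u` is on `[0, τ)` the solution with initial value `u₀`: it solves the equation, it is the
unique solution (on `[0, τ)` and on each shorter interval), and energy and charge are constant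
along it. -/
structure IsTrajectory (s : ℝ) (W : ℝ → ℝ) (u₀ : L2R) (τ : ℝ) (u : ℝ → L2R) : Prop where
  initial : u 0 = u₀
  solves : IsSolution s W (Ico 0 τ) u
  unique : ∀ σ ≤ τ, ∀ v : ℝ → L2R, v 0 = u₀ → IsSolution s W (Ico 0 σ) v → EqOn v u (Ico 0 σ)
  energy_const : ∀ t ∈ Ico 0 τ, energy s W (u t) = energy s W u₀
  charge_const : ∀ t ∈ Ico 0 τ, charge (u t) = charge u₀

/-- The solution with initial value `u₀` exists (in the above sense) beyond the time `t ≥ 0`. -/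
def InDomain (s : ℝ) (W : ℝ → ℝ) (t : ℝ) (u₀ : L2R) : Prop :=
  0 ≤ t ∧ u₀ ∈ H s ∧ ∃ τ > t, ∃ u, IsTrajectory s W u₀ τ u

open Classical in
/-- The evolution operator `γ_t`; the value is `u₀` where the solution does not exist. -/
def flow (s : ℝ) (W : ℝ → ℝ) (t : ℝ) (u₀ : L2R) : L2R :=
  if h : ∃ v, ∃ τ > t, ∃ u, IsTrajectory s W u₀ τ u ∧ u t = v then h.choose else u₀

/-- `(t, u₀) ↦ γ_t u₀` is continuous at `(t, u₀)`, with respect to the norm of `H^s`. -/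
def FlowContinuousAt (s : ℝ) (W : ℝ → ℝ) (t : ℝ) (u₀ : L2R) : Prop :=
  ∀ ε : ℝ≥0∞, 0 < ε → ∃ η : ℝ, 0 < η ∧ ∀ t' v, InDomain s W t' v → |t' - t| < η →
    sobolevNorm s (v - u₀) < ENNReal.ofReal η →
    sobolevNorm s (flow s W t' v - flow s W t u₀) < ε

/-- `T(u₀)`: the supremum of the `τ` such that on `[0, τ)` the solution with initial value `u₀` is
the unique one in `H^s`, depends continuously on time and initial value, and preserves energy and
charge. -/
def lifespan (s : ℝ) (W : ℝ → ℝ) (u₀ : L2R) : ℝ≥0∞ :=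
  ⨆ τ ∈ {τ : ℝ≥0 | (∃ u, IsTrajectory s W u₀ τ u) ∧
    ∀ t ∈ Ico (0 : ℝ) τ, FlowContinuousAt s W t u₀}, (τ : ℝ≥0∞)

/-- `X₀`: the states with global evolution. -/
def globalStates (s : ℝ) (W : ℝ → ℝ) : Set L2R := {u₀ | u₀ ∈ H s ∧ lifespan s W u₀ = ⊤}

/-- `Γ` is invariant. -/
def IsInvariant (s : ℝ) (W : ℝ → ℝ) (Γ : Set L2R) : Prop :=
  ∀ u ∈ Γ, ∀ t : ℝ, 0 ≤ t → ENNReal.ofReal t < lifespan s W u → flow s W t u ∈ Γ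

/-- `Γ` is orbitally stable. -/
def IsStable (s : ℝ) (W : ℝ → ℝ) (Γ : Set L2R) : Prop :=
  ∀ ε : ℝ≥0∞, 0 < ε → ∃ δ : ℝ≥0∞, 0 < δ ∧ ∀ u ∈ H s, distToSet s u Γ ≤ δ →
    ∀ t : ℝ, 0 ≤ t → ENNReal.ofReal t < lifespan s W u → distToSet s (flow s W t u) Γ ≤ ε

/-- `Γ` is compact up to translations, in `H^s`. -/
def IsCompactUpToTranslations (s : ℝ) (Γ : Set L2R) : Prop :=
  ∀ u : ℕ → L2R, (∀ n, u n ∈ Γ) → ∃ n : ℕ → ℕ, StrictMono n ∧ ∃ a : ℕ → ℝ, ∃ v ∈ H s,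
    Tendsto (fun k => sobolevNorm s (translate (a k) (u (n k)) - v)) atTop (𝓝 0)

/-- The set of the states with energy `e` and charge `c`. -/
def levelSet (s : ℝ) (W : ℝ → ℝ) (e c : ℝ) : Set L2R :=
  {u | u ∈ H s ∧ energy s W u = e ∧ |charge u| = c}

/-- `e` is the minimum of the energy among the states with charge `c`. -/
def IsMinEnergy (s : ℝ) (W : ℝ → ℝ) (c e : ℝ) : Prop :=
  IsLeast {x | ∃ v ∈ H s, |charge v| = c ∧ energy s W v = x} e

/-- Hylomorphic solitons: states of a set `Γ ⊆ X₀` that is invariant, stable and compact up to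
translations, and which consists of the energy minimizers at a prescribed charge. -/
def IsHylomorphicSoliton (s : ℝ) (W : ℝ → ℝ) (u : L2R) : Prop :=
  ∃ e c : ℝ, IsMinEnergy s W c e ∧ u ∈ levelSet s W e c ∧
    levelSet s W e c ⊆ globalStates s W ∧
    IsInvariant s W (levelSet s W e c) ∧ IsStable s W (levelSet s W e c) ∧
    IsCompactUpToTranslations s (levelSet s W e c)

/-- `N(r) = W(r) - E₀ r²` with `E₀ = ½ W''(0)`. -/
def nonlinearPart (W : ℝ → ℝ) (r : ℝ) : ℝ := W r - 1 / 2 * iteratedDeriv 2 W 0 * r ^ 2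

end FKdV

end

open MeasureTheory Filter Topology Set
open scoped ENNReal NNReal FourierTransform ContDiff

noncomputable section

namespace FKdV


/-! At fixed charge `c` the quadratic part `e * r ^ 2` of `W` only adds the constant `2 * e * c` to
the energy, so `W` may be replaced by `N` and the sign of `E₀` plays no role. The engine is the
stretching `u (x / θ)` with `θ ≥ 1`: it multiplies the charge and the potential energy by `θ`, but
the kinetic energy by `θ ^ (1 - 2 * s)`, which is at most `1` because `s ≥ 1/2`. Hence the minimal
energy per unit charge does not increase with the charge (`minE_div_le`), and the decrease is strict
on the way to any charge with negative minimal energy (`minE_div_lt`). A long plateau at a height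
where `N < 0` shows that the minimal energy is negative for all large charges (`exists_minE_neg`).

Negative minimal energy makes minimizing sequences compact up to translations (`exists_tendsto`). A
potential energy that stays below a negative constant forces a peak of the low-frequency part of `u`
(`exists_le_norm_low`); moving this peak to the origin gives a nonzero weak limit `v`. Charge and
energy split asymptotically between `v` and the remainder (`exists_weak_subseq`, `tendsto_split`),
and the strict decrease of the energy per charge makes such sharing too expensive. So no charge
escapes, the convergence is strong in `L²`, and convergence of the energies upgrades it to `H^s`.
For `s = 1/2` the functions need not be bounded; pointwise arguments are therefore made on `low k
u`, and the `L^p` bounds come from integrating the distribution function with a frequency cutoff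
that depends on the level (`lintegral_rpow_le_of_low`).

Compactness gives existence of minimizers, compactness of `Γ`, and stability: if the initial data
approach `Γ`, the conservation laws turn the evolved states into a minimizing sequence. Invariance
is conservation itself. Comparing `u` with `u + t • v`, stretched back to the original charge, gives
`D^(2s) u + N'(u) = μ u` (`eulerLagrange`, `exists_isProfile`). Since the other terms lie in `L²`,
this puts `u` in `H^(2s)`, and its weak derivative says that `u` travels with speed `μ + 2 * e`. The
family is obtained from the charges `c₀ + 1 / δ`. -/

/-- Complex-valued square-integrable functions on the line. -/
abbrev L2C : Type := Lp ℂ 2 (volume : Measure ℝ)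

/-! ### The Fourier transform on `L²` and its duality with test functions -/

theorem integral_schwartz_fourier_mul (f : L2C) (ψ : SchwartzMap ℝ ℂ) :
    ∫ x, (𝓕 ψ) x * f x = ∫ x, ψ x * (𝓕 f : L2C) x := by
  have h := congrArg (fun T => T ψ) (Lp.fourier_toTemperedDistribution_eq f)
  simpa [TemperedDistribution.fourier_apply, Lp.toTemperedDistribution_apply] using h

theorem ext_of_integral_schwartz {f g : L2C}
    (h : ∀ ψ : SchwartzMap ℝ ℂ, ∫ x, ψ x * f x = ∫ x, ψ x * g x) : f = g := by
  have hk := Lp.ker_toTemperedDistributionCLM_eq_bot (F := ℂ) (μ := (volume : Measure ℝ)) (p := 2)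
  have hinj := LinearMap.ker_eq_bot.mp hk
  apply hinj
  ext ψ
  simpa [Lp.toTemperedDistribution_apply] using h ψ

/-- An `L²` function is determined by its tempered distribution, so duality identifies a transform
that has no integral formula. The rules for translation, dilation and complex conjugation are
derived in this way. -/
theorem eq_fourier_of_integral_schwartz {f g : L2C}
    (h : ∀ ψ : SchwartzMap ℝ ℂ, ∫ x, (𝓕 ψ) x * f x = ∫ x, ψ x * g x) : g = 𝓕 f :=
  ext_of_integral_schwartz fun ψ => by rw [← h, integral_schwartz_fourier_mul]

theorem integral_fourier_mul {f g : ℝ → ℂ} (hf : Integrable f) (hg : Integrable g) :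
    ∫ x, 𝓕 f x * g x = ∫ x, f x * 𝓕 g x := by
  have := VectorFourier.integral_fourierIntegral_smul_eq_flip (L := innerₗ ℝ)
    (μ := (volume : Measure ℝ)) (ν := (volume : Measure ℝ)) (f := f) (g := g)
    Real.continuous_fourierChar continuous_inner hf hg
  simp only [flip_innerₗ, smul_eq_mul] at this
  exact this

/-- Both sides are locally integrable and have the same integrals against smooth compactly supported
functions, by the two versions of the multiplication formula. -/
theorem fourier_toLp_ae {f : ℝ → ℂ} (h1 : Integrable f) (h2 : MemLp f 2) :
    (𝓕 (h2.toLp f) : L2C) =ᵐ[volume] 𝓕 f := by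
  have hcont : Continuous (𝓕 f) :=
    VectorFourier.fourierIntegral_continuous Real.continuous_fourierChar continuous_inner h1
  refine ae_eq_of_integral_contDiff_smul_eq
    ((Lp.memLp _).locallyIntegrable (by norm_num)) hcont.locallyIntegrable ?_
  intro g hg hgc
  set ψ : SchwartzMap ℝ ℂ := HasCompactSupport.toSchwartzMap (f := fun x => (g x : ℂ))
    (hgc.comp_left (g := fun r : ℝ => (r : ℂ)) Complex.ofReal_zero)
    (Complex.ofRealCLM.contDiff.comp hg)
  have hψ : ∀ x, ψ x = (g x : ℂ) := fun x => rfl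
  have h := integral_schwartz_fourier_mul (h2.toLp f) ψ
  have h3 : ∫ x, (𝓕 ψ) x * (h2.toLp f) x = ∫ x, 𝓕 (ψ : ℝ → ℂ) x * f x := by
    apply integral_congr_ae
    filter_upwards [h2.coeFn_toLp] with x hx
    rw [hx, SchwartzMap.fourier_coe]
  rw [h3, integral_fourier_mul ψ.integrable h1] at h
  simp only [Complex.real_smul]
  simp only [hψ] at h
  exact h.symm

theorem inner_L2C (f g : L2C) : inner ℂ f g = ∫ x, g x * (starRingEnd ℂ) (f x) := by
  rw [L2.inner_def]; simp only [RCLike.inner_apply]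

theorem fourierInv_ae (f : L2C) : (𝓕⁻ f : L2C) =ᵐ[volume] fun x => (𝓕 f : L2C) (-x) := by
  set g : L2C := Lp.compMeasurePreserving (fun x : ℝ => -x)
    (Measure.measurePreserving_neg volume) (𝓕 f : L2C) with hg
  have hgx : g =ᵐ[volume] fun x => (𝓕 f : L2C) (-x) :=
    Lp.coeFn_compMeasurePreserving _ (Measure.measurePreserving_neg volume)
  suffices h : 𝓕⁻ f = g by rw [h]; exact hgx
  apply ext_of_integral_schwartz
  intro ψ
  have h1 := congrArg (fun T => T ψ) (Lp.fourierInv_toTemperedDistribution_eq f)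
  simp only [TemperedDistribution.fourierInv_apply, Lp.toTemperedDistribution_apply,
    smul_eq_mul] at h1
  rw [← h1]
  have h2 : ∫ x, ψ x * g x = ∫ x, ψ (-x) * (𝓕 f : L2C) x := by
    rw [← integral_neg_eq_self]
    apply integral_congr_ae
    have := (Measure.measurePreserving_neg (volume : Measure ℝ)).quasiMeasurePreserving.ae_eq hgx
    filter_upwards [this] with x hx
    simp only [Function.comp] at hx
    rw [hx, neg_neg]
  rw [h2]
  set φ : SchwartzMap ℝ ℂ := SchwartzMap.compCLMOfContinuousLinearEquiv ℂ
    (ContinuousLinearEquiv.neg ℝ) ψ with hφ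
  have hφx : ∀ x, φ x = ψ (-x) := fun x => rfl
  simp only [← hφx]
  rw [← integral_schwartz_fourier_mul]
  congr 1
  ext x
  rw [SchwartzMap.fourierInv_coe, SchwartzMap.fourier_coe, Real.fourierInv_eq_fourier_comp_neg]
  rfl

theorem fourierInv_toLp_ae {f : ℝ → ℂ} (h1 : Integrable f) (h2 : MemLp f 2) :
    (𝓕⁻ (h2.toLp f) : L2C) =ᵐ[volume] 𝓕⁻ f := by
  refine (fourierInv_ae _).trans ?_
  have := (Measure.measurePreserving_neg (volume : Measure ℝ)).quasiMeasurePreserving.ae_eq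
    (fourier_toLp_ae h1 h2)
  filter_upwards [this] with x hx
  simp only [Function.comp] at hx
  rw [hx, Real.fourierInv_eq_fourier_neg]

/-- The multiplication formula beyond Schwartz functions: the test functions used below, such as
`phase a * ψ` or `ψ (x / θ)`, enter only through integrability. It is Plancherel's identity for `f`
and the inverse transform of the conjugate of `ψ`. -/
theorem integral_fourier_mul_L2 {ψ : ℝ → ℂ} (h1 : Integrable ψ) (h2 : MemLp ψ 2) (f : L2C) :
    ∫ x, 𝓕 ψ x * f x = ∫ x, ψ x * (𝓕 f : L2C) x := by
  have hc : MemLp (fun x => (starRingEnd ℂ) (ψ x)) 2 := h2.star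
  have hc1 : Integrable (fun x => (starRingEnd ℂ) (ψ x)) := by
    simpa using (Complex.conjLIE.toContinuousLinearEquiv.integrable_comp_iff).2 h1
  have e := Lp.inner_fourier_eq (𝓕⁻ (hc.toLp _) : L2C) f
  rw [FourierTransform.fourier_fourierInv_eq, inner_L2C, inner_L2C] at e
  have e1 : ∫ x, (𝓕 f : L2C) x * (starRingEnd ℂ) ((hc.toLp _ : L2C) x)
      = ∫ x, ψ x * (𝓕 f : L2C) x := by
    apply integral_congr_ae
    filter_upwards [hc.coeFn_toLp] with x hx
    rw [hx]; simp [mul_comm]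
  rw [← e1, e]
  apply integral_congr_ae
  filter_upwards [fourierInv_toLp_ae hc1 hc] with x hx
  rw [hx, mul_comm, Real.fourierInv_eq', Real.fourier_eq', ← integral_conj]
  congr 2
  ext v
  simp [← Complex.exp_conj, Complex.conj_ofNat]


/-! ### Real functions -/

/-- A real-valued function, viewed as a complex-valued one. -/
def toC (u : L2R) : L2C := Complex.ofRealCLM.compLp u

theorem toC_ae (u : L2R) : toC u =ᵐ[volume] fun x => (u x : ℂ) :=
  ContinuousLinearMap.coeFn_compLp _ _

theorem fourierL2_def (u : L2R) : fourierL2 u = 𝓕 (toC u) := rfl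

theorem toC_eq_compLpL (u : L2R) : toC u = Complex.ofRealCLM.compLpL 2 volume u := rfl

theorem toC_add (u v : L2R) : toC (u + v) = toC u + toC v := by
  simp only [toC_eq_compLpL, map_add]

theorem toC_sub (u v : L2R) : toC (u - v) = toC u - toC v := by
  simp only [toC_eq_compLpL, map_sub]

theorem toC_smul (r : ℝ) (u : L2R) : toC (r • u) = (r : ℂ) • toC u := by
  rw [toC_eq_compLpL, map_smul]
  ext1
  filter_upwards [Lp.coeFn_smul r (Complex.ofRealCLM.compLpL 2 volume u),
    Lp.coeFn_smul (r : ℂ) (toC u)] with x h1 h2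
  rw [h1, h2]; rfl

theorem norm_toC (u : L2R) : ‖toC u‖ = ‖u‖ := by
  rw [Lp.norm_def, Lp.norm_def]
  congr 1
  apply eLpNorm_congr_norm_ae
  filter_upwards [toC_ae u] with x hx
  rw [hx]; simp

theorem fourierL2_add (u v : L2R) : fourierL2 (u + v) = fourierL2 u + fourierL2 v := by
  simp only [fourierL2_def, toC_add]
  exact FourierTransform.fourier_add _ _

theorem fourierL2_sub (u v : L2R) : fourierL2 (u - v) = fourierL2 u - fourierL2 v := by
  simp only [fourierL2_def, toC_sub]
  exact map_sub (Lp.fourierTransformₗᵢ ℝ ℂ) _ _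

theorem fourierL2_smul (r : ℝ) (u : L2R) : fourierL2 (r • u) = (r : ℂ) • fourierL2 u := by
  simp only [fourierL2_def, toC_smul]
  exact FourierTransform.fourier_smul _ _

theorem norm_fourierL2 (u : L2R) : ‖fourierL2 u‖ = ‖u‖ := by
  rw [fourierL2_def, Lp.norm_fourier_eq, norm_toC]

theorem fourierL2_injective : Function.Injective fourierL2 := by
  intro u v h
  rw [← sub_eq_zero, ← norm_eq_zero, ← norm_fourierL2, fourierL2_sub, h, sub_self, norm_zero]

theorem norm_sq_L2R (u : L2R) : ‖u‖ ^ 2 = ∫ x, (u x) ^ 2 := by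
  rw [← real_inner_self_eq_norm_sq, L2.inner_def]
  simp [sq]

theorem norm_sq_L2C (u : L2C) : ‖u‖ ^ 2 = ∫ x, ‖u x‖ ^ 2 := by
  rw [← inner_self_eq_norm_sq (𝕜 := ℂ), L2.inner_def, ← integral_re]
  · simp [← Complex.ofReal_pow]
  · exact L2.integrable_inner _ _

theorem norm_sq_eq_integral_fourierL2 (u : L2R) : ‖u‖ ^ 2 = ∫ ξ, ‖fourierL2 u ξ‖ ^ 2 := by
  rw [← norm_fourierL2, norm_sq_L2C]

theorem charge_eq (u : L2R) : charge u = 1 / 2 * ‖u‖ ^ 2 := by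
  rw [charge, norm_sq_L2R]

theorem inner_L2R (u v : L2R) : inner ℝ u v = ∫ x, u x * v x := by
  rw [L2.inner_def]; simp [mul_comm]

theorem inner_toC (u v : L2R) : inner ℂ (toC u) (toC v) = ((inner ℝ u v : ℝ) : ℂ) := by
  rw [inner_L2C, inner_L2R, ← integral_complex_ofReal]
  apply integral_congr_ae
  filter_upwards [toC_ae u, toC_ae v] with x h1 h2
  rw [h1, h2]; simp [mul_comm]

theorem inner_fourierL2 (u v : L2R) :
    inner ℂ (fourierL2 u) (fourierL2 v) = ((inner ℝ u v : ℝ) : ℂ) := by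
  rw [fourierL2_def, fourierL2_def, Lp.inner_fourier_eq, inner_toC]

/-- Plancherel's identity for real-valued functions. -/
theorem integral_mul_eq_fourierL2 (u v : L2R) :
    ∫ x, u x * v x = (∫ ξ, fourierL2 u ξ * (starRingEnd ℂ) (fourierL2 v ξ)).re := by
  rw [← inner_L2C, inner_fourierL2, Complex.ofReal_re, inner_L2R]
  simp [mul_comm]

theorem fourierL2_toLp_ae {f : ℝ → ℝ} (h1 : Integrable f) (h2 : MemLp f 2) :
    fourierL2 (h2.toLp f) =ᵐ[volume] 𝓕 (fun x => (f x : ℂ)) := by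
  have h3 : MemLp (fun x => (f x : ℂ)) 2 := h2.ofReal
  have e : toC (h2.toLp f) = h3.toLp _ := by
    ext1
    filter_upwards [toC_ae (h2.toLp f), h2.coeFn_toLp, h3.coeFn_toLp] with x a b c
    rw [a, b, c]
  rw [fourierL2_def, e]
  exact fourier_toLp_ae h1.ofReal h3

/-! ### Translations, dilations, reality -/

theorem translate_ae (a : ℝ) (u : L2R) : translate a u =ᵐ[volume] fun x => u (x - a) :=
  Lp.coeFn_compMeasurePreserving _ (measurePreserving_sub_right volume a)

theorem ae_comp_sub (a : ℝ) {p : ℝ → Prop} (h : ∀ᵐ x, p x) : ∀ᵐ x : ℝ, p (x - a) :=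
  (measurePreserving_sub_right volume a).quasiMeasurePreserving.ae h

theorem ae_comp_neg {p : ℝ → Prop} (h : ∀ᵐ x, p x) : ∀ᵐ x : ℝ, p (-x) :=
  (Measure.measurePreserving_neg (volume : Measure ℝ)).quasiMeasurePreserving.ae h

theorem ae_comp_mul {θ : ℝ} (hθ : θ ≠ 0) {p : ℝ → Prop} (h : ∀ᵐ x, p x) :
    ∀ᵐ x : ℝ, p (θ * x) := by
  have : Measure.QuasiMeasurePreserving (fun x : ℝ => θ * x) volume volume := by
    refine ⟨measurable_const_mul θ, ?_⟩
    rw [Real.map_volume_mul_left hθ]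
    exact Measure.smul_absolutelyContinuous
  exact this.ae h

/-- The phase factor `e^{-2πiaξ}`. -/
def phase (a ξ : ℝ) : ℂ := Complex.exp (((-2 * Real.pi * (a * ξ) : ℝ) : ℂ) * Complex.I)

theorem continuous_phase : Continuous fun p : ℝ × ℝ => phase p.1 p.2 := by
  unfold phase; fun_prop

theorem norm_phase (a ξ : ℝ) : ‖phase a ξ‖ = 1 := Complex.norm_exp_ofReal_mul_I _

theorem phase_add (a b ξ : ℝ) : phase (a + b) ξ = phase a ξ * phase b ξ := by
  rw [phase, phase, phase, ← Complex.exp_add]; congr 1; push_cast; ring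

theorem phase_zero (ξ : ℝ) : phase 0 ξ = 1 := by simp [phase]

theorem conj_phase (a ξ : ℝ) : (starRingEnd ℂ) (phase a ξ) = phase (-a) ξ := by
  simp [phase, ← Complex.exp_conj, Complex.conj_ofNat]

theorem fourier_eq_phase (f : ℝ → ℂ) (ξ : ℝ) : 𝓕 f ξ = ∫ x, phase x ξ * f x := by
  rw [Real.fourier_eq']
  simp only [phase, smul_eq_mul, RCLike.inner_apply, conj_trivial]
  congr 1; ext x; rw [mul_comm ξ x]

theorem fourierInv_eq_phase (f : ℝ → ℂ) (x : ℝ) : 𝓕⁻ f x = ∫ ξ, phase (-x) ξ * f ξ := by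
  rw [Real.fourierInv_eq_fourier_neg, fourier_eq_phase]
  congr 1; ext ξ; simp only [phase]; congr 4; ring

theorem memLp_phase_mul {f : ℝ → ℂ} {p : ℝ≥0∞} (a : ℝ) (hf : MemLp f p) :
    MemLp (fun x => phase a x * f x) p := by
  refine hf.of_le_mul (c := 1) ?_ ?_
  · exact (continuous_phase.comp (by fun_prop : Continuous fun x : ℝ => (a, x))).aestronglyMeasurable.mul
      hf.aestronglyMeasurable
  · exact Eventually.of_forall fun x => by simp [norm_phase]

theorem fourierL2_translate (a : ℝ) (u : L2R) :
    fourierL2 (translate a u) =ᵐ[volume] fun ξ => phase a ξ * fourierL2 u ξ := by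
  have hm := memLp_phase_mul a (Lp.memLp (fourierL2 u))
  suffices h : hm.toLp _ = fourierL2 (translate a u) by
    rw [← h]; exact hm.coeFn_toLp
  rw [fourierL2_def (translate a u)]
  apply eq_fourier_of_integral_schwartz
  intro ψ
  have hp1 : Integrable (fun x => phase a x * ψ x) := by
    rw [← memLp_one_iff_integrable] at *
    exact memLp_phase_mul a (memLp_one_iff_integrable.2 ψ.integrable)
  have hp2 : MemLp (fun x => phase a x * ψ x) 2 := memLp_phase_mul a (ψ.memLp 2)
  calc ∫ x, (𝓕 ψ) x * toC (translate a u) x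
      = ∫ x, (𝓕 ψ) x * toC u (x - a) := by
        apply integral_congr_ae
        filter_upwards [toC_ae (translate a u), translate_ae a u, ae_comp_sub a (toC_ae u)]
          with x h1 h2 h3
        rw [h1, h2, h3]
    _ = ∫ x, (𝓕 ψ) (x + a) * toC u x := by
        have h := integral_sub_right_eq_self (fun x => (𝓕 ψ) (x + a) * toC u x) a (μ := volume)
        simpa only [sub_add_cancel] using h
    _ = ∫ x, 𝓕 (fun y => phase a y * ψ y) x * toC u x := by
        congr 1; ext x
        rw [SchwartzMap.fourier_coe, fourier_eq_phase, fourier_eq_phase]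
        congr 2; ext y
        have : phase y (x + a) = phase y x * phase a y := by
          rw [phase, phase, phase, ← Complex.exp_add]; congr 1; push_cast; ring
        rw [this]; ring
    _ = ∫ x, phase a x * ψ x * fourierL2 u x := by
        rw [integral_fourier_mul_L2 hp1 hp2]; rfl
    _ = ∫ x, ψ x * hm.toLp _ x := by
        apply integral_congr_ae
        filter_upwards [hm.coeFn_toLp] with x h
        rw [h]; ring

theorem fourierL2_hermitian (u : L2R) :
    ∀ᵐ ξ, fourierL2 u (-ξ) = (starRingEnd ℂ) (fourierL2 u ξ) := by
  set g : L2C := Lp.compMeasurePreserving (fun x : ℝ => -x)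
    (Measure.measurePreserving_neg volume) (fourierL2 u) with hg
  have hgx : g =ᵐ[volume] fun x => fourierL2 u (-x) :=
    Lp.coeFn_compMeasurePreserving _ (Measure.measurePreserving_neg volume)
  have hm : MemLp (fun x => (starRingEnd ℂ) (g x)) 2 := (Lp.memLp g).star
  suffices h : hm.toLp _ = fourierL2 u by
    have h2 := hm.coeFn_toLp
    rw [h] at h2
    filter_upwards [h2, hgx] with x h3 h4
    rw [h3, h4, Complex.conj_conj]
  rw [fourierL2_def u]
  apply eq_fourier_of_integral_schwartz
  intro ψ
  have hp : ∀ {p : ℝ≥0∞}, MemLp ψ p → MemLp (fun x => (starRingEnd ℂ) (ψ (-x))) p := by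
    intro p h
    exact (h.comp_measurePreserving (Measure.measurePreserving_neg volume)).star
  have hp1 : Integrable (fun x => (starRingEnd ℂ) (ψ (-x))) :=
    memLp_one_iff_integrable.1 (hp (memLp_one_iff_integrable.2 ψ.integrable))
  have hp2 : MemLp (fun x => (starRingEnd ℂ) (ψ (-x))) 2 := hp (ψ.memLp 2)
  have e1 := integral_fourier_mul_L2 hp1 hp2 (toC u)
  have e2 := congrArg (starRingEnd ℂ) e1
  rw [← integral_conj, ← integral_conj] at e2
  -- The conjugate of the transform of `conj (ψ (-x))` is the transform of `ψ`, and `toC u` equals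
  -- its conjugate because `u` is real.
  have e3 : ∫ x, (starRingEnd ℂ) (𝓕 (fun x => (starRingEnd ℂ) (ψ (-x))) x * toC u x)
      = ∫ x, (𝓕 ψ) x * toC u x := by
    apply integral_congr_ae
    filter_upwards [toC_ae u] with x hx
    rw [hx, map_mul, Complex.conj_ofReal, SchwartzMap.fourier_coe, fourier_eq_phase,
      fourier_eq_phase, ← integral_conj]
    congr 1
    rw [← integral_neg_eq_self]
    congr 1; ext y
    simp [conj_phase]
  rw [← e3, e2, ← integral_neg_eq_self]
  apply integral_congr_ae
  filter_upwards [hm.coeFn_toLp, hgx] with x h1 h2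
  rw [h1, h2, neg_neg, map_mul, Complex.conj_conj]; rfl

theorem exists_eq_toC_add (f : L2C) : ∃ u v : L2R, f = toC u + Complex.I • toC v := by
  set u : L2R := Complex.reCLM.compLp f
  set v : L2R := Complex.imCLM.compLp f
  refine ⟨u, v, ?_⟩
  ext1
  filter_upwards [Lp.coeFn_add (toC u) (Complex.I • toC v), Lp.coeFn_smul Complex.I (toC v),
    toC_ae u, toC_ae v, ContinuousLinearMap.coeFn_compLp Complex.reCLM f,
    ContinuousLinearMap.coeFn_compLp Complex.imCLM f] with x h1 h2 h3 h4 h5 h6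
  rw [h1, Pi.add_apply, h2, Pi.smul_apply, h3, h4, h5, h6]
  simp only [Complex.reCLM_apply, Complex.imCLM_apply, smul_eq_mul]
  rw [mul_comm, Complex.re_add_im]

/-- Hermitian square-integrable functions are transforms of real-valued functions. -/
theorem exists_fourierL2_eq {G : L2C} (h : ∀ᵐ ξ, G (-ξ) = (starRingEnd ℂ) (G ξ)) :
    ∃ u : L2R, fourierL2 u = G := by
  obtain ⟨u, v, e⟩ := exists_eq_toC_add (𝓕⁻ G : L2C)
  have e2 : G = fourierL2 u + Complex.I • fourierL2 v := by
    rw [fourierL2_def, fourierL2_def, ← FourierTransform.fourier_smul,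
      ← FourierTransform.fourier_add, ← e, FourierTransform.fourier_fourierInv_eq]
  have hG : G =ᵐ[volume] fun x => fourierL2 u x + Complex.I * fourierL2 v x := by
    rw [e2]
    filter_upwards [Lp.coeFn_add (fourierL2 u) (Complex.I • fourierL2 v),
      Lp.coeFn_smul Complex.I (fourierL2 v)] with x h1 h2
    rw [h1, Pi.add_apply, h2]; rfl
  -- Both transforms are Hermitian, but the factor `I` changes sign under conjugation, so the
  -- symmetry of `G` leaves `2 * I * conj (fourierL2 v) = 0`.
  have hv : fourierL2 v = 0 := by
    ext1
    filter_upwards [h, hG, ae_comp_neg hG, fourierL2_hermitian u, fourierL2_hermitian v,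
      Lp.coeFn_zero ℂ 2 volume] with x h1 h2 h3 h4 h5 h6
    rw [h6]
    rw [h2, h3, h4, h5, map_add, map_mul, Complex.conj_I] at h1
    have h7 : Complex.I * (starRingEnd ℂ) (fourierL2 v x) = 0 := by linear_combination h1 / 2
    simpa using h7
  exact ⟨u, by rw [e2, hv, smul_zero, add_zero]⟩

theorem memLp_comp_div {E : Type*} [NormedAddCommGroup E] {θ : ℝ} (hθ : 0 < θ) {f : ℝ → E}
    {p : ℝ≥0∞} (hf : MemLp f p) : MemLp (fun x => f (x / θ)) p := by
  have h0 : θ⁻¹ ≠ 0 := by positivity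
  have hm : Measure.map (fun x : ℝ => θ⁻¹ * x) volume = ENNReal.ofReal |θ⁻¹⁻¹| • volume :=
    Real.map_volume_mul_left h0
  have h1 : MemLp f p (Measure.map (fun x : ℝ => θ⁻¹ * x) volume) := by
    rw [hm]; exact hf.smul_measure ENNReal.ofReal_ne_top
  have h2 := h1.comp_of_map (measurable_const_mul θ⁻¹).aemeasurable
  refine h2.congr_norm ?_ ?_
  · convert h2.aestronglyMeasurable using 1
    ext x; simp [div_eq_inv_mul]
  · exact Eventually.of_forall fun x => by simp [div_eq_inv_mul]

/-- The dilate `x ↦ u (x / θ)`, for `θ > 0`. -/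
def dilate {θ : ℝ} (hθ : 0 < θ) (u : L2R) : L2R := (memLp_comp_div hθ (Lp.memLp u)).toLp _

theorem dilate_ae {θ : ℝ} (hθ : 0 < θ) (u : L2R) :
    dilate hθ u =ᵐ[volume] fun x => u (x / θ) := MemLp.coeFn_toLp _

theorem integral_dilate {θ : ℝ} (hθ : 0 < θ) (u : L2R) (g : ℝ → ℝ) :
    ∫ x, g (dilate hθ u x) = θ * ∫ x, g (u x) := by
  have : ∫ x, g (dilate hθ u x) = ∫ x, g (u (x / θ)) := by
    apply integral_congr_ae
    filter_upwards [dilate_ae hθ u] with x hx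
    rw [hx]
  rw [this, Measure.integral_comp_div (fun x => g (u x)) θ, abs_of_pos hθ, smul_eq_mul]

theorem fourierL2_dilate {θ : ℝ} (hθ : 0 < θ) (u : L2R) :
    fourierL2 (dilate hθ u) =ᵐ[volume] fun ξ => θ * fourierL2 u (θ * ξ) := by
  have hi : 0 < θ⁻¹ := by positivity
  have hm : MemLp (fun ξ => (θ : ℂ) * fourierL2 u (ξ / θ⁻¹)) 2 :=
    (memLp_comp_div hi (Lp.memLp (fourierL2 u))).const_mul _
  suffices h : hm.toLp _ = fourierL2 (dilate hθ u) by
    rw [← h]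
    filter_upwards [hm.coeFn_toLp] with x hx
    rw [hx, div_inv_eq_mul, mul_comm x]
  rw [fourierL2_def (dilate hθ u)]
  apply eq_fourier_of_integral_schwartz
  intro ψ
  have hp1 : Integrable (fun x => ψ (x / θ)) :=
    memLp_one_iff_integrable.1 (memLp_comp_div hθ (memLp_one_iff_integrable.2 ψ.integrable))
  have hp2 : MemLp (fun x => ψ (x / θ)) 2 := memLp_comp_div hθ (ψ.memLp 2)
  have hθC : (θ : ℂ) ≠ 0 := by exact_mod_cast hθ.ne'
  calc ∫ x, (𝓕 ψ) x * toC (dilate hθ u) x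
      = ∫ x, (𝓕 ψ) (θ * (x / θ)) * toC u (x / θ) := by
        apply integral_congr_ae
        have := ae_comp_mul hi.ne' (toC_ae u)
        filter_upwards [toC_ae (dilate hθ u), dilate_ae hθ u, this] with x h1 h2 h3
        rw [h1, h2, mul_div_cancel₀ _ hθ.ne', div_eq_inv_mul, h3]
    _ = θ • ∫ x, (𝓕 ψ) (θ * x) * toC u x := by
        have h := Measure.integral_comp_div (fun x => (𝓕 ψ) (θ * x) * toC u x) θ
        rwa [abs_of_pos hθ] at h
    _ = ∫ x, 𝓕 (fun y => ψ (y / θ)) x * toC u x := by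
        rw [← integral_smul]
        congr 1; ext x
        have : 𝓕 (fun y => ψ (y / θ)) x = θ • (𝓕 ψ) (θ * x) := by
          rw [SchwartzMap.fourier_coe, fourier_eq_phase, fourier_eq_phase]
          have h2 := Measure.integral_comp_div (fun y => phase y (θ * x) * ψ y) θ
          rw [abs_of_pos hθ] at h2
          rw [← h2]
          congr 1; ext y
          congr 1
          simp only [phase]; congr 4; field_simp
        rw [this]; simp only [Complex.real_smul]; ring
    _ = ∫ x, ψ (x / θ) * fourierL2 u (θ * (x / θ)) := by
        rw [integral_fourier_mul_L2 hp1 hp2]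
        simp only [mul_div_cancel₀ _ hθ.ne']; rfl
    _ = θ • ∫ x, ψ x * fourierL2 u (θ * x) := by
        rw [Measure.integral_comp_div (fun x => ψ x * fourierL2 u (θ * x)) θ, abs_of_pos hθ]
    _ = ∫ x, ψ x * hm.toLp _ x := by
        rw [← integral_smul]
        apply integral_congr_ae
        filter_upwards [hm.coeFn_toLp] with x h
        rw [h, div_inv_eq_mul, mul_comm x]; simp only [Complex.real_smul]; ring


/-! ### Homogeneous Sobolev seminorms -/

/-- The frequency `|2πξ|`. -/
def freq (ξ : ℝ) : ℝ := |2 * Real.pi * ξ|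

theorem freq_nonneg (ξ : ℝ) : 0 ≤ freq ξ := abs_nonneg _

theorem freq_neg (ξ : ℝ) : freq (-ξ) = freq ξ := by simp [freq]

theorem freq_mul {θ : ℝ} (hθ : 0 < θ) (ξ : ℝ) : freq (θ * ξ) = θ * freq ξ := by
  rw [freq, freq, mul_left_comm, abs_mul, abs_of_pos hθ]

theorem continuous_freq : Continuous freq := by unfold freq; fun_prop

theorem measurable_freq_rpow (σ : ℝ) : Measurable fun ξ => freq ξ ^ σ :=
  continuous_freq.measurable.pow_const σ

theorem freq_rpow_nonneg (σ ξ : ℝ) : 0 ≤ freq ξ ^ σ := Real.rpow_nonneg (freq_nonneg ξ) σ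

/-- The square `∫ |2πξ|^σ |𝓕 u|²` of the homogeneous Sobolev seminorm of order `σ / 2`. -/
def sob (σ : ℝ) (u : L2R) : ℝ := ∫ ξ, freq ξ ^ σ * ‖fourierL2 u ξ‖ ^ 2

/-- Finiteness of `sob σ u`. -/
def SobFinite (σ : ℝ) (u : L2R) : Prop := Integrable fun ξ => freq ξ ^ σ * ‖fourierL2 u ξ‖ ^ 2

/-- The square of the norm of `H^s`. -/
def hsq (s : ℝ) (u : L2R) : ℝ := ‖u‖ ^ 2 + sob (2 * s) u

theorem sob_nonneg (σ : ℝ) (u : L2R) : 0 ≤ sob σ u :=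
  integral_nonneg fun ξ => mul_nonneg (freq_rpow_nonneg σ ξ) (sq_nonneg _)

theorem hsq_nonneg (s : ℝ) (u : L2R) : 0 ≤ hsq s u :=
  add_nonneg (sq_nonneg _) (sob_nonneg _ _)

theorem measurable_fourierL2 (u : L2R) : Measurable (fourierL2 u) :=
  (Lp.stronglyMeasurable _).measurable

theorem aestronglyMeasurable_sob (σ : ℝ) (u : L2R) :
    AEStronglyMeasurable (fun ξ => freq ξ ^ σ * ‖fourierL2 u ξ‖ ^ 2) volume :=
  ((measurable_freq_rpow σ).mul ((measurable_fourierL2 u).norm.pow_const 2)).aestronglyMeasurable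

theorem integrable_norm_sq (f : L2C) : Integrable fun ξ => ‖f ξ‖ ^ 2 :=
  (Lp.memLp f).integrable_norm_pow (by norm_num)

theorem sobolevNorm_eq_lintegral (s : ℝ) (u : L2R) :
    sobolevNorm s u = (∫⁻ ξ, ENNReal.ofReal
      (‖fourierL2 u ξ‖ ^ 2 + freq ξ ^ (2 * s) * ‖fourierL2 u ξ‖ ^ 2)) ^ (1 / 2 : ℝ) := by
  rw [sobolevNorm]
  congr 2; ext ξ
  have h : ‖fourierL2 u ξ‖ₑ ^ 2 = ENNReal.ofReal (‖fourierL2 u ξ‖ ^ 2) := by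
    rw [ENNReal.ofReal_pow (norm_nonneg _), ofReal_norm]
  rw [h, ← ENNReal.ofReal_mul' (sq_nonneg _), add_mul, one_mul]; rfl

theorem mem_H_iff {s : ℝ} {u : L2R} : u ∈ H s ↔ SobFinite (2 * s) u := by
  have hm := (integrable_norm_sq (fourierL2 u)).aestronglyMeasurable.add
    (aestronglyMeasurable_sob (2 * s) u)
  have hn : ∀ ξ, 0 ≤ ‖fourierL2 u ξ‖ ^ 2 + freq ξ ^ (2 * s) * ‖fourierL2 u ξ‖ ^ 2 := fun ξ =>
    add_nonneg (sq_nonneg _) (mul_nonneg (freq_rpow_nonneg _ ξ) (sq_nonneg _))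
  have h1 : u ∈ H s ↔ Integrable fun ξ =>
      ‖fourierL2 u ξ‖ ^ 2 + freq ξ ^ (2 * s) * ‖fourierL2 u ξ‖ ^ 2 := by
    rw [H, mem_ofPred_eq, sobolevNorm_eq_lintegral, ENNReal.rpow_lt_top_iff_of_pos (by norm_num),
      Integrable, hasFiniteIntegral_iff_ofReal (Eventually.of_forall hn)]
    exact ⟨fun h => ⟨hm, h⟩, fun h => h.2⟩
  rw [h1]
  exact ⟨fun h => (h.sub (integrable_norm_sq (fourierL2 u))).congr
      (Eventually.of_forall fun ξ => by simp),
    fun h => (integrable_norm_sq (fourierL2 u)).add h⟩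

theorem sobolevNorm_eq {s : ℝ} {u : L2R} (hu : SobFinite (2 * s) u) :
    sobolevNorm s u = ENNReal.ofReal (Real.sqrt (hsq s u)) := by
  have hn : ∀ ξ, 0 ≤ ‖fourierL2 u ξ‖ ^ 2 + freq ξ ^ (2 * s) * ‖fourierL2 u ξ‖ ^ 2 := fun ξ =>
    add_nonneg (sq_nonneg _) (mul_nonneg (freq_rpow_nonneg _ ξ) (sq_nonneg _))
  have hi : Integrable fun ξ =>
      ‖fourierL2 u ξ‖ ^ 2 + freq ξ ^ (2 * s) * ‖fourierL2 u ξ‖ ^ 2 :=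
    (integrable_norm_sq (fourierL2 u)).add hu
  rw [sobolevNorm_eq_lintegral, ← ofReal_integral_eq_lintegral_ofReal hi
    (Eventually.of_forall hn), integral_add (integrable_norm_sq (fourierL2 u)) hu, ← norm_sq_eq_integral_fourierL2,
    Real.sqrt_eq_rpow]
  exact ENNReal.ofReal_rpow_of_nonneg (hsq_nonneg s u) (by norm_num)

theorem energy_eq (s : ℝ) (W : ℝ → ℝ) (u : L2R) :
    energy s W u = 1 / 2 * sob (2 * s) u + ∫ x, W (u x) := rfl

/-! ### Interpolation of weights -/

theorem rpow_le_one_add_rpow {z β σ : ℝ} (hz : 0 ≤ z) (hβ : 0 ≤ β) (h : β ≤ σ) :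
    z ^ β ≤ 1 + z ^ σ := by
  rcases le_total z 1 with h1 | h1
  · linarith [Real.rpow_le_one hz h1 hβ, Real.rpow_nonneg hz σ]
  · linarith [Real.rpow_le_rpow_of_exponent_le h1 h]

theorem exists_rpow_le_add_mul {β σ ε : ℝ} (hβ : 0 < β) (h : β ≤ σ) (hε : 0 < ε) :
    ∃ C, 0 ≤ C ∧ ∀ z : ℝ, 0 ≤ z → z ^ β ≤ ε + C * z ^ σ := by
  have hr : 0 < ε ^ (1 / β) := Real.rpow_pos_of_pos hε _
  refine ⟨(ε ^ (1 / β)) ^ (β - σ), by positivity, fun z hz => ?_⟩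
  rcases le_total z (ε ^ (1 / β)) with h1 | h1
  · have : z ^ β ≤ ε := by
      calc z ^ β ≤ (ε ^ (1 / β)) ^ β := Real.rpow_le_rpow hz h1 hβ.le
        _ = ε := by rw [← Real.rpow_mul hε.le, one_div_mul_cancel hβ.ne', Real.rpow_one]
    have : 0 ≤ (ε ^ (1 / β)) ^ (β - σ) * z ^ σ := by positivity
    linarith
  · have hz' : 0 < z := hr.trans_le h1
    have : z ^ β = z ^ (β - σ) * z ^ σ := by rw [← Real.rpow_add hz']; simp
    rw [this]
    have h2 : z ^ (β - σ) ≤ (ε ^ (1 / β)) ^ (β - σ) :=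
      Real.rpow_le_rpow_of_nonpos hr h1 (by linarith)
    have := mul_le_mul_of_nonneg_right h2 (Real.rpow_nonneg hz σ)
    linarith

theorem exists_rpow_le_mul_add {β σ ε : ℝ} (hβ : 0 ≤ β) (h : β < σ) (hε : 0 < ε) :
    ∃ C, 0 ≤ C ∧ ∀ z : ℝ, 0 ≤ z → z ^ β ≤ ε * z ^ σ + C := by
  have hr : 0 < ε ^ (1 / (β - σ)) := Real.rpow_pos_of_pos hε _
  refine ⟨(ε ^ (1 / (β - σ))) ^ β, by positivity, fun z hz => ?_⟩
  rcases le_total z (ε ^ (1 / (β - σ))) with h1 | h1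
  · have := Real.rpow_le_rpow hz h1 hβ
    have : 0 ≤ ε * z ^ σ := by positivity
    linarith
  · have hz' : 0 < z := hr.trans_le h1
    have : z ^ β = z ^ (β - σ) * z ^ σ := by rw [← Real.rpow_add hz']; simp
    rw [this]
    have h2 : z ^ (β - σ) ≤ ε := by
      calc z ^ (β - σ) ≤ (ε ^ (1 / (β - σ))) ^ (β - σ) :=
            Real.rpow_le_rpow_of_nonpos hr h1 (by linarith)
        _ = ε := by
            rw [← Real.rpow_mul hε.le, one_div_mul_cancel (by linarith), Real.rpow_one]
    have := mul_le_mul_of_nonneg_right h2 (Real.rpow_nonneg hz σ)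
    have h3 : 0 ≤ (ε ^ (1 / (β - σ))) ^ β := by positivity
    linarith

theorem sobFinite_zero (u : L2R) : SobFinite 0 u := by
  simpa [SobFinite] using integrable_norm_sq (fourierL2 u)

theorem sob_zero (u : L2R) : sob 0 u = ‖u‖ ^ 2 := by
  simp [sob, norm_sq_eq_integral_fourierL2]

theorem SobFinite.mono {σ β a b : ℝ} {u : L2R} (hu : SobFinite σ u)
    (h : ∀ z : ℝ, 0 ≤ z → z ^ β ≤ a + b * z ^ σ) :
    SobFinite β u ∧ sob β u ≤ a * ‖u‖ ^ 2 + b * sob σ u := by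
  have hi : Integrable fun ξ => a * ‖fourierL2 u ξ‖ ^ 2
      + b * (freq ξ ^ σ * ‖fourierL2 u ξ‖ ^ 2) :=
    ((integrable_norm_sq _).const_mul a).add (Integrable.const_mul hu b)
  have hle : ∀ ξ, freq ξ ^ β * ‖fourierL2 u ξ‖ ^ 2 ≤ a * ‖fourierL2 u ξ‖ ^ 2
      + b * (freq ξ ^ σ * ‖fourierL2 u ξ‖ ^ 2) := fun ξ => by
    have := mul_le_mul_of_nonneg_right (h _ (freq_nonneg ξ)) (sq_nonneg ‖fourierL2 u ξ‖)
    linarith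
  have hf : SobFinite β u := by
    refine hi.mono' (aestronglyMeasurable_sob β u) (Eventually.of_forall fun ξ => ?_)
    rw [Real.norm_of_nonneg (mul_nonneg (freq_rpow_nonneg _ _) (sq_nonneg _))]
    exact hle ξ
  refine ⟨hf, ?_⟩
  rw [norm_sq_eq_integral_fourierL2, sob, sob, ← integral_const_mul, ← integral_const_mul,
    ← integral_add ((integrable_norm_sq _).const_mul a) (Integrable.const_mul hu b)]
  exact integral_mono hf hi hle

theorem SobFinite.of_le {s β : ℝ} {u : L2R} (hu : SobFinite (2 * s) u) (hβ : 0 ≤ β)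
    (h : β ≤ 2 * s) : SobFinite β u ∧ sob β u ≤ hsq s u := by
  have := hu.mono (β := β) (a := 1) (b := 1) fun z hz => by
    simpa using rpow_le_one_add_rpow hz hβ h
  simpa [hsq] using this

/-! ### Low frequencies -/

/-- The frequencies below `k`. -/
def lowSet (k : ℝ) : Set ℝ := {ξ | freq ξ < k}

theorem measurableSet_lowSet (k : ℝ) : MeasurableSet (lowSet k) :=
  measurableSet_lt continuous_freq.measurable measurable_const

theorem lowSet_eq (k : ℝ) : lowSet k = Ioo (-(k / (2 * Real.pi))) (k / (2 * Real.pi)) := by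
  ext ξ
  have h2 : (0 : ℝ) < 2 * Real.pi := by positivity
  rw [lowSet, mem_ofPred_eq, freq, abs_mul, abs_of_pos h2, ← lt_div_iff₀' h2, abs_lt]; rfl

theorem volume_lowSet_lt_top (k : ℝ) : volume (lowSet k) < ⊤ := by
  rw [lowSet_eq]; exact measure_Ioo_lt_top

/-- The part of `u` with frequencies below `k`. -/
def low (k : ℝ) (u : L2R) (x : ℝ) : ℂ := ∫ ξ in lowSet k, phase (-x) ξ * fourierL2 u ξ

theorem integrableOn_lowSet (k : ℝ) (f : L2C) : IntegrableOn f (lowSet k) := by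
  have : IsFiniteMeasure (volume.restrict (lowSet k)) :=
    ⟨by simpa using volume_lowSet_lt_top k⟩
  exact ((Lp.memLp f).restrict (lowSet k)).integrable (by norm_num)

theorem norm_low_le (k : ℝ) (u : L2R) (x : ℝ) :
    ‖low k u x‖ ≤ ∫ ξ in lowSet k, ‖fourierL2 u ξ‖ := by
  refine (norm_integral_le_integral_norm _).trans (le_of_eq ?_)
  simp [norm_phase]

/-- The truncated transform lies in `L¹` and in `L²`, so `low k u` is at once a pointwise integral
and an `L²` inverse transform. Plancherel's identity then applies to the difference. -/
theorem lintegral_sub_low (k : ℝ) (u : L2R) :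
    ∫⁻ x, ‖(u x : ℂ) - low k u x‖ₑ ^ 2 = ∫⁻ ξ in (lowSet k)ᶜ, ‖fourierL2 u ξ‖ₑ ^ 2 := by
  set f := fourierL2 u with hf
  have h1 : Integrable ((lowSet k).indicator f) :=
    (integrable_indicator_iff (measurableSet_lowSet k)).2 (integrableOn_lowSet k f)
  have h2 : MemLp ((lowSet k).indicator f) 2 := (Lp.memLp f).indicator (measurableSet_lowSet k)
  set g : L2C := h2.toLp _
  have hg : (𝓕⁻ g : L2C) =ᵐ[volume] low k u := by
    refine (fourierInv_toLp_ae h1 h2).trans (Eventually.of_forall fun x => ?_)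
    rw [fourierInv_eq_phase, low, ← integral_indicator (measurableSet_lowSet k)]
    congr 1; ext ξ
    by_cases h : ξ ∈ lowSet k <;> simp [h, hf]
  have he : toC u - 𝓕⁻ g = 𝓕⁻ (f - g) := by
    have : 𝓕⁻ f = toC u := by
      rw [hf, fourierL2_def]; exact FourierTransform.fourierInv_fourier_eq _
    rw [← this]
    exact (map_sub (Lp.fourierTransformₗᵢ ℝ ℂ).symm f g).symm
  have hn : eLpNorm (toC u - 𝓕⁻ g : L2C) 2 volume = eLpNorm (f - g : L2C) 2 volume := by
    rw [he, ← Lp.enorm_def, ← Lp.enorm_def]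
    have h3 := Lp.norm_fourier_eq (𝓕⁻ (f - g) : L2C)
    rw [FourierTransform.fourier_fourierInv_eq] at h3
    rw [← ofReal_norm, ← ofReal_norm, h3]
  have hsq : ∀ h : ℝ → ℂ, ∫⁻ x, ‖h x‖ₑ ^ 2 = eLpNorm h 2 volume ^ 2 := fun h => by
    rw [eLpNorm_eq_lintegral_rpow_enorm_toReal (by norm_num) (by norm_num), ← ENNReal.rpow_natCast,
      ← ENNReal.rpow_mul]
    simp
  have e1 : ∫⁻ x, ‖(u x : ℂ) - low k u x‖ₑ ^ 2 = ∫⁻ x, ‖(toC u - 𝓕⁻ g : L2C) x‖ₑ ^ 2 := by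
    apply lintegral_congr_ae
    filter_upwards [hg, toC_ae u, Lp.coeFn_sub (toC u) (𝓕⁻ g)] with x a b c
    rw [c, Pi.sub_apply, a, b]
  rw [e1, hsq, hn, ← hsq, ← lintegral_indicator (measurableSet_lowSet k).compl]
  apply lintegral_congr_ae
  filter_upwards [h2.coeFn_toLp, Lp.coeFn_sub f g] with ξ a b
  rw [b, Pi.sub_apply, a]
  by_cases h : ξ ∈ lowSet k <;> simp [h]

theorem measurable_low (k : ℝ) (u : L2R) : AEStronglyMeasurable (low k u) volume := by
  apply AEStronglyMeasurable.integral_prod_right' (f := fun p : ℝ × ℝ => phase (-p.1) p.2 * fourierL2 u p.2)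
  refine Measurable.aestronglyMeasurable ?_
  refine Measurable.mul ?_ ((measurable_fourierL2 u).comp measurable_snd)
  exact (continuous_phase.comp (by fun_prop : Continuous fun p : ℝ × ℝ => (-p.1, p.2))).measurable

/-- Where `|u| > t` and the low part is at most `t / 2`, the high part is at least `t / 2`;
Chebyshev's inequality and Plancherel's identity conclude. -/
theorem volume_lt_abs_le {u : L2R} {k t : ℝ} (ht : 0 < t)
    (h : ∫ ξ in lowSet k, ‖fourierL2 u ξ‖ ≤ t / 2) :
    volume {x | t < |u x|} ≤ ENNReal.ofReal (4 / t ^ 2) * ∫⁻ ξ in (lowSet k)ᶜ, ‖fourierL2 u ξ‖ₑ ^ 2 := by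
  have hsub : {x | t < |u x|} ⊆ {x | ENNReal.ofReal (t ^ 2 / 4) ≤ ‖(u x : ℂ) - low k u x‖ₑ ^ 2} := by
    intro x hx
    simp only [mem_ofPred_eq] at hx ⊢
    have h1 : ‖(u x : ℂ)‖ = |u x| := by simp
    have h2 := norm_sub_norm_le (u x : ℂ) (low k u x)
    have h3 := (norm_low_le k u x).trans h
    rw [← ofReal_norm, ← ENNReal.ofReal_pow (norm_nonneg _)]
    apply ENNReal.ofReal_le_ofReal
    have : t / 2 ≤ ‖(u x : ℂ) - low k u x‖ := by linarith
    nlinarith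
  have hm : AEMeasurable (fun x => ‖(u x : ℂ) - low k u x‖ₑ ^ 2) volume :=
    (((Complex.continuous_ofReal.comp_aestronglyMeasurable (Lp.aestronglyMeasurable u)).sub
      (measurable_low k u)).enorm).pow_const 2
  have hmk := mul_meas_ge_le_lintegral₀ hm (ENNReal.ofReal (t ^ 2 / 4))
  rw [lintegral_sub_low] at hmk
  have hpos : 0 < t ^ 2 / 4 := by positivity
  calc volume {x | t < |u x|}
      = ENNReal.ofReal (4 / t ^ 2) * (ENNReal.ofReal (t ^ 2 / 4) * volume {x | t < |u x|}) := by
        rw [← mul_assoc, ← ENNReal.ofReal_mul (by positivity)]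
        have : 4 / t ^ 2 * (t ^ 2 / 4) = 1 := by field_simp
        rw [this]; simp
    _ ≤ _ := by
        gcongr
        exact (mul_le_mul_right (measure_mono hsub) _).trans hmk


/-! ### Bounds in `L^p` -/

theorem lintegral_rpow_Ioc {p X : ℝ} (hp : 2 < p) (hX : 0 ≤ X) :
    ∫⁻ t in Ioc 0 X, ENNReal.ofReal (t ^ (p - 3)) = ENNReal.ofReal (X ^ (p - 2) / (p - 2)) := by
  rw [← ofReal_integral_eq_lintegral_ofReal]
  · rw [← intervalIntegral.integral_of_le hX, integral_rpow (Or.inl (by linarith)),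
      Real.zero_rpow (by linarith)]
    congr 1; ring_nf
  · rw [← IntegrableOn, ← intervalIntegrable_iff_integrableOn_Ioc_of_le hX]
    exact intervalIntegral.intervalIntegrable_rpow' (by linarith)
  · filter_upwards [ae_restrict_mem measurableSet_Ioc] with t ht
    exact Real.rpow_nonneg ht.1.le _

/-- Integration of the distribution function, where low frequencies are used for the part of `u`
below each level. -/
theorem lintegral_rpow_le_of_low {u : L2R} {p α B : ℝ} (hp : 2 < p) (hα : 0 < α) (hB : 0 < B)
    (h : ∀ k : ℝ, 0 < k → ∫ ξ in lowSet k, ‖fourierL2 u ξ‖ ≤ B * k ^ (α / 2)) :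
    ∫⁻ x, ENNReal.ofReal (|u x| ^ p) ≤ ENNReal.ofReal (4 * p / (p - 2) * (2 * B) ^ (p - 2)) *
      ∫⁻ ξ, ENNReal.ofReal (freq ξ ^ (α * (p - 2) / 2) * ‖fourierL2 u ξ‖ ^ 2) := by
  set X : ℝ → ℝ := fun ξ => 2 * B * freq ξ ^ (α / 2) with hX
  have hX0 : ∀ ξ, 0 ≤ X ξ := fun ξ => mul_nonneg (by positivity) (freq_rpow_nonneg _ _)
  have hXm : Measurable X := (measurable_freq_rpow _).const_mul _
  set S : Set (ℝ × ℝ) := {q | q.1 ≤ X q.2} with hS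
  have hSm : MeasurableSet S := measurableSet_le measurable_fst (hXm.comp measurable_snd)
  set F : ℝ → ℝ → ℝ≥0∞ := fun t ξ => S.indicator
    (fun q => ENNReal.ofReal (4 * q.1 ^ (p - 3)) * ‖fourierL2 u q.2‖ₑ ^ 2) (t, ξ) with hF
  have hFm : Measurable (Function.uncurry F) := by
    refine Measurable.indicator ?_ hSm
    have m1 : Measurable fun q : ℝ × ℝ => ENNReal.ofReal (4 * q.1 ^ (p - 3)) :=
      ENNReal.measurable_ofReal.comp ((measurable_fst.pow_const _).const_mul _)
    exact m1.mul ((((measurable_fourierL2 u).comp measurable_snd).enorm).pow_const 2)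
  have key : ∀ t ∈ Ioi (0 : ℝ), volume {x | t < |u x|} * ENNReal.ofReal (t ^ (p - 1))
      ≤ ∫⁻ ξ, F t ξ := by
    intro t ht
    have ht : 0 < t := ht
    -- This cutoff solves `B * k ^ (α / 2) = t / 2`, so that the low part stays below half of the
    -- level.
    set k := (t / (2 * B)) ^ (2 / α) with hk
    have hk0 : 0 < k := by positivity
    have hka : k ^ (α / 2) = t / (2 * B) := by
      rw [hk, ← Real.rpow_mul (by positivity)]
      have : 2 / α * (α / 2) = 1 := by field_simp
      rw [this, Real.rpow_one]
    have h1 := volume_lt_abs_le (u := u) (k := k) ht (by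
      refine (h k hk0).trans (le_of_eq ?_)
      rw [hka]; field_simp)
    calc volume {x | t < |u x|} * ENNReal.ofReal (t ^ (p - 1))
        ≤ (ENNReal.ofReal (4 / t ^ 2) * ∫⁻ ξ in (lowSet k)ᶜ, ‖fourierL2 u ξ‖ₑ ^ 2)
            * ENNReal.ofReal (t ^ (p - 1)) := by gcongr
      _ = ENNReal.ofReal (4 * t ^ (p - 3)) * ∫⁻ ξ in (lowSet k)ᶜ, ‖fourierL2 u ξ‖ₑ ^ 2 := by
          rw [mul_right_comm, ← ENNReal.ofReal_mul (by positivity)]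
          congr 2
          have : t ^ (p - 1) = t ^ (p - 3) * t ^ 2 := by
            rw [← Real.rpow_natCast t 2, ← Real.rpow_add ht]; congr 1; push_cast; ring
          rw [this]; field_simp
      _ ≤ ∫⁻ ξ, F t ξ := by
          rw [← lintegral_indicator (measurableSet_lowSet k).compl, ← lintegral_const_mul' _ _
            ENNReal.ofReal_ne_top]
          apply lintegral_mono
          intro ξ
          by_cases hξ : ξ ∈ (lowSet k)ᶜ
          · have hle : k ≤ freq ξ := by simpa [lowSet] using hξ
            have hmem : (t, ξ) ∈ S := by
              have h2 := Real.rpow_le_rpow hk0.le hle (by positivity : 0 ≤ α / 2)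
              rw [hka, div_le_iff₀ (by positivity)] at h2
              change t ≤ 2 * B * freq ξ ^ (α / 2)
              linarith
            simp only [hF, indicator_of_mem hξ, indicator_of_mem hmem, le_refl]
          · simp [indicator_of_notMem hξ]
  -- After Tonelli, a frequency `ξ` contributes only for levels `t ≤ X ξ`; the power `t ^ (p - 3)`
  -- is integrable at zero because `p > 2`.
  have hinner : ∀ ξ, ∫⁻ t in Ioi (0 : ℝ), F t ξ
      = ENNReal.ofReal (4 / (p - 2) * (2 * B) ^ (p - 2)) *
        ENNReal.ofReal (freq ξ ^ (α * (p - 2) / 2) * ‖fourierL2 u ξ‖ ^ 2) := by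
    intro ξ
    have e1 : ∫⁻ t in Ioi (0 : ℝ), F t ξ
        = ∫⁻ t in Ioc 0 (X ξ), ENNReal.ofReal 4 * ENNReal.ofReal (t ^ (p - 3)) * ‖fourierL2 u ξ‖ₑ ^ 2 := by
      rw [← lintegral_indicator measurableSet_Ioi, ← lintegral_indicator measurableSet_Ioc]
      congr 1; ext t
      by_cases h0 : 0 < t
      · by_cases h1 : t ≤ X ξ
        · have hmem : (t, ξ) ∈ S := h1
          have hI : t ∈ Ioc 0 (X ξ) := ⟨h0, h1⟩
          rw [indicator_of_mem (mem_Ioi.2 h0), indicator_of_mem hI]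
          simp only [hF, indicator_of_mem hmem]
          rw [ENNReal.ofReal_mul (by norm_num)]
        · have hmem : (t, ξ) ∉ S := h1
          rw [indicator_of_mem (mem_Ioi.2 h0),
            indicator_of_notMem (fun h : t ∈ Ioc 0 (X ξ) => h1 h.2)]
          simp only [hF, indicator_of_notMem hmem]
      · have hI : t ∉ Ioi (0 : ℝ) := h0
        rw [indicator_of_notMem hI,
            indicator_of_notMem (fun h : t ∈ Ioc 0 (X ξ) => h0 h.1)]
    rw [e1, lintegral_mul_const' _ _ (by simp), lintegral_const_mul' _ _ ENNReal.ofReal_ne_top,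
      lintegral_rpow_Ioc hp (hX0 ξ), ← ofReal_norm, ← ENNReal.ofReal_pow (norm_nonneg _),
      ← ENNReal.ofReal_mul (by norm_num), ← ENNReal.ofReal_mul, ← ENNReal.ofReal_mul]
    · congr 1
      rw [hX]
      simp only
      rw [Real.mul_rpow (by positivity) (freq_rpow_nonneg _ _), ← Real.rpow_mul (freq_nonneg ξ)]
      have : α / 2 * (p - 2) = α * (p - 2) / 2 := by ring
      rw [this]; ring
    · have : 0 < p - 2 := by linarith
      positivity
    · have : 0 < p - 2 := by linarith
      have := Real.rpow_nonneg (hX0 ξ) (p - 2)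
      positivity
  have hpm : AEMeasurable (fun x => |u x|) volume :=
    (continuous_abs.comp_aestronglyMeasurable (Lp.aestronglyMeasurable u)).aemeasurable
  rw [lintegral_rpow_eq_lintegral_meas_lt_mul volume (Eventually.of_forall fun x => abs_nonneg _)
    hpm (by linarith : 0 < p)]
  calc ENNReal.ofReal p * ∫⁻ t in Ioi 0, volume {a | t < |u a|} * ENNReal.ofReal (t ^ (p - 1))
      ≤ ENNReal.ofReal p * ∫⁻ t in Ioi (0 : ℝ), ∫⁻ ξ, F t ξ := by
        gcongr ENNReal.ofReal p * ?_
        exact setLIntegral_mono' measurableSet_Ioi key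
    _ = ENNReal.ofReal p * ∫⁻ ξ, ∫⁻ t in Ioi (0 : ℝ), F t ξ := by
        rw [lintegral_lintegral_swap]
        exact hFm.aemeasurable
    _ = _ := by
        simp only [hinner]
        rw [lintegral_const_mul' _ _ ENNReal.ofReal_ne_top, ← mul_assoc,
          ← ENNReal.ofReal_mul (by linarith)]
        congr 2; ring

theorem lintegral_lowSet_freq_rpow {α k : ℝ} (hα : 0 < α) (hk : 0 < k) :
    IntegrableOn (fun ξ => freq ξ ^ (α - 1)) (lowSet k) ∧
      ∫ ξ in lowSet k, freq ξ ^ (α - 1) = k ^ α / (Real.pi * α) := by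
  have hpi : (0 : ℝ) < 2 * Real.pi := by positivity
  set r := k / (2 * Real.pi) with hr
  have hr0 : 0 < r := by positivity
  have hset : lowSet k = Ioo (-r) r := lowSet_eq k
  have hpos : IntegrableOn (fun ξ => freq ξ ^ (α - 1)) (Ioo 0 r) ∧
      ∫ ξ in Ioo 0 r, freq ξ ^ (α - 1) = k ^ α / (2 * Real.pi * α) := by
    have e : EqOn (fun ξ => freq ξ ^ (α - 1)) (fun ξ => (2 * Real.pi) ^ (α - 1) * ξ ^ (α - 1))
        (Ioo 0 r) := fun ξ hξ => by
      have : freq ξ = 2 * Real.pi * ξ := abs_of_nonneg (mul_nonneg hpi.le hξ.1.le)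
      simp only [this]
      rw [Real.mul_rpow hpi.le hξ.1.le]
    have hi : IntegrableOn (fun ξ : ℝ => ξ ^ (α - 1)) (Ioo 0 r) := by
      rw [← integrableOn_Ioc_iff_integrableOn_Ioo, ← intervalIntegrable_iff_integrableOn_Ioc_of_le hr0.le]
      exact intervalIntegral.intervalIntegrable_rpow' (by linarith)
    refine ⟨(integrableOn_congr_fun e measurableSet_Ioo).2 (hi.const_mul _), ?_⟩
    rw [setIntegral_congr_fun measurableSet_Ioo e, integral_const_mul, ← integral_Ioc_eq_integral_Ioo,
      ← intervalIntegral.integral_of_le hr0.le, integral_rpow (Or.inl (by linarith)),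
      Real.zero_rpow (by linarith), hr, sub_add_cancel, Real.div_rpow hk.le hpi.le,
      Real.rpow_sub hpi, Real.rpow_one]
    have := (Real.rpow_pos_of_pos hpi α).ne'
    field_simp
    ring
  have hneg : IntegrableOn (fun ξ => freq ξ ^ (α - 1)) (Ioo (-r) 0) ∧
      ∫ ξ in Ioo (-r) 0, freq ξ ^ (α - 1) = k ^ α / (2 * Real.pi * α) := by
    have hpre : (fun x : ℝ => -x) ⁻¹' Ioo 0 r = Ioo (-r) 0 := by
      ext x; simp [and_comm, neg_lt]
    have hmp := Measure.measurePreserving_neg (volume : Measure ℝ)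
    have hemb : MeasurableEmbedding (fun x : ℝ => -x) := (MeasurableEquiv.neg ℝ).measurableEmbedding
    constructor
    · have := (hmp.integrableOn_comp_preimage hemb).2 hpos.1
      rw [hpre] at this
      simpa [Function.comp_def, freq_neg] using this
    · have := hmp.setIntegral_preimage_emb hemb (fun ξ => freq ξ ^ (α - 1)) (Ioo 0 r)
      rw [hpre, hpos.2] at this
      simpa [freq_neg] using this
  have hae : (Ioo (-r) r : Set ℝ) =ᵐ[volume] (Ioo (-r) 0 ∪ Ioo 0 r : Set ℝ) := by
    have : (Ioo (-r) r : Set ℝ) =ᵐ[volume] (Ioo (-r) r \ {0} : Set ℝ) :=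
      (sdiff_null_ae_eq_self (by simp)).symm
    refine this.trans (Eventually.of_forall fun x => ?_)
    apply propext
    constructor
    · rintro ⟨⟨a, b⟩, c⟩
      rcases lt_or_gt_of_ne (show x ≠ 0 from c) with h | h
      · exact Or.inl ⟨a, h⟩
      · exact Or.inr ⟨h, b⟩
    · rintro (⟨a, b⟩ | ⟨a, b⟩)
      · exact ⟨⟨a, b.trans hr0⟩, b.ne⟩
      · exact ⟨⟨by linarith, b⟩, a.ne'⟩
  rw [hset]
  constructor
  · exact (hneg.1.union hpos.1).congr_set_ae hae
  · rw [setIntegral_congr_set hae, setIntegral_union _ measurableSet_Ioo hneg.1 hpos.1, hneg.2, hpos.2]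
    · field_simp; ring
    · rw [Set.disjoint_left]; intro x h1 h2; exact lt_asymm h1.2 h2.1

/-- Cauchy–Schwarz with the weights `freq ^ ((α - 1) / 2)` and `freq ^ ((1 - α) / 2)`; the square of
the first is integrable near the origin because `α > 0`. -/
theorem integral_lowSet_norm_le {u : L2R} {α k A : ℝ} (hα : 0 < α) (hk : 0 < k)
    (hu : SobFinite (1 - α) u) (hA : sob (1 - α) u ≤ A) :
    ∫ ξ in lowSet k, ‖fourierL2 u ξ‖ ≤ Real.sqrt (A / (Real.pi * α)) * k ^ (α / 2) := by
  obtain ⟨hi, hv⟩ := lintegral_lowSet_freq_rpow hα hk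
  set f : ℝ → ℝ := fun ξ => freq ξ ^ ((α - 1) / 2)
  set g : ℝ → ℝ := fun ξ => freq ξ ^ ((1 - α) / 2) * ‖fourierL2 u ξ‖
  have hf2 : ∀ ξ, f ξ ^ 2 = freq ξ ^ (α - 1) := fun ξ => by
    rw [← Real.rpow_natCast, ← Real.rpow_mul (freq_nonneg ξ)]; congr 1; push_cast; ring
  have hg2 : ∀ ξ, g ξ ^ 2 = freq ξ ^ (1 - α) * ‖fourierL2 u ξ‖ ^ 2 := fun ξ => by
    rw [mul_pow]; congr 1
    rw [← Real.rpow_natCast, ← Real.rpow_mul (freq_nonneg ξ)]; congr 1; push_cast; ring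
  have hfm : MemLp f 2 (volume.restrict (lowSet k)) := by
    rw [memLp_two_iff_integrable_sq (measurable_freq_rpow _).aestronglyMeasurable]
    exact hi.congr (Eventually.of_forall fun ξ => (hf2 ξ).symm)
  have hgm : MemLp g 2 (volume.restrict (lowSet k)) := by
    have hm : Measurable g := (measurable_freq_rpow _).mul (measurable_fourierL2 u).norm
    rw [memLp_two_iff_integrable_sq hm.aestronglyMeasurable]
    simp only [hg2]
    exact Integrable.integrableOn hu
  have hfg : ∀ᵐ ξ ∂(volume.restrict (lowSet k)), ‖fourierL2 u ξ‖ = f ξ * g ξ := by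
    apply ae_restrict_of_ae
    have : ∀ᵐ ξ : ℝ, ξ ≠ 0 := by simp [ae_iff]
    filter_upwards [this] with ξ hξ
    have hp : 0 < freq ξ := abs_pos.2 (mul_ne_zero (by positivity) hξ)
    simp only [f, g]
    rw [← mul_assoc, ← Real.rpow_add hp]
    have : (α - 1) / 2 + (1 - α) / 2 = 0 := by ring
    rw [this, Real.rpow_zero, one_mul]
  rw [integral_congr_ae hfg]
  have hcs := integral_mul_le_Lp_mul_Lq_of_nonneg Real.HolderConjugate.two_two
    (μ := volume.restrict (lowSet k)) (f := f) (g := g)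
    (Eventually.of_forall fun ξ => freq_rpow_nonneg _ _)
    (Eventually.of_forall fun ξ => mul_nonneg (freq_rpow_nonneg _ _) (norm_nonneg _))
    (by simpa using hfm) (by simpa using hgm)
  refine hcs.trans ?_
  simp only [Real.rpow_two, hf2, hg2, hv]
  have h1 : ∫ ξ in lowSet k, freq ξ ^ (1 - α) * ‖fourierL2 u ξ‖ ^ 2 ≤ A :=
    (setIntegral_le_integral hu (Eventually.of_forall fun ξ =>
      mul_nonneg (freq_rpow_nonneg _ _) (sq_nonneg _))).trans hA
  have h0 : 0 ≤ ∫ ξ in lowSet k, freq ξ ^ (1 - α) * ‖fourierL2 u ξ‖ ^ 2 :=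
    integral_nonneg fun ξ => mul_nonneg (freq_rpow_nonneg _ _) (sq_nonneg _)
  have hA0 : 0 ≤ A := h0.trans h1
  calc (k ^ α / (Real.pi * α)) ^ (1 / 2 : ℝ) *
        (∫ ξ in lowSet k, freq ξ ^ (1 - α) * ‖fourierL2 u ξ‖ ^ 2) ^ (1 / 2 : ℝ)
      ≤ (k ^ α / (Real.pi * α)) ^ (1 / 2 : ℝ) * A ^ (1 / 2 : ℝ) := by gcongr
    _ = Real.sqrt (A / (Real.pi * α)) * k ^ (α / 2) := by
        rw [Real.sqrt_eq_rpow, ← Real.mul_rpow (by positivity) hA0]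
        have : k ^ α / (Real.pi * α) * A = A / (Real.pi * α) * k ^ α := by ring
        rw [this, Real.mul_rpow (by positivity) (by positivity), ← Real.rpow_mul hk.le]
        congr 2; ring

/-- The parameter `α` distributes the regularity between the two seminorms. Two values matter: `α =
2 / p`, where both have the same order, and `α = 1`, where the first is the `L²` norm. -/
theorem integral_rpow_le_of_sob {p α : ℝ} (hp : 2 < p) (hα : 0 < α) :
    ∃ C, 0 ≤ C ∧ ∀ (u : L2R) (A : ℝ), 0 < A → SobFinite (1 - α) u → sob (1 - α) u ≤ A →
      SobFinite (α * (p - 2) / 2) u →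
      Integrable (fun x => |u x| ^ p) ∧
        ∫ x, |u x| ^ p ≤ C * A ^ ((p - 2) / 2) * sob (α * (p - 2) / 2) u := by
  have hp2 : 0 < p - 2 := by linarith
  refine ⟨4 * p / (p - 2) * (2 * Real.sqrt (1 / (Real.pi * α))) ^ (p - 2), by positivity, ?_⟩
  intro u A hA hu hle hf
  have hB : 0 < Real.sqrt (A / (Real.pi * α)) := Real.sqrt_pos.2 (by positivity)
  have h := lintegral_rpow_le_of_low (u := u) hp hα hB
    (fun k hk => integral_lowSet_norm_le hα hk hu hle)
  rw [← ofReal_integral_eq_lintegral_ofReal hf (Eventually.of_forall fun ξ =>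
    mul_nonneg (freq_rpow_nonneg _ _) (sq_nonneg _)), ← ENNReal.ofReal_mul (by positivity)] at h
  have hn : ∀ x, 0 ≤ |u x| ^ p := fun x => Real.rpow_nonneg (abs_nonneg _) _
  have hm : AEStronglyMeasurable (fun x => |u x| ^ p) volume := by
    have : Measurable fun x => |u x| ^ p :=
      ((Lp.stronglyMeasurable u).measurable.abs).pow_const p
    exact this.aestronglyMeasurable
  have hi : Integrable (fun x => |u x| ^ p) :=
    ⟨hm, (hasFiniteIntegral_iff_ofReal (Eventually.of_forall hn)).2
      (h.trans_lt ENNReal.ofReal_lt_top)⟩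
  refine ⟨hi, ?_⟩
  rw [← ofReal_integral_eq_lintegral_ofReal hi (Eventually.of_forall hn)] at h
  have h2 := (ENNReal.ofReal_le_ofReal_iff (mul_nonneg (by positivity) (sob_nonneg _ _))).1 h
  refine h2.trans (le_of_eq ?_)
  congr 1
  rw [mul_assoc]
  congr 1
  have e : Real.sqrt (A / (Real.pi * α)) = Real.sqrt (1 / (Real.pi * α)) * Real.sqrt A := by
    rw [← Real.sqrt_mul (by positivity)]; congr 1; ring
  rw [e, ← mul_assoc, Real.mul_rpow (by positivity) (by positivity), Real.sqrt_eq_rpow A,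
    ← Real.rpow_mul hA.le]
  congr 2; ring


/-! ### Integrals of powers of functions in `H^s` -/

theorem measurable_L2R (u : L2R) : Measurable u := (Lp.stronglyMeasurable u).measurable

theorem integrable_sq (u : L2R) : Integrable fun x => |u x| ^ 2 := by
  simpa using (Lp.memLp u).integrable_norm_pow (p := 2) (by norm_num)

theorem integral_abs_sq (u : L2R) : ∫ x, |u x| ^ 2 = ‖u‖ ^ 2 := by
  simp only [sq_abs, norm_sq_L2R]

theorem norm_sq_le_hsq (s : ℝ) (u : L2R) : ‖u‖ ^ 2 ≤ hsq s u :=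
  le_add_of_nonneg_right (sob_nonneg _ _)

theorem sob_le_hsq (s : ℝ) (u : L2R) : sob (2 * s) u ≤ hsq s u :=
  le_add_of_nonneg_left (sq_nonneg _)

theorem integral_mul_le_sqrt_mul_sqrt {f g : ℝ → ℝ} (hf : MemLp f 2) (hg : MemLp g 2)
    (hf0 : ∀ x, 0 ≤ f x) (hg0 : ∀ x, 0 ≤ g x) :
    Integrable (fun x => f x * g x) ∧
      ∫ x, f x * g x ≤ Real.sqrt (∫ x, f x ^ 2) * Real.sqrt (∫ x, g x ^ 2) := by
  refine ⟨hf.integrable_mul hg, ?_⟩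
  have := integral_mul_le_Lp_mul_Lq_of_nonneg Real.HolderConjugate.two_two (μ := volume)
    (Eventually.of_forall hf0) (Eventually.of_forall hg0) (by simpa using hf) (by simpa using hg)
  simpa [Real.sqrt_eq_rpow] using this

/-- Bound of `∫ |u|^p` by an intermediate seminorm, for functions in a ball of `H^s`. -/
theorem exists_integral_rpow_le {s p : ℝ} (hs : 1 / 2 ≤ s) (hp : 2 < p) :
    ∃ C, 0 ≤ C ∧ ∀ (u : L2R) (M : ℝ), 0 < M → SobFinite (2 * s) u → hsq s u ≤ M →
      Integrable (fun x => |u x| ^ p) ∧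
        ∫ x, |u x| ^ p ≤ C * M ^ ((p - 2) / 2) * sob (1 - 2 / p) u := by
  -- With `α = 2 / p` both seminorms have order parameter `1 - 2 / p < 1 ≤ 2 * s`.
  have hα : 0 < 2 / p := by positivity
  have hα1 : 2 / p < 1 := by rw [div_lt_one (by linarith)]; exact hp
  obtain ⟨C, hC, h⟩ := integral_rpow_le_of_sob hp hα
  refine ⟨C, hC, fun u M hM hu hle => ?_⟩
  obtain ⟨h1, h2⟩ := hu.of_le (β := 1 - 2 / p) (by linarith) (by linarith)
  have e : 2 / p * (p - 2) / 2 = 1 - 2 / p := by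
    have : p ≠ 0 := by linarith
    field_simp
  have := h u M hM h1 (h2.trans hle) (by rw [e]; exact h1)
  rwa [e] at this

theorem exists_integral_pow_le {s : ℝ} (hs : 1 / 2 ≤ s) {n : ℕ} (hn : 2 ≤ n) (M : ℝ) :
    ∃ C, 0 ≤ C ∧ ∀ u : L2R, SobFinite (2 * s) u → hsq s u ≤ M →
      Integrable (fun x => |u x| ^ n) ∧ ∫ x, |u x| ^ n ≤ C := by
  rcases hn.eq_or_lt with rfl | hn
  · refine ⟨|M|, abs_nonneg _, fun u _ hM => ⟨integrable_sq u, ?_⟩⟩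
    rw [integral_abs_sq]
    exact (norm_sq_le_hsq s u).trans (hM.trans (le_abs_self _))
  · have hp : (2 : ℝ) < n := by exact_mod_cast hn
    obtain ⟨C, hC, h⟩ := exists_integral_rpow_le hs hp
    have hM' : 0 < |M| + 1 := by positivity
    refine ⟨C * (|M| + 1) ^ (((n : ℝ) - 2) / 2) * (|M| + 1), by positivity, fun u hu hM => ?_⟩
    have hle : hsq s u ≤ |M| + 1 := hM.trans (by linarith [le_abs_self M])
    have := h u (|M| + 1) hM' hu hle
    simp only [Real.rpow_natCast] at this
    refine ⟨this.1, this.2.trans ?_⟩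
    have h2 := (hu.of_le (β := 1 - 2 / n) (by
      rw [sub_nonneg, div_le_one (by linarith)]; exact hp.le) (by
      have : (0 : ℝ) < 2 / n := by positivity
      linarith)).2.trans hle
    gcongr

theorem integrable_pow {s : ℝ} (hs : 1 / 2 ≤ s) {n : ℕ} (hn : 2 ≤ n) {u : L2R}
    (hu : SobFinite (2 * s) u) : Integrable (fun x => |u x| ^ n) := by
  obtain ⟨C, _, h⟩ := exists_integral_pow_le hs hn (hsq s u)
  exact (h u hu le_rfl).1

theorem memLp_pow {s : ℝ} (hs : 1 / 2 ≤ s) {n : ℕ} (hn : 1 ≤ n) {u : L2R}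
    (hu : SobFinite (2 * s) u) : MemLp (fun x => |u x| ^ n) 2 := by
  rw [memLp_two_iff_integrable_sq ((measurable_L2R u).abs.pow_const n).aestronglyMeasurable]
  simp only [← pow_mul]
  exact integrable_pow hs (by omega) hu

/-- In a ball of `H^s`, a small homogeneous seminorm makes `∫ |u|^n` small. -/
theorem exists_integral_pow_lt {s : ℝ} (hs : 1 / 2 ≤ s) {n : ℕ} (hn : 3 ≤ n) (M : ℝ) {η : ℝ}
    (hη : 0 < η) : ∃ τ, 0 < τ ∧ ∀ u : L2R, SobFinite (2 * s) u → hsq s u ≤ M →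
      sob (2 * s) u ≤ τ → ∫ x, |u x| ^ n < η := by
  have hp : (2 : ℝ) < n := by exact_mod_cast (by omega : 2 < n)
  obtain ⟨C, hC, h⟩ := exists_integral_rpow_le hs hp
  set M' := |M| + 1
  have hM' : 0 < M' := by positivity
  set D := C * M' ^ (((n : ℝ) - 2) / 2) + 1 with hD
  have hD0 : 0 < D := by positivity
  have hβ : 0 < 1 - 2 / (n : ℝ) := by
    rw [sub_pos, div_lt_one (by linarith)]; exact hp
  have hβ2 : 1 - 2 / (n : ℝ) ≤ 2 * s := by
    have : (0 : ℝ) < 2 / n := by positivity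
    linarith
  -- The order `1 - 2 / n` is strictly positive, so its weight is at most a small constant plus a
  -- multiple of `freq ^ (2 * s)`: the first part is paid by the bound `M'` on the `L²` norm, the
  -- second by the small seminorm.
  have hε : 0 < η / (4 * D * M') := by positivity
  obtain ⟨K, hK, hz⟩ := exists_rpow_le_add_mul hβ hβ2 hε
  refine ⟨η / (4 * D * (K + 1)), by positivity, fun u hu hM hτ => ?_⟩
  have hle : hsq s u ≤ M' := hM.trans (by simp only [M']; linarith [le_abs_self M])
  have h1 := (h u M' hM' hu hle).2
  simp only [Real.rpow_natCast] at h1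
  have h2 := (hu.mono hz).2
  have h3 : η / (4 * D * M') * ‖u‖ ^ 2 ≤ η / (4 * D) := by
    calc η / (4 * D * M') * ‖u‖ ^ 2 ≤ η / (4 * D * M') * M' := by
          gcongr; exact (norm_sq_le_hsq s u).trans hle
      _ = η / (4 * D) := by field_simp
  have h4 : K * sob (2 * s) u ≤ η / (4 * D) := by
    calc K * sob (2 * s) u ≤ (K + 1) * (η / (4 * D * (K + 1))) := by
          gcongr
          · exact sob_nonneg _ _
          · linarith
      _ = η / (4 * D) := by field_simp
  have h5 : sob (1 - 2 / (n : ℝ)) u ≤ η / (2 * D) := by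
    have : η / (4 * D) + η / (4 * D) = η / (2 * D) := by field_simp; ring
    linarith
  calc ∫ x, |u x| ^ n ≤ C * M' ^ (((n : ℝ) - 2) / 2) * sob (1 - 2 / (n : ℝ)) u := h1
    _ ≤ D * (η / (2 * D)) := by
        gcongr
        · exact sob_nonneg _ _
        · linarith
    _ = η / 2 := by field_simp
    _ < η := by linarith

/-- In the subcritical range, `∫ |u|^p` is controlled by a small multiple of the seminorm. -/
theorem exists_integral_rpow_le_eps {s p : ℝ} (hp : 2 < p) (hp2 : p < 4 * s + 2)
    (c : ℝ) {ε : ℝ} (hε : 0 < ε) :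
    ∃ K, ∀ u : L2R, SobFinite (2 * s) u → ‖u‖ ^ 2 ≤ c → Integrable (fun x => |u x| ^ p) ∧
      ∫ x, |u x| ^ p ≤ ε * sob (2 * s) u + K := by
  -- With `α = 1` only the charge enters nonlinearly, and the remaining order `(p - 2) / 2` is below
  -- `2 * s` exactly because `p < 4 * s + 2`.
  obtain ⟨C, hC, h⟩ := integral_rpow_le_of_sob hp one_pos
  set A := |c| + 1
  have hA : 0 < A := by positivity
  set D := C * A ^ ((p - 2) / 2) + 1 with hD
  have hD0 : 0 < D := by positivity
  have hβ : 0 ≤ 1 * (p - 2) / 2 := by linarith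
  have hβ2 : 1 * (p - 2) / 2 < 2 * s := by linarith
  obtain ⟨K, hK, hz⟩ := exists_rpow_le_mul_add hβ hβ2 (by positivity : 0 < ε / D)
  refine ⟨D * (K * A), fun u hu hc => ?_⟩
  have hle : ‖u‖ ^ 2 ≤ A := hc.trans (by simp only [A]; linarith [le_abs_self c])
  obtain ⟨f1, f2⟩ := hu.mono (β := 1 * (p - 2) / 2) (a := K) (b := ε / D)
    fun z hz0 => by linarith [hz z hz0]
  obtain ⟨i1, i2⟩ := h u A hA (by simpa using sobFinite_zero u) (by simpa [sob_zero] using hle) f1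
  refine ⟨i1, i2.trans ?_⟩
  calc C * A ^ ((p - 2) / 2) * sob (1 * (p - 2) / 2) u
      ≤ D * (K * A + ε / D * sob (2 * s) u) := by
        gcongr
        · exact sob_nonneg _ _
        · linarith
        · exact f2.trans (by gcongr)
    _ = ε * sob (2 * s) u + D * (K * A) := by field_simp; ring

/-! ### Low frequency approximation -/

theorem integral_sub_low_le {s k : ℝ} (hs : 0 < s) (hk : 0 < k) {u : L2R} (hu : SobFinite (2 * s) u) :
    MemLp (fun x => ‖(u x : ℂ) - low k u x‖) 2 ∧
      ∫ x, ‖(u x : ℂ) - low k u x‖ ^ 2 ≤ sob (2 * s) u / k ^ (2 * s) := by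
  have hks : 0 < k ^ (2 * s) := Real.rpow_pos_of_pos hk _
  have hle : ∫⁻ x, ENNReal.ofReal (‖(u x : ℂ) - low k u x‖ ^ 2)
      ≤ ENNReal.ofReal (sob (2 * s) u / k ^ (2 * s)) := by
    have e : ∀ z : ℂ, ENNReal.ofReal (‖z‖ ^ 2) = ‖z‖ₑ ^ 2 := fun z => by
      rw [ENNReal.ofReal_pow (norm_nonneg _), ofReal_norm]
    simp only [e]
    have h0 : ∀ ξ, 0 ≤ freq ξ ^ (2 * s) * ‖fourierL2 u ξ‖ ^ 2 / k ^ (2 * s) := fun ξ =>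
      div_nonneg (mul_nonneg (freq_rpow_nonneg _ _) (sq_nonneg _)) hks.le
    rw [lintegral_sub_low, sob, ← integral_div, ofReal_integral_eq_lintegral_ofReal
      (Integrable.div_const hu _) (Eventually.of_forall h0),
      ← lintegral_indicator (measurableSet_lowSet k).compl]
    apply lintegral_mono
    intro ξ
    by_cases hξ : ξ ∈ (lowSet k)ᶜ
    · simp only [indicator_of_mem hξ, ← e]
      apply ENNReal.ofReal_le_ofReal
      have hf : k ≤ freq ξ := by simpa [lowSet] using hξ
      have := Real.rpow_le_rpow hk.le hf (by linarith : 0 ≤ 2 * s)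
      rw [le_div_iff₀ hks, mul_comm]
      gcongr
    · simp [indicator_of_notMem hξ]
  have hm : AEStronglyMeasurable (fun x => ‖(u x : ℂ) - low k u x‖) volume :=
    ((Complex.continuous_ofReal.comp_aestronglyMeasurable (Lp.aestronglyMeasurable u)).sub
      (measurable_low k u)).norm
  have hi : Integrable fun x => ‖(u x : ℂ) - low k u x‖ ^ 2 :=
    ⟨hm.pow 2, (hasFiniteIntegral_iff_ofReal (Eventually.of_forall fun x => sq_nonneg _)).2
      (hle.trans_lt ENNReal.ofReal_lt_top)⟩
  refine ⟨(memLp_two_iff_integrable_sq hm).2 hi, ?_⟩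
  rw [← ofReal_integral_eq_lintegral_ofReal hi (Eventually.of_forall fun x => sq_nonneg _)] at hle
  exact (ENNReal.ofReal_le_ofReal_iff (div_nonneg (sob_nonneg _ _) hks.le)).1 hle

theorem norm_low_le_norm {k : ℝ} (hk : 0 < k) (u : L2R) (x : ℝ) :
    ‖low k u x‖ ≤ Real.sqrt k * ‖u‖ := by
  refine (norm_low_le k u x).trans ?_
  have := integral_lowSet_norm_le (α := 1) (A := ‖u‖ ^ 2) one_pos hk
    (by simpa using sobFinite_zero u) (by simp [sob_zero])
  refine this.trans ?_
  rw [← Real.sqrt_eq_rpow, mul_comm]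
  gcongr
  rw [Real.sqrt_le_left (norm_nonneg _), mul_one]
  exact div_le_self (sq_nonneg _) (by linarith [Real.pi_gt_three])

/-- Low frequencies control `∫ h |u|`, up to a remainder. -/
theorem integral_mul_abs_le_low {s k : ℝ} (hs : 0 < s) (hk : 0 < k) {u : L2R}
    (hu : SobFinite (2 * s) u) {h : ℝ → ℝ} (h0 : ∀ x, 0 ≤ h x) (h1 : Integrable h)
    (h2 : MemLp h 2) :
    ∫ x, h x * |u x| ≤ (∫ x, h x * ‖low k u x‖)
      + Real.sqrt (∫ x, h x ^ 2) * Real.sqrt (sob (2 * s) u / k ^ (2 * s)) := by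
  obtain ⟨a1, a2⟩ := integral_sub_low_le hs hk hu
  obtain ⟨b1, b2⟩ := integral_mul_le_sqrt_mul_sqrt h2 a1 h0 (fun x => norm_nonneg _)
  have hl : Integrable (fun x => h x * ‖low k u x‖) :=
    h1.mul_bdd (c := Real.sqrt k * ‖u‖) (measurable_low k u).norm
      (Eventually.of_forall fun x => by simpa using norm_low_le_norm hk u x)
  have hu2 : Integrable (fun x => h x * |u x|) := h2.integrable_mul (Lp.memLp u).norm
  calc ∫ x, h x * |u x| ≤ ∫ x, (h x * ‖low k u x‖ + h x * ‖(u x : ℂ) - low k u x‖) := by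
        refine integral_mono hu2 (hl.add b1) fun x => ?_
        have : |u x| ≤ ‖low k u x‖ + ‖(u x : ℂ) - low k u x‖ := by
          have := norm_le_norm_add_norm_sub (low k u x) (u x : ℂ)
          rwa [norm_sub_rev, Complex.norm_real, Real.norm_eq_abs] at this
        simp only
        rw [← mul_add]
        exact mul_le_mul_of_nonneg_left this (h0 x)
    _ = (∫ x, h x * ‖low k u x‖) + ∫ x, h x * ‖(u x : ℂ) - low k u x‖ := integral_add hl b1
    _ ≤ _ := by
        gcongr
        exact b2.trans (by gcongr)


/-! ### Nonlinearities -/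

/-- The properties of the nonlinear part of the potential that are used: it is superquadratic at
zero with polynomial growth, subcritical from below, and takes a negative value. -/
structure Admissible (s : ℝ) (m : ℕ) (N : ℝ → ℝ) : Prop where
  contDiff : ContDiff ℝ 1 N
  zero : N 0 = 0
  two_le : 2 ≤ m
  deriv_le : ∀ ε > 0, ∃ C, 0 ≤ C ∧ ∀ r, |deriv N r| ≤ ε * |r| + C * |r| ^ m
  lower : ∃ p C : ℝ, 2 < p ∧ p < 4 * s + 2 ∧ 0 ≤ C ∧ ∀ r, -(C * (|r| ^ 2 + |r| ^ p)) ≤ N r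
  neg : ∃ r, N r < 0

namespace Admissible

variable {s : ℝ} {m : ℕ} {N : ℝ → ℝ}

theorem differentiable (hN : Admissible s m N) : Differentiable ℝ N :=
  hN.contDiff.differentiable (by norm_num)

theorem continuous (hN : Admissible s m N) : Continuous N := hN.contDiff.continuous

theorem continuous_deriv (hN : Admissible s m N) : Continuous (deriv N) :=
  hN.contDiff.continuous_deriv (by norm_num)

theorem abs_sub_le (hN : Admissible s m N) {ε : ℝ} (hε : 0 < ε) :
    ∃ C, 0 ≤ C ∧ ∀ a b, |N a - N b| ≤ |a - b| * (ε * (|a| + |b|) + C * (|a| ^ m + |b| ^ m)) := by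
  obtain ⟨C, hC, h⟩ := hN.deriv_le ε hε
  refine ⟨C, hC, fun a b => ?_⟩
  have hb : ∀ x ∈ uIcc a b, ‖deriv N x‖ ≤ ε * (|a| + |b|) + C * (|a| ^ m + |b| ^ m) := by
    intro x hx
    have hx' : |x| ≤ max |a| |b| := by
      rcases hx with ⟨h1, h2⟩
      rw [abs_le]
      constructor
      · have : -max |a| |b| ≤ min a b := by
          rw [le_min_iff]
          exact ⟨by linarith [neg_abs_le a, le_max_left |a| |b|],
            by linarith [neg_abs_le b, le_max_right |a| |b|]⟩
        exact this.trans h1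
      · exact h2.trans (max_le ((le_abs_self a).trans (le_max_left _ _))
          ((le_abs_self b).trans (le_max_right _ _)))
    have h1 : |x| ≤ |a| + |b| := hx'.trans (max_le (by linarith [abs_nonneg b])
      (by linarith [abs_nonneg a]))
    have h2 : |x| ^ m ≤ |a| ^ m + |b| ^ m := by
      have ha := pow_nonneg (abs_nonneg a) m
      have hb := pow_nonneg (abs_nonneg b) m
      rcases le_max_iff.1 hx' with h | h
      · linarith [pow_le_pow_left₀ (abs_nonneg x) h m]
      · linarith [pow_le_pow_left₀ (abs_nonneg x) h m]
    refine (h x).trans ?_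
    gcongr
  have := (convex_uIcc a b).norm_image_sub_le_of_norm_deriv_le
    (fun x _ => hN.differentiable x) hb right_mem_uIcc left_mem_uIcc
  rw [Real.norm_eq_abs, Real.norm_eq_abs] at this
  linarith

theorem abs_le (hN : Admissible s m N) {ε : ℝ} (hε : 0 < ε) :
    ∃ C, 0 ≤ C ∧ ∀ r, |N r| ≤ ε * |r| ^ 2 + C * |r| ^ (m + 1) := by
  obtain ⟨C, hC, h⟩ := hN.abs_sub_le hε
  have hm : m ≠ 0 := by have := hN.two_le; omega
  refine ⟨C, hC, fun r => ?_⟩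
  have := h r 0
  simp only [hN.zero, sub_zero, abs_zero, add_zero, zero_pow hm] at this
  calc |N r| ≤ _ := this
    _ = _ := by ring

/-- The nonlinearity is almost additive on functions that live at different places. -/
theorem abs_add_sub_sub_le (hN : Admissible s m N) {ε : ℝ} (hε : 0 < ε) :
    ∃ K, 0 ≤ K ∧ ∀ a b, |N (a + b) - N a - N b| ≤
      ε * (|a| ^ 2 + |b| ^ 2 + |b| ^ (2 * m - 1)) + K * (|a| ^ 2 * |b| + |a| ^ m * |b|) := by
  obtain ⟨C, hC, h⟩ := hN.abs_sub_le (by positivity : 0 < ε / 4)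
  have hm := hN.two_le
  set D := C * (2 ^ m + 2) with hD
  have hD0 : 0 ≤ D := by positivity
  have hm0 : m ≠ 0 := by omega
  have hz : ∀ a, |N a| ≤ |a| * (ε / 4 * |a| + C * |a| ^ m) := fun a => by
    have := h a 0
    simpa [hN.zero, hm0] using this
  -- `x` is the small one
  have key : ∀ x y : ℝ, |x| ≤ |y| →
      |N (x + y) - N x - N y| ≤ ε * (|x| * |y|) + D * (|x| * |y| ^ m) := by
    intro x y hxy
    have h1 := h (x + y) y
    rw [add_sub_cancel_right] at h1
    have h2 : |x + y| ≤ 2 * |y| := (abs_add_le x y).trans (by linarith)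
    have h3 : |x + y| ^ m ≤ 2 ^ m * |y| ^ m := by
      rw [← mul_pow]; exact pow_le_pow_left₀ (abs_nonneg _) h2 m
    have h4 : |x| ^ m ≤ |y| ^ m := pow_le_pow_left₀ (abs_nonneg _) hxy m
    calc |N (x + y) - N x - N y| = |N (x + y) - N y - N x| := by congr 1; ring
      _ ≤ |N (x + y) - N y| + |N x| := abs_sub _ _
      _ ≤ |x| * (ε / 4 * (2 * |y| + |y|) + C * (2 ^ m * |y| ^ m + |y| ^ m))
          + |x| * (ε / 4 * |y| + C * |y| ^ m) := by
          refine add_le_add (h1.trans ?_) ((hz x).trans ?_)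
          · gcongr
          · gcongr
      _ = ε * (|x| * |y|) + D * (|x| * |y| ^ m) := by rw [hD]; ring
  refine ⟨D * (D / ε + 1), by positivity, fun a b => ?_⟩
  have hA := abs_nonneg a
  have hB := abs_nonneg b
  set A := |a|
  set B := |b|
  have hAB : A * B ≤ A ^ 2 + B ^ 2 := by nlinarith [sq_nonneg (A - B), sq_nonneg A, sq_nonneg B]
  have hsym : ∃ X, X ≤ D * (A * B ^ m) + D * (A ^ m * B) ∧
      |N (a + b) - N a - N b| ≤ ε * (A * B) + X := by
    rcases le_total A B with hle | hle
    · exact ⟨D * (A * B ^ m), le_add_of_nonneg_right (by positivity), key a b hle⟩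
    · refine ⟨D * (A ^ m * B), le_add_of_nonneg_left (by positivity), ?_⟩
      have := key b a hle
      rw [add_comm a b, mul_comm A B, mul_comm (A ^ m)]
      calc _ = |N (b + a) - N b - N a| := by congr 1; ring
        _ ≤ _ := this
  obtain ⟨X, hX, hle⟩ := hsym
  -- In the application `a` is fixed and `b` tends weakly to zero, so the large constant may only
  -- stand before terms linear in `B`. The excess powers of `B` are moved by Young's inequality into
  -- the term with factor `ε`, where boundedness is enough.
  have hY : D * (A * B ^ m) ≤ ε * B ^ (2 * m - 1) + D * (D / ε) * (A ^ 2 * B) := by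
    obtain ⟨j, rfl⟩ : ∃ j, m = j + 1 := ⟨m - 1, by omega⟩
    have e : 2 * (j + 1) - 1 = 2 * j + 1 := by omega
    rw [e]
    have hs := sq_nonneg (ε * B ^ j - D * A)
    have h0 : ε * (D * (A * B ^ (j + 1))) ≤
        ε * (ε * B ^ (2 * j + 1) + D * (D / ε) * (A ^ 2 * B)) := by
      have e1 : ε * (ε * B ^ (2 * j + 1) + D * (D / ε) * (A ^ 2 * B))
          = (ε ^ 2 * (B ^ j) ^ 2 + D ^ 2 * A ^ 2) * B := by field_simp; ring
      have e2 : ε * (D * (A * B ^ (j + 1))) = (ε * B ^ j) * (D * A) * B := by ring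
      rw [e1, e2]
      apply mul_le_mul_of_nonneg_right _ hB
      have : 0 ≤ (ε * B ^ j) * (D * A) := by positivity
      nlinarith
    exact le_of_mul_le_mul_left h0 hε
  have hE : D * (A ^ m * B) ≤ D * (D / ε + 1) * (A ^ m * B) := by
    have : 0 ≤ D / ε := by positivity
    have h0 : 0 ≤ A ^ m * B := by positivity
    gcongr
    nlinarith
  have hF : D * (D / ε) * (A ^ 2 * B) ≤ D * (D / ε + 1) * (A ^ 2 * B) := by
    gcongr; linarith
  have := mul_le_mul_of_nonneg_left hAB hε.le
  linarith

theorem integrable (hs : 1 / 2 ≤ s) (hN : Admissible s m N) {u : L2R} (hu : SobFinite (2 * s) u) :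
    Integrable fun x => N (u x) := by
  obtain ⟨C, hC, h⟩ := hN.abs_le one_pos
  refine (((integrable_sq u).const_mul 1).add ((integrable_pow hs (n := m + 1)
    (by have := hN.two_le; omega) hu).const_mul C)).mono'
    (hN.continuous.comp_aestronglyMeasurable (Lp.aestronglyMeasurable u))
    (Eventually.of_forall fun x => h _)

theorem integral_abs_le (hs : 1 / 2 ≤ s) (hN : Admissible s m N) {ε : ℝ} (hε : 0 < ε) :
    ∃ C, 0 ≤ C ∧ ∀ u : L2R, SobFinite (2 * s) u →
      |∫ x, N (u x)| ≤ ε * ‖u‖ ^ 2 + C * ∫ x, |u x| ^ (m + 1) := by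
  obtain ⟨C, hC, h⟩ := hN.abs_le hε
  refine ⟨C, hC, fun u hu => ?_⟩
  have hi := integrable_pow hs (n := m + 1) (by have := hN.two_le; omega) hu
  rw [← integral_abs_sq, ← integral_const_mul, ← integral_const_mul,
    ← integral_add ((integrable_sq u).const_mul ε) (hi.const_mul C)]
  exact abs_integral_le_integral_abs.trans (integral_mono (hN.integrable hs hu).abs
    (((integrable_sq u).const_mul ε).add (hi.const_mul C)) fun x => h _)

/-- On balls of `H^s` the potential energy is Lipschitz for the `L²` norm alone, so `L²` convergence
suffices to pass to the limit. The growth factor is absorbed by Cauchy–Schwarz and the bound on `∫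
|u| ^ (2 * m)`. -/
theorem abs_integral_sub_le (hs : 1 / 2 ≤ s) (hN : Admissible s m N) (M : ℝ) :
    ∃ C, 0 ≤ C ∧ ∀ u v : L2R, SobFinite (2 * s) u → SobFinite (2 * s) v → hsq s u ≤ M →
      hsq s v ≤ M → |(∫ x, N (u x)) - ∫ x, N (v x)| ≤ C * ‖u - v‖ := by
  obtain ⟨C, hC, h⟩ := hN.abs_sub_le one_pos
  have hm1 : 1 ≤ m := by have := hN.two_le; omega
  obtain ⟨D, hD, hp⟩ := exists_integral_pow_le hs (by omega : 2 ≤ m * 2) M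
  refine ⟨2 * Real.sqrt |M| + C * (2 * Real.sqrt D), by positivity, fun u v hu hv hMu hMv => ?_⟩
  set w := u - v with hw
  have hw2 : MemLp (fun x => |w x|) 2 := (Lp.memLp w).norm
  have hww : Real.sqrt (∫ x, |w x| ^ 2) = ‖w‖ := by
    rw [integral_abs_sq, Real.sqrt_sq (norm_nonneg _)]
  have b1 : ∀ z : L2R, hsq s z ≤ M → Integrable (fun x => |w x| * |z x|) ∧
      ∫ x, |w x| * |z x| ≤ ‖w‖ * Real.sqrt |M| := fun z hz => by
    have := integral_mul_le_sqrt_mul_sqrt hw2 (Lp.memLp z).norm (fun x => abs_nonneg _)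
      (fun x => norm_nonneg _)
    simp only [Real.norm_eq_abs, hww] at this
    refine ⟨this.1, this.2.trans ?_⟩
    rw [integral_abs_sq]
    gcongr
    exact (norm_sq_le_hsq s z).trans (hz.trans (le_abs_self _))
  have b2 : ∀ z : L2R, SobFinite (2 * s) z → hsq s z ≤ M →
      Integrable (fun x => |w x| * |z x| ^ m) ∧
      ∫ x, |w x| * |z x| ^ m ≤ ‖w‖ * Real.sqrt D := fun z hz hM => by
    have := integral_mul_le_sqrt_mul_sqrt hw2 (memLp_pow hs hm1 hz) (fun x => abs_nonneg _)
      (fun x => by positivity)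
    simp only [hww, ← pow_mul] at this
    refine ⟨this.1, this.2.trans ?_⟩
    gcongr
    exact (hp z hz hM).2
  have hpt : ∀ᵐ x, |N (u x) - N (v x)| ≤ (|w x| * |u x| + |w x| * |v x|)
      + C * (|w x| * |u x| ^ m + |w x| * |v x| ^ m) := by
    filter_upwards [Lp.coeFn_sub u v] with x hx
    rw [hw, hx, Pi.sub_apply]
    refine (h (u x) (v x)).trans (le_of_eq (by ring))
  rw [← integral_sub (hN.integrable hs hu) (hN.integrable hs hv)]
  have i1 := (b1 u hMu).1.add (b1 v hMv).1
  have i2 := ((b2 u hu hMu).1.add (b2 v hv hMv).1).const_mul C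
  calc |∫ x, (N (u x) - N (v x))| ≤ ∫ x, |N (u x) - N (v x)| := abs_integral_le_integral_abs
    _ ≤ ∫ x, ((|w x| * |u x| + |w x| * |v x|) + C * (|w x| * |u x| ^ m + |w x| * |v x| ^ m)) :=
        integral_mono_ae ((hN.integrable hs hu).sub (hN.integrable hs hv)).abs (i1.add i2) hpt
    _ = ((∫ x, |w x| * |u x|) + ∫ x, |w x| * |v x|)
        + C * ((∫ x, |w x| * |u x| ^ m) + ∫ x, |w x| * |v x| ^ m) := by
        rw [integral_add, integral_add (b1 u hMu).1 (b1 v hMv).1, integral_const_mul,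
          integral_add (b2 u hu hMu).1 (b2 v hv hMv).1]
        · exact i1
        · exact i2
    _ ≤ (‖w‖ * Real.sqrt |M| + ‖w‖ * Real.sqrt |M|)
        + C * (‖w‖ * Real.sqrt D + ‖w‖ * Real.sqrt D) := by
        have := b1 u hMu
        have := b1 v hMv
        have := b2 u hu hMu
        have := b2 v hv hMv
        gcongr <;> tauto
    _ = _ := by ring

/-- Only the lower bound on `N` matters: its power is subcritical, so at bounded charge the negative
part of the potential energy is at most a quarter of the seminorm plus a constant. -/
theorem coercive (hs : 1 / 2 ≤ s) (hN : Admissible s m N) (c : ℝ) :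
    ∃ K, ∀ u : L2R, SobFinite (2 * s) u → ‖u‖ ^ 2 ≤ c →
      1 / 4 * sob (2 * s) u ≤ energy s N u + K := by
  obtain ⟨p, C, hp, hp2, hC, h⟩ := hN.lower
  obtain ⟨K, hK⟩ := exists_integral_rpow_le_eps hp hp2 c (by positivity : 0 < 1 / (4 * (C + 1)))
  refine ⟨C * (c + |K|), fun u hu hc => ?_⟩
  obtain ⟨i1, i2⟩ := hK u hu hc
  have hi := ((integrable_sq u).add i1).const_mul C
  have h1 : -(C * (‖u‖ ^ 2 + ∫ x, |u x| ^ p)) ≤ ∫ x, N (u x) := by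
    rw [← integral_abs_sq, ← integral_add (integrable_sq u) i1, ← integral_const_mul,
      ← integral_neg]
    exact integral_mono hi.neg (hN.integrable hs hu) fun x => h _
  have h2 : C * (1 / (4 * (C + 1)) * sob (2 * s) u) ≤ 1 / 4 * sob (2 * s) u := by
    rw [← mul_assoc]
    refine mul_le_mul_of_nonneg_right ?_ (sob_nonneg _ _)
    rw [mul_one_div, div_le_div_iff₀ (by positivity) (by norm_num)]
    linarith
  have h3 : C * (‖u‖ ^ 2 + ∫ x, |u x| ^ p) ≤ C * (c + (1 / (4 * (C + 1)) * sob (2 * s) u + |K|)) := by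
    gcongr
    exact i2.trans (by gcongr; exact le_abs_self K)
  rw [energy_eq]
  linarith [mul_add C c (1 / (4 * (C + 1)) * sob (2 * s) u + |K|),
    mul_add C (1 / (4 * (C + 1)) * sob (2 * s) u) |K|, mul_add C c |K|]

/-- If the seminorm were small, `∫ |u| ^ (m + 1)` would be small and the potential energy could not
reach `-η`. This lower bound makes the gain from stretching uniform along near-minimizers. -/
theorem exists_le_sob (hs : 1 / 2 ≤ s) (hN : Admissible s m N) (M : ℝ) {η : ℝ} (hη : 0 < η) :
    ∃ τ, 0 < τ ∧ ∀ u : L2R, SobFinite (2 * s) u → hsq s u ≤ M → ∫ x, N (u x) ≤ -η →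
      τ ≤ sob (2 * s) u := by
  obtain ⟨C, hC, h⟩ := hN.integral_abs_le hs (by positivity : 0 < η / (2 * (|M| + 1)))
  obtain ⟨τ, hτ, hlt⟩ := exists_integral_pow_lt hs (n := m + 1) (by have := hN.two_le; omega) M
    (by positivity : 0 < η / (2 * (C + 1)))
  refine ⟨τ, hτ, fun u hu hM hneg => ?_⟩
  by_contra hcon
  have h1 := hlt u hu hM (not_le.1 hcon).le
  have h2 := h u hu
  have h3 : η / (2 * (|M| + 1)) * ‖u‖ ^ 2 < η / 2 := by
    have : ‖u‖ ^ 2 < |M| + 1 := by linarith [norm_sq_le_hsq s u, le_abs_self M]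
    calc η / (2 * (|M| + 1)) * ‖u‖ ^ 2 < η / (2 * (|M| + 1)) * (|M| + 1) := by gcongr
      _ = η / 2 := by field_simp
  have h4 : C * ∫ x, |u x| ^ (m + 1) ≤ η / 2 := by
    calc C * ∫ x, |u x| ^ (m + 1) ≤ (C + 1) * (η / (2 * (C + 1))) := by
          gcongr
          linarith
      _ = η / 2 := by field_simp
  linarith [neg_abs_le (∫ x, N (u x))]

/-- A negative potential energy forces a low frequency peak. -/
theorem exists_le_norm_low (hs : 1 / 2 ≤ s) (hN : Admissible s m N) (M : ℝ) {η : ℝ} (hη : 0 < η) :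
    ∃ k κ : ℝ, 0 < k ∧ 0 < κ ∧ ∀ u : L2R, SobFinite (2 * s) u → hsq s u ≤ M →
      ∫ x, N (u x) ≤ -η → ∃ x, κ ≤ ‖low k u x‖ := by
  obtain ⟨C, hC, h⟩ := hN.integral_abs_le hs (by positivity : 0 < η / (4 * (|M| + 1)))
  have hm := hN.two_le
  obtain ⟨D, hD, hp⟩ := exists_integral_pow_le hs hm M
  obtain ⟨G, hG, hp2⟩ := exists_integral_pow_le hs (by omega : 2 ≤ m * 2) M
  have hs0 : 0 < s := by linarith
  -- The quadratic term, the high-frequency remainder and the low-frequency term are each kept below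
  -- `η / 4`; the second condition fixes `k` and the third fixes `κ`, so a low part below `κ`
  -- everywhere contradicts `-η`.
  obtain ⟨k, hk0, hk⟩ : ∃ k : ℝ, 0 < k ∧
      C * (Real.sqrt G * Real.sqrt (|M| / k ^ (2 * s))) ≤ η / 4 := by
    have ht : Tendsto (fun k : ℝ => C * (Real.sqrt G * Real.sqrt (|M| / k ^ (2 * s)))) atTop
        (𝓝 (C * (Real.sqrt G * Real.sqrt 0))) := by
      refine Tendsto.const_mul _ (Tendsto.const_mul _ ?_)
      exact (Real.continuous_sqrt.tendsto 0).comp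
        (tendsto_const_nhds.div_atTop (tendsto_rpow_atTop (by linarith)))
    simp only [Real.sqrt_zero, mul_zero] at ht
    have := (ht.eventually_le_const (by positivity : 0 < η / 4)).and (eventually_gt_atTop 0)
    obtain ⟨k, h1, h2⟩ := this.exists
    exact ⟨k, h2, h1⟩
  refine ⟨k, η / (4 * (C + 1) * (D + 1)), hk0, by positivity, fun u hu hM hneg => ?_⟩
  by_contra! hcon
  set κ := η / (4 * (C + 1) * (D + 1)) with hκ
  have h1 := integral_mul_abs_le_low hs0 hk0 hu (h := fun x => |u x| ^ m) (fun x => by positivity)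
    (hp u hu hM).1 (memLp_pow hs (by omega) hu)
  simp only [← pow_succ, ← pow_mul] at h1
  have h2 : ∫ x, |u x| ^ m * ‖low k u x‖ ≤ D * κ := by
    calc ∫ x, |u x| ^ m * ‖low k u x‖ ≤ ∫ x, |u x| ^ m * κ := by
          refine integral_mono ?_ ((hp u hu hM).1.mul_const κ) fun x => ?_
          · exact (hp u hu hM).1.mul_bdd (c := κ) (measurable_low k u).norm
              (Eventually.of_forall fun x => by simpa using (hcon x).le)
          · simp only; gcongr; exact (hcon x).le
      _ ≤ D * κ := by
          rw [integral_mul_const]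
          gcongr
          exact (hp u hu hM).2
  have h3 : η / (4 * (|M| + 1)) * ‖u‖ ^ 2 ≤ η / 4 := by
    calc η / (4 * (|M| + 1)) * ‖u‖ ^ 2 ≤ η / (4 * (|M| + 1)) * (|M| + 1) := by
          gcongr
          linarith [norm_sq_le_hsq s u, le_abs_self M]
      _ = η / 4 := by field_simp
  have h4 : Real.sqrt (∫ x, |u x| ^ (m * 2)) * Real.sqrt (sob (2 * s) u / k ^ (2 * s))
      ≤ Real.sqrt G * Real.sqrt (|M| / k ^ (2 * s)) := by
    have := (hp2 u hu hM).2
    have h5 : sob (2 * s) u ≤ |M| := (sob_le_hsq s u).trans (hM.trans (le_abs_self _))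
    have h6 : 0 ≤ k ^ (2 * s) := Real.rpow_nonneg hk0.le _
    gcongr
  have h5 : C * (D * κ) ≤ η / 4 := by
    calc C * (D * κ) ≤ (C + 1) * ((D + 1) * κ) := by
          have : 0 < κ := by positivity
          gcongr <;> linarith
      _ = η / 4 := by rw [hκ]; field_simp
  have h6 := h u hu
  have h7 : C * ∫ x, |u x| ^ (m + 1) ≤ C * (D * κ + Real.sqrt G * Real.sqrt (|M| / k ^ (2 * s))) := by
    gcongr
    linarith
  linarith [neg_abs_le (∫ x, N (u x)), mul_add C (D * κ) (Real.sqrt G * Real.sqrt (|M| / k ^ (2 * s)))]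

end Admissible


/-! ### Translations -/

theorem norm_fourierL2_translate (a : ℝ) (u : L2R) :
    ∀ᵐ ξ, ‖fourierL2 (translate a u) ξ‖ = ‖fourierL2 u ξ‖ := by
  filter_upwards [fourierL2_translate a u] with ξ h
  rw [h, norm_mul, norm_phase, one_mul]

theorem sobFinite_translate {σ : ℝ} {u : L2R} (a : ℝ) (hu : SobFinite σ u) :
    SobFinite σ (translate a u) := by
  refine Integrable.congr hu ?_
  filter_upwards [norm_fourierL2_translate a u] with ξ h
  rw [h]

theorem sob_translate (σ a : ℝ) (u : L2R) : sob σ (translate a u) = sob σ u := by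
  apply integral_congr_ae
  filter_upwards [norm_fourierL2_translate a u] with ξ h
  rw [h]

theorem norm_translate (a : ℝ) (u : L2R) : ‖translate a u‖ = ‖u‖ :=
  Lp.norm_compMeasurePreserving _ _

theorem hsq_translate (s a : ℝ) (u : L2R) : hsq s (translate a u) = hsq s u := by
  rw [hsq, hsq, sob_translate, norm_translate]

theorem charge_translate (a : ℝ) (u : L2R) : charge (translate a u) = charge u := by
  rw [charge_eq, charge_eq, norm_translate]

theorem integral_comp_translate (g : ℝ → ℝ) (a : ℝ) (u : L2R) :
    ∫ x, g (translate a u x) = ∫ x, g (u x) := by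
  rw [← integral_sub_right_eq_self (fun x => g (u x)) a]
  apply integral_congr_ae
  filter_upwards [translate_ae a u] with x h
  rw [h]

theorem energy_translate (s : ℝ) (W : ℝ → ℝ) (a : ℝ) (u : L2R) :
    energy s W (translate a u) = energy s W u := by
  rw [energy_eq, energy_eq, sob_translate, integral_comp_translate]

theorem low_translate (k a : ℝ) (u : L2R) (x : ℝ) : low k (translate a u) x = low k u (x - a) := by
  apply integral_congr_ae
  filter_upwards [ae_restrict_of_ae (fourierL2_translate a u)] with ξ h
  rw [h, ← mul_assoc, ← phase_add]; congr 2; ring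

theorem translate_sub (a : ℝ) (u v : L2R) : translate a (u - v) = translate a u - translate a v :=
  map_sub _ _ _

theorem translate_translate (a b : ℝ) (u : L2R) : translate a (translate b u) = translate (a + b) u := by
  apply fourierL2_injective
  ext1
  filter_upwards [fourierL2_translate a (translate b u), fourierL2_translate b u,
    fourierL2_translate (a + b) u] with ξ h1 h2 h3
  rw [h1, h2, h3, phase_add, mul_assoc]

theorem translate_zero (u : L2R) : translate 0 u = u := by
  apply fourierL2_injective
  ext1
  filter_upwards [fourierL2_translate 0 u] with ξ h1
  rw [h1, phase_zero, one_mul]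

/-! ### Weak compactness -/

theorem sobFinite_sub {σ : ℝ} {u v : L2R} (hu : SobFinite σ u) (hv : SobFinite σ v) :
    SobFinite σ (u - v) := by
  refine ((Integrable.const_mul hu 2).add (Integrable.const_mul hv 2)).mono'
    (aestronglyMeasurable_sob σ _) ?_
  filter_upwards [Lp.coeFn_sub (fourierL2 u) (fourierL2 v)] with ξ h
  rw [fourierL2_sub, h, Pi.sub_apply,
    Real.norm_of_nonneg (mul_nonneg (freq_rpow_nonneg _ _) (sq_nonneg _)), Pi.add_apply]
  have h1 := norm_sub_le (fourierL2 u ξ) (fourierL2 v ξ)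
  have h2 : ‖fourierL2 u ξ - fourierL2 v ξ‖ ^ 2 ≤ 2 * ‖fourierL2 u ξ‖ ^ 2 + 2 * ‖fourierL2 v ξ‖ ^ 2 := by
    nlinarith [sq_nonneg (‖fourierL2 u ξ‖ - ‖fourierL2 v ξ‖), norm_nonneg (fourierL2 u ξ - fourierL2 v ξ)]
  have := mul_le_mul_of_nonneg_left h2 (freq_rpow_nonneg σ ξ)
  linarith

theorem sobFinite_smul {σ : ℝ} {u : L2R} (r : ℝ) (hu : SobFinite σ u) : SobFinite σ (r • u) := by
  refine (Integrable.const_mul hu (r ^ 2)).congr ?_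
  filter_upwards [Lp.coeFn_smul (r : ℂ) (fourierL2 u)] with ξ h
  rw [fourierL2_smul, h, Pi.smul_apply, norm_smul, Complex.norm_real, mul_pow, Real.norm_eq_abs, sq_abs]
  ring

theorem sobFinite_add {σ : ℝ} {u v : L2R} (hu : SobFinite σ u) (hv : SobFinite σ v) :
    SobFinite σ (u + v) := by
  have := sobFinite_sub hu (sobFinite_smul (-1) hv)
  simpa using this

/-- The weight `(1 + |2πξ|^{2s})^{1/2}`. -/
def wt (s ξ : ℝ) : ℝ := Real.sqrt (1 + freq ξ ^ (2 * s))

theorem one_le_wt (s ξ : ℝ) : 1 ≤ wt s ξ :=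
  Real.one_le_sqrt.2 (le_add_of_nonneg_right (freq_rpow_nonneg _ _))

theorem measurable_wt (s : ℝ) : Measurable (wt s) :=
  ((measurable_freq_rpow _).const_add 1).sqrt

theorem norm_wt_mul_sq (s ξ : ℝ) (z : ℂ) :
    ‖(wt s ξ : ℂ) * z‖ ^ 2 = ‖z‖ ^ 2 + freq ξ ^ (2 * s) * ‖z‖ ^ 2 := by
  rw [norm_mul, mul_pow, Complex.norm_real, Real.norm_eq_abs, sq_abs, wt,
    Real.sq_sqrt (add_nonneg zero_le_one (freq_rpow_nonneg _ _))]
  ring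

theorem memLp_wt_mul {s : ℝ} {u : L2R} (hu : SobFinite (2 * s) u) :
    MemLp (fun ξ => (wt s ξ : ℂ) * fourierL2 u ξ) 2 := by
  have hm : Measurable fun ξ => (wt s ξ : ℂ) * fourierL2 u ξ :=
    (Complex.measurable_ofReal.comp (measurable_wt s)).mul (measurable_fourierL2 u)
  rw [memLp_two_iff_integrable_sq_norm hm.aestronglyMeasurable]
  simp only [norm_wt_mul_sq]
  exact (integrable_norm_sq _).add hu

/-- The isometry of `H^s` into `L²` given by the weighted Fourier transform. -/
def lift {s : ℝ} {u : L2R} (hu : SobFinite (2 * s) u) : L2C := (memLp_wt_mul hu).toLp _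

theorem lift_ae {s : ℝ} {u : L2R} (hu : SobFinite (2 * s) u) :
    lift hu =ᵐ[volume] fun ξ => (wt s ξ : ℂ) * fourierL2 u ξ := MemLp.coeFn_toLp _

theorem norm_lift_sq {s : ℝ} {u : L2R} (hu : SobFinite (2 * s) u) : ‖lift hu‖ ^ 2 = hsq s u := by
  rw [norm_sq_L2C, hsq, norm_sq_eq_integral_fourierL2, sob, ← integral_add (integrable_norm_sq _) hu]
  apply integral_congr_ae
  filter_upwards [lift_ae hu] with ξ h
  rw [h, norm_wt_mul_sq]

theorem lift_sub {s : ℝ} {u v : L2R} (hu : SobFinite (2 * s) u) (hv : SobFinite (2 * s) v) :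
    lift (sobFinite_sub hu hv) = lift hu - lift hv := by
  ext1
  filter_upwards [lift_ae hu, lift_ae hv, lift_ae (sobFinite_sub hu hv),
    Lp.coeFn_sub (lift hu) (lift hv), Lp.coeFn_sub (fourierL2 u) (fourierL2 v)] with ξ h1 h2 h3 h4 h5
  rw [h3, h4, Pi.sub_apply, h1, h2, fourierL2_sub, h5, Pi.sub_apply, mul_sub]

theorem exists_weak_limit {U : ℕ → L2C} {R : ℝ} (hU : ∀ n, ‖U n‖ ≤ R) :
    ∃ φ : ℕ → ℕ, StrictMono φ ∧ ∃ V : L2C, ∀ g : L2C,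
      Tendsto (fun n => inner ℂ g (U (φ n))) atTop (𝓝 (inner ℂ g V)) := by
  -- Finiteness of the exponent makes `L²` separable, which the sequential Banach–Alaoglu theorem
  -- requires.
  have : Fact ((2 : ℝ≥0∞) ≠ ⊤) := ⟨by norm_num⟩
  have hc := WeakDual.isSeqCompact_closedBall ℂ L2C 0 R
  let x : ℕ → WeakDual ℂ L2C := fun n => StrongDual.toWeakDual (InnerProductSpace.toDual ℂ L2C (U n))
  have hx : ∀ n, x n ∈ WeakDual.toStrongDual ⁻¹' Metric.closedBall (0 : StrongDual ℂ L2C) R := by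
    intro n
    simp only [mem_preimage, Metric.mem_closedBall, dist_zero_right, x]
    exact ((InnerProductSpace.toDual ℂ L2C).norm_map (U n)).le.trans (hU n)
  obtain ⟨y, _, φ, hφ, hy⟩ := hc hx
  refine ⟨φ, hφ, (InnerProductSpace.toDual ℂ L2C).symm (WeakDual.toStrongDual y), fun g => ?_⟩
  have h1 : Tendsto (fun n => x (φ n) g) atTop (𝓝 (y g)) :=
    (WeakDual.eval_continuous g).continuousAt.tendsto.comp hy
  have h2 : ∀ n, x (φ n) g = inner ℂ (U (φ n)) g := fun n => InnerProductSpace.toDual_apply_apply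
  have h3 : y g = inner ℂ ((InnerProductSpace.toDual ℂ L2C).symm (WeakDual.toStrongDual y)) g :=
    InnerProductSpace.toDual_symm_apply.symm
  simp only [h2, h3] at h1
  have h4 := (Complex.continuous_conj.tendsto _).comp h1
  simpa only [Function.comp_def, inner_conj_symm] using h4

/-- A weak limit of real-valued functions is real-valued. -/
theorem exists_fourierL2_eq_of_weak {u : ℕ → L2R} {G : L2C}
    (h : ∀ g : L2C, Tendsto (fun n => inner ℂ g (fourierL2 (u n))) atTop (𝓝 (inner ℂ g G))) :
    ∃ v : L2R, fourierL2 v = G := by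
  obtain ⟨v, w, e⟩ := exists_eq_toC_add (𝓕⁻ G : L2C)
  have e2 : G = fourierL2 v + Complex.I • fourierL2 w := by
    rw [fourierL2_def, fourierL2_def, ← FourierTransform.fourier_smul,
      ← FourierTransform.fourier_add, ← e, FourierTransform.fourier_fourierInv_eq]
  have h1 := (Complex.continuous_im.tendsto _).comp (h (fourierL2 w))
  simp only [Function.comp_def, inner_fourierL2, Complex.ofReal_im] at h1
  have h2 := tendsto_nhds_unique h1 tendsto_const_nhds
  rw [e2, inner_add_right, inner_smul_right, inner_fourierL2, inner_fourierL2] at h2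
  simp only [Complex.add_im, Complex.ofReal_im, Complex.mul_im, Complex.I_re, Complex.I_im,
    Complex.ofReal_re, real_inner_self_eq_norm_sq] at h2
  have hw : w = 0 := by
    have : ‖w‖ ^ 2 = 0 := by linarith
    simpa using this
  refine ⟨v, ?_⟩
  have h0 : fourierL2 0 = 0 := by
    have := fourierL2_sub 0 0
    simpa using this
  rw [e2, hw, h0, smul_zero, add_zero]

theorem memLp_inv_wt_mul (s : ℝ) (g : L2C) : MemLp (fun ξ => ((wt s ξ)⁻¹ : ℂ) * g ξ) 2 := by
  refine (Lp.memLp g).of_le_mul (c := 1) ?_ (Eventually.of_forall fun ξ => ?_)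
  · exact (((Complex.measurable_ofReal.comp (measurable_wt s)).inv).mul
      (Lp.stronglyMeasurable g).measurable).aestronglyMeasurable
  · rw [norm_mul, norm_inv, Complex.norm_real, Real.norm_of_nonneg (zero_le_one.trans (one_le_wt s ξ))]
    gcongr
    exact inv_le_one_of_one_le₀ (one_le_wt s ξ)

/-- Bounded sequences in `H^s` have weakly convergent subsequences. -/
theorem exists_weak_subseq {s M : ℝ} {u : ℕ → L2R} (hu : ∀ n, SobFinite (2 * s) (u n))
    (hM : ∀ n, hsq s (u n) ≤ M) :
    ∃ φ : ℕ → ℕ, StrictMono φ ∧ ∃ v : L2R, SobFinite (2 * s) v ∧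
      (∀ k x, Tendsto (fun n => low k (u (φ n) - v) x) atTop (𝓝 0)) ∧
      Tendsto (fun n => ‖u (φ n)‖ ^ 2 - ‖v‖ ^ 2 - ‖u (φ n) - v‖ ^ 2) atTop (𝓝 0) ∧
      Tendsto (fun n => hsq s (u (φ n)) - hsq s v - hsq s (u (φ n) - v)) atTop (𝓝 0) := by
  obtain ⟨φ, hφ, V, hV⟩ := exists_weak_limit (U := fun n => lift (hu n)) (R := Real.sqrt M)
    fun n => by
      rw [← Real.sqrt_sq (norm_nonneg (lift (hu n))), norm_lift_sq]
      exact Real.sqrt_le_sqrt (hM n)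
  have hwt : ∀ ξ, (wt s ξ : ℂ) ≠ 0 := fun ξ => by
    have := one_le_wt s ξ
    exact_mod_cast (by linarith : wt s ξ ≠ 0)
  -- The weak limit `V` is that of the weighted transforms. Dividing by the weight, here and in the
  -- test functions, gives the weak limit of the transforms themselves.
  set G : L2C := (memLp_inv_wt_mul s V).toLp _ with hG
  have hGae : G =ᵐ[volume] fun ξ => ((wt s ξ)⁻¹ : ℂ) * V ξ := MemLp.coeFn_toLp _
  have hweak : ∀ g : L2C,
      Tendsto (fun n => inner ℂ g (fourierL2 (u (φ n)))) atTop (𝓝 (inner ℂ g G)) := by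
    intro g
    set g' : L2C := (memLp_inv_wt_mul s g).toLp _
    have hg' : g' =ᵐ[volume] fun ξ => ((wt s ξ)⁻¹ : ℂ) * g ξ := MemLp.coeFn_toLp _
    have e1 : inner ℂ g G = inner ℂ g' V := by
      rw [inner_L2C, inner_L2C]
      apply integral_congr_ae
      filter_upwards [hGae, hg'] with ξ h1 h2
      rw [h1, h2, map_mul, map_inv₀, Complex.conj_ofReal]; ring
    have e2 : ∀ n, inner ℂ g (fourierL2 (u (φ n))) = inner ℂ g' (lift (hu (φ n))) := by
      intro n
      rw [inner_L2C, inner_L2C]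
      apply integral_congr_ae
      filter_upwards [lift_ae (hu (φ n)), hg'] with ξ h1 h2
      rw [h1, h2, map_mul, map_inv₀, Complex.conj_ofReal]
      have := hwt ξ
      field_simp
    rw [e1]; simp only [e2]
    exact hV g'
  obtain ⟨v, hv⟩ := exists_fourierL2_eq_of_weak hweak
  have hVae : V =ᵐ[volume] fun ξ => (wt s ξ : ℂ) * fourierL2 v ξ := by
    rw [hv]
    filter_upwards [hGae] with ξ h
    rw [h, mul_inv_cancel_left₀ (hwt ξ)]
  have hvf : SobFinite (2 * s) v := by
    have h1 : Integrable fun ξ => ‖fourierL2 v ξ‖ ^ 2 + freq ξ ^ (2 * s) * ‖fourierL2 v ξ‖ ^ 2 := by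
      refine (integrable_norm_sq V).congr ?_
      filter_upwards [hVae] with ξ h
      rw [h, norm_wt_mul_sq]
    exact (h1.sub (integrable_norm_sq (fourierL2 v))).congr (Eventually.of_forall fun ξ => by simp)
  have hlift : lift hvf = V := by
    ext1
    filter_upwards [lift_ae hvf, hVae] with ξ h1 h2
    rw [h1, h2]
  have hdiff : ∀ g : L2C,
      Tendsto (fun n => inner ℂ g (fourierL2 (u (φ n) - v))) atTop (𝓝 0) := by
    intro g
    simp only [fourierL2_sub, inner_sub_right, hv]
    simpa using (hweak g).sub_const (inner ℂ g G)
  refine ⟨φ, hφ, v, hvf, ?_, ?_, ?_⟩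
  · intro k x
    -- A value of the low part is an inner product with a fixed `L²` function, because the cutoff
    -- set has finite measure; weak convergence thus becomes pointwise convergence.
    have hmem : MemLp (fun ξ => phase x ξ * (lowSet k).indicator (fun _ => (1 : ℂ)) ξ) 2 := by
      apply memLp_phase_mul
      exact memLp_indicator_const 2 (measurableSet_lowSet k) 1 (Or.inr (volume_lowSet_lt_top k).ne)
    refine (hdiff (hmem.toLp _)).congr fun n => ?_
    rw [inner_L2C, low, ← integral_indicator (measurableSet_lowSet k)]
    apply integral_congr_ae
    filter_upwards [hmem.coeFn_toLp] with ξ h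
    rw [h, map_mul, conj_phase]
    by_cases hξ : ξ ∈ lowSet k <;> simp [hξ, mul_comm]
  · have h1 := (Complex.continuous_re.tendsto _).comp (hdiff (fourierL2 v))
    simp only [Function.comp_def, inner_fourierL2, Complex.ofReal_re, Complex.zero_re] at h1
    have h2 := h1.const_mul 2
    rw [mul_zero] at h2
    refine h2.congr fun n => ?_
    have := norm_add_sq_real v (u (φ n) - v)
    rw [add_sub_cancel] at this
    linarith
  · have e : ∀ n, lift (sobFinite_sub (hu (φ n)) hvf) = lift (hu (φ n)) - V := fun n => by
      rw [lift_sub (hu (φ n)) hvf, hlift]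
    have h1 : Tendsto (fun n => inner ℂ V (lift (sobFinite_sub (hu (φ n)) hvf))) atTop (𝓝 0) := by
      simp only [e, inner_sub_right]
      simpa using (hV V).sub_const (inner ℂ V V)
    have h2 := ((Complex.continuous_re.tendsto _).comp h1).const_mul 2
    simp only [Function.comp_def, Complex.zero_re, mul_zero] at h2
    refine h2.congr fun n => ?_
    have := norm_add_sq (𝕜 := ℂ) V (lift (sobFinite_sub (hu (φ n)) hvf))
    rw [norm_lift_sq, e n, add_sub_cancel, norm_lift_sq, ← hlift, norm_lift_sq, hlift, ← e n] at this
    simp only [RCLike.re_to_complex] at this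
    linarith

/-! ### Splitting of the potential energy -/

/-- This takes the place of local compactness of the embedding: the low part converges pointwise
under a uniform bound, so dominated convergence applies, while the high part is small uniformly in
`n`. -/
theorem tendsto_integral_mul_abs {s M : ℝ} (hs : 0 < s) {w : ℕ → L2R}
    (hw : ∀ n, SobFinite (2 * s) (w n)) (hM : ∀ n, hsq s (w n) ≤ M)
    (hlow : ∀ k x, Tendsto (fun n => low k (w n) x) atTop (𝓝 0))
    {f : ℝ → ℝ} (h0 : ∀ x, 0 ≤ f x) (h1 : Integrable f) (h2 : MemLp f 2) :
    Tendsto (fun n => ∫ x, f x * |w n x|) atTop (𝓝 0) := by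
  have hM0 : 0 ≤ M := (hsq_nonneg s _).trans (hM 0)
  rw [Metric.tendsto_atTop']
  intro ε hε
  obtain ⟨k, hk0, hk⟩ : ∃ k : ℝ, 0 < k ∧
      Real.sqrt (∫ x, f x ^ 2) * Real.sqrt (M / k ^ (2 * s)) ≤ ε / 4 := by
    have ht : Tendsto (fun k : ℝ => Real.sqrt (∫ x, f x ^ 2) * Real.sqrt (M / k ^ (2 * s))) atTop
        (𝓝 (Real.sqrt (∫ x, f x ^ 2) * Real.sqrt 0)) := by
      refine Tendsto.const_mul _ ?_
      exact (Real.continuous_sqrt.tendsto 0).comp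
        (tendsto_const_nhds.div_atTop (tendsto_rpow_atTop (by linarith)))
    simp only [Real.sqrt_zero, mul_zero] at ht
    obtain ⟨k, h1, h2⟩ := ((ht.eventually_le_const (by positivity : 0 < ε / 4)).and
      (eventually_gt_atTop 0)).exists
    exact ⟨k, h2, h1⟩
  have hl : Tendsto (fun n => ∫ x, f x * ‖low k (w n) x‖) atTop (𝓝 (∫ _x : ℝ, (0 : ℝ))) := by
    apply tendsto_integral_of_dominated_convergence (fun x => f x * (Real.sqrt k * Real.sqrt M))
    · intro n
      exact h1.aestronglyMeasurable.mul (measurable_low k (w n)).norm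
    · exact h1.mul_const _
    · intro n
      refine Eventually.of_forall fun x => ?_
      rw [norm_mul, Real.norm_of_nonneg (h0 x), norm_norm]
      refine mul_le_mul_of_nonneg_left ((norm_low_le_norm hk0 _ x).trans ?_) (h0 x)
      gcongr
      exact Real.le_sqrt_of_sq_le ((norm_sq_le_hsq s _).trans (hM n))
    · refine Eventually.of_forall fun x => ?_
      simpa using ((hlow k x).norm).const_mul (f x)
  rw [integral_zero] at hl
  obtain ⟨n₀, hn₀⟩ := eventually_atTop.1 (hl.eventually_lt_const (by positivity : 0 < ε / 4))
  refine ⟨n₀, fun n hn => ?_⟩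
  rw [Real.dist_0_eq_abs, abs_of_nonneg (integral_nonneg fun x => mul_nonneg (h0 x) (abs_nonneg _))]
  have h3 := integral_mul_abs_le_low hs hk0 (hw n) h0 h1 h2
  have h4 : Real.sqrt (∫ x, f x ^ 2) * Real.sqrt (sob (2 * s) (w n) / k ^ (2 * s))
      ≤ Real.sqrt (∫ x, f x ^ 2) * Real.sqrt (M / k ^ (2 * s)) := by
    have h6 : 0 ≤ k ^ (2 * s) := Real.rpow_nonneg hk0.le _
    have := (sob_le_hsq s (w n)).trans (hM n)
    gcongr
  linarith [hn₀ n (by omega)]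

/-- A Brezis–Lieb splitting. The defect is at most a small multiple of bounded quantities plus
integrals of `|u n - v|` against the fixed functions `|v| ^ 2` and `|v| ^ m`, which tend to zero. -/
theorem Admissible.tendsto_split {s : ℝ} {m : ℕ} {N : ℝ → ℝ} (hs : 1 / 2 ≤ s)
    (hN : Admissible s m N) {v : L2R} (hv : SobFinite (2 * s) v) {u : ℕ → L2R} {M : ℝ}
    (hu : ∀ n, SobFinite (2 * s) (u n)) (hM : ∀ n, hsq s (u n - v) ≤ M)
    (hlow : ∀ k x, Tendsto (fun n => low k (u n - v) x) atTop (𝓝 0)) :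
    Tendsto (fun n => (∫ x, N (u n x)) - (∫ x, N (v x)) - ∫ x, N ((u n - v) x)) atTop (𝓝 0) := by
  have hm := hN.two_le
  have hs0 : 0 < s := by linarith
  set w : ℕ → L2R := fun n => u n - v with hwdef
  have hw : ∀ n, SobFinite (2 * s) (w n) := fun n => sobFinite_sub (hu n) hv
  have hv1 : Integrable (fun x => |v x| ^ m) := integrable_pow hs hm hv
  have hv2 : MemLp (fun x => |v x| ^ m) 2 := memLp_pow hs (by omega) hv
  have t1 := tendsto_integral_mul_abs hs0 hw hM hlow (f := fun x => |v x| ^ 2)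
    (fun x => by positivity) (integrable_sq v) (memLp_pow hs (by omega) hv)
  have t2 := tendsto_integral_mul_abs hs0 hw hM hlow (f := fun x => |v x| ^ m)
    (fun x => by positivity) hv1 hv2
  obtain ⟨D, hD, hp⟩ := exists_integral_pow_le hs (by omega : 2 ≤ 2 * m - 1) M
  have hM0 : 0 ≤ M := (hsq_nonneg s _).trans (hM 0)
  set A := ‖v‖ ^ 2 + M + D + 1 with hA
  have hA0 : 0 < A := by positivity
  rw [Metric.tendsto_atTop']
  intro ε hε
  obtain ⟨K, hK, h⟩ := hN.abs_add_sub_sub_le (by positivity : 0 < ε / (2 * A))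
  have t3 := (t1.add t2).const_mul K
  rw [add_zero, mul_zero] at t3
  obtain ⟨n₀, hn₀⟩ := eventually_atTop.1 (t3.eventually_lt_const (by positivity : 0 < ε / 2))
  refine ⟨n₀, fun n hn => ?_⟩
  have hn := hn₀ n (by omega)
  rw [Real.dist_0_eq_abs]
  have iN : Integrable fun x => N (u n x) - N (v x) :=
    (hN.integrable hs (hu n)).sub (hN.integrable hs hv)
  have iNw := hN.integrable hs (hw n)
  obtain ⟨iw, hwD⟩ := hp (w n) (hw n) (hM n)
  have i1 : Integrable (fun x => |v x| ^ 2 * |w n x|) :=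
    (memLp_pow hs (by omega) hv).integrable_mul (Lp.memLp (w n)).norm
  have i2 : Integrable (fun x => |v x| ^ m * |w n x|) := hv2.integrable_mul (Lp.memLp (w n)).norm
  have i3 : Integrable (fun x => |v x| ^ 2 + |w n x| ^ 2 + |w n x| ^ (2 * m - 1)) :=
    ((integrable_sq v).add (integrable_sq (w n))).add iw
  have i12 : Integrable (fun x => |v x| ^ 2 * |w n x| + |v x| ^ m * |w n x|) := i1.add i2
  have i4 : Integrable (fun x => ε / (2 * A) * (|v x| ^ 2 + |w n x| ^ 2 + |w n x| ^ (2 * m - 1))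
        + K * (|v x| ^ 2 * |w n x| + |v x| ^ m * |w n x|)) :=
    (i3.const_mul (ε / (2 * A))).add (i12.const_mul K)
  have i5 : Integrable (fun x => |v x| ^ 2 + |w n x| ^ 2) :=
    (integrable_sq v).add (integrable_sq (w n))
  have hpt : ∀ᵐ x, |N (u n x) - N (v x) - N (w n x)| ≤
      ε / (2 * A) * (|v x| ^ 2 + |w n x| ^ 2 + |w n x| ^ (2 * m - 1))
        + K * (|v x| ^ 2 * |w n x| + |v x| ^ m * |w n x|) := by
    filter_upwards [Lp.coeFn_sub (u n) v] with x hx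
    have e : u n x = v x + w n x := by
      simp only [hwdef]; rw [hx, Pi.sub_apply]; ring
    rw [e]
    exact h _ _
  calc |(∫ x, N (u n x)) - (∫ x, N (v x)) - ∫ x, N (w n x)|
      = |∫ x, (N (u n x) - N (v x) - N (w n x))| := by
        rw [integral_sub iN iNw, integral_sub (hN.integrable hs (hu n)) (hN.integrable hs hv)]
    _ ≤ ∫ x, |N (u n x) - N (v x) - N (w n x)| := abs_integral_le_integral_abs
    _ ≤ _ := integral_mono_ae (iN.sub iNw).abs i4 hpt
    _ = ε / (2 * A) * (‖v‖ ^ 2 + ‖w n‖ ^ 2 + ∫ x, |w n x| ^ (2 * m - 1))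
        + K * ((∫ x, |v x| ^ 2 * |w n x|) + ∫ x, |v x| ^ m * |w n x|) := by
        rw [integral_add (i3.const_mul _) (i12.const_mul K), integral_const_mul,
          integral_const_mul, integral_add i1 i2,
          integral_add i5 iw,
          integral_add (integrable_sq v) (integrable_sq (w n)), integral_abs_sq, integral_abs_sq]
    _ < ε / (2 * A) * A + ε / 2 := by
        have := (norm_sq_le_hsq s (w n)).trans (hM n)
        refine add_lt_add_of_le_of_lt ?_ hn
        gcongr
        rw [hA]; linarith
    _ = ε := by field_simp; ring


/-! ### Dilations -/

theorem integral_norm_fourierL2_dilate {θ : ℝ} (hθ : 0 < θ) (σ : ℝ) (u : L2R) :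
    ∀ᵐ ξ, freq ξ ^ σ * ‖fourierL2 (dilate hθ u) ξ‖ ^ 2
      = θ ^ (2 - σ) * (freq (θ * ξ) ^ σ * ‖fourierL2 u (θ * ξ)‖ ^ 2) := by
  filter_upwards [fourierL2_dilate hθ u] with ξ h
  rw [h, norm_mul, Complex.norm_real, Real.norm_of_nonneg hθ.le, freq_mul hθ,
    Real.mul_rpow hθ.le (freq_nonneg ξ), mul_pow, Real.rpow_sub hθ, Real.rpow_two]
  have := (Real.rpow_pos_of_pos hθ σ).ne'
  field_simp

theorem sobFinite_dilate {θ : ℝ} (hθ : 0 < θ) {σ : ℝ} {u : L2R} (hu : SobFinite σ u) :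
    SobFinite σ (dilate hθ u) := by
  have h1 : Integrable fun ξ => freq (θ * ξ) ^ σ * ‖fourierL2 u (θ * ξ)‖ ^ 2 :=
    Integrable.comp_mul_left' hu hθ.ne'
  refine (h1.const_mul (θ ^ (2 - σ))).congr ?_
  filter_upwards [integral_norm_fourierL2_dilate hθ σ u] with ξ h
  rw [h]

theorem sob_dilate {θ : ℝ} (hθ : 0 < θ) (σ : ℝ) (u : L2R) :
    sob σ (dilate hθ u) = θ ^ (1 - σ) * sob σ u := by
  rw [sob, integral_congr_ae (integral_norm_fourierL2_dilate hθ σ u), integral_const_mul,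
    Measure.integral_comp_mul_left (fun ξ => freq ξ ^ σ * ‖fourierL2 u ξ‖ ^ 2) θ,
    abs_of_pos (inv_pos.2 hθ), smul_eq_mul, ← mul_assoc, ← sob]
  congr 1
  rw [Real.rpow_sub hθ, Real.rpow_sub hθ, Real.rpow_two, Real.rpow_one]
  field_simp

theorem charge_dilate {θ : ℝ} (hθ : 0 < θ) (u : L2R) : charge (dilate hθ u) = θ * charge u := by
  rw [charge, integral_dilate hθ u (fun r => r ^ 2), charge]; ring

theorem energy_dilate {θ : ℝ} (hθ : 0 < θ) (s : ℝ) (N : ℝ → ℝ) (u : L2R) :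
    energy s N (dilate hθ u) = 1 / 2 * (θ ^ (1 - 2 * s) * sob (2 * s) u) + θ * ∫ x, N (u x) := by
  rw [energy_eq, sob_dilate, integral_dilate hθ u N]

/-- This is where `s ≥ 1/2` matters for the variational problem: stretching does not increase the
kinetic energy, while proportional growth would multiply it by `θ`. The surplus is kept for the
strict inequality. -/
theorem energy_dilate_le {θ s : ℝ} (hθ : 1 ≤ θ) (hs : 1 / 2 ≤ s) (N : ℝ → ℝ) (u : L2R) :
    energy s N (dilate (one_pos.trans_le hθ) u)
      ≤ θ * energy s N u - 1 / 2 * (θ - 1) * sob (2 * s) u := by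
  rw [energy_dilate, energy_eq]
  have : θ ^ (1 - 2 * s) ≤ 1 := Real.rpow_le_one_of_one_le_of_nonpos hθ (by linarith)
  nlinarith [sob_nonneg (2 * s) u]

/-! ### Test functions -/

theorem integrable_freq_rpow_mul_schwartz (ψ : SchwartzMap ℝ ℂ) {σ : ℝ} (hσ : 0 ≤ σ) :
    Integrable (fun ξ => freq ξ ^ σ * ‖ψ ξ‖) := by
  obtain ⟨k, hk⟩ := exists_nat_ge σ
  have h1 := SchwartzMap.integrable_pow_mul volume ψ k
  have h2 : Integrable fun ξ => ‖ψ ξ‖ + (2 * Real.pi) ^ k * (‖ξ‖ ^ k * ‖ψ ξ‖) :=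
    ψ.integrable.norm.add (h1.const_mul _)
  refine h2.mono' (((measurable_freq_rpow σ).mul
    ψ.continuous.measurable.norm).aestronglyMeasurable) (Eventually.of_forall fun ξ => ?_)
  rw [Real.norm_of_nonneg (mul_nonneg (freq_rpow_nonneg _ _) (norm_nonneg _))]
  have h3 := rpow_le_one_add_rpow (freq_nonneg ξ) hσ hk
  have h4 : freq ξ ^ (k : ℝ) = (2 * Real.pi) ^ k * ‖ξ‖ ^ k := by
    rw [Real.rpow_natCast, freq, abs_mul, mul_pow, abs_of_pos (by positivity : 0 < 2 * Real.pi),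
      Real.norm_eq_abs]
  rw [h4] at h3
  have := mul_le_mul_of_nonneg_right h3 (norm_nonneg (ψ ξ))
  linarith

theorem memLp_freq_rpow_mul_schwartz (ψ : SchwartzMap ℝ ℂ) {σ : ℝ} (hσ : 0 ≤ σ) :
    MemLp (fun ξ => freq ξ ^ σ * ‖ψ ξ‖) 2 := by
  have hm : Measurable fun ξ => freq ξ ^ σ * ‖ψ ξ‖ :=
    (measurable_freq_rpow σ).mul ψ.continuous.measurable.norm
  rw [memLp_two_iff_integrable_sq hm.aestronglyMeasurable]
  obtain ⟨C, hC⟩ := ψ.decay 0 0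
  have hb : ∀ ξ, ‖ψ ξ‖ ≤ C := fun ξ => by simpa using hC.2 ξ
  refine ((integrable_freq_rpow_mul_schwartz ψ (by positivity : 0 ≤ 2 * σ)).const_mul C).mono'
    (hm.pow_const 2).aestronglyMeasurable (Eventually.of_forall fun ξ => ?_)
  rw [Real.norm_of_nonneg (sq_nonneg _), mul_pow, ← Real.rpow_natCast (freq ξ ^ σ),
    ← Real.rpow_mul (freq_nonneg ξ), sq ‖ψ ξ‖]
  have e : σ * ((2 : ℕ) : ℝ) = 2 * σ := by push_cast; ring
  rw [e]
  have := mul_le_mul_of_nonneg_left (hb ξ) (mul_nonneg (freq_rpow_nonneg (2 * σ) ξ) (norm_nonneg (ψ ξ)))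
  linarith

theorem exists_schwartz {φ : ℝ → ℝ} (hφ : IsTest φ) :
    ∃ ψ : SchwartzMap ℝ ℂ, ∀ x, ψ x = (φ x : ℂ) :=
  ⟨HasCompactSupport.toSchwartzMap (f := fun x => (φ x : ℂ))
    (hφ.2.comp_left (g := fun r : ℝ => (r : ℂ)) Complex.ofReal_zero)
    (Complex.ofRealCLM.contDiff.comp hφ.1), fun _ => rfl⟩

theorem IsTest.memLp {φ : ℝ → ℝ} (hφ : IsTest φ) (p : ℝ≥0∞) : MemLp φ p :=
  hφ.1.continuous.memLp_of_hasCompactSupport hφ.2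

theorem IsTest.integrable {φ : ℝ → ℝ} (hφ : IsTest φ) : Integrable φ :=
  hφ.1.continuous.integrable_of_hasCompactSupport hφ.2

theorem sobFinite_test {φ : ℝ → ℝ} (hφ : IsTest φ) {σ : ℝ} (hσ : 0 ≤ σ) :
    SobFinite σ ((hφ.memLp 2).toLp φ) := by
  obtain ⟨ψ, hψ⟩ := exists_schwartz hφ
  have h := (memLp_freq_rpow_mul_schwartz (𝓕 ψ) (by positivity : 0 ≤ σ / 2)).integrable_sq
  refine h.congr ?_
  filter_upwards [fourierL2_toLp_ae hφ.integrable (hφ.memLp 2)] with ξ hξ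
  have e : (fun x => (φ x : ℂ)) = ψ := by ext x; rw [hψ]
  rw [hξ, e, SchwartzMap.fourier_coe, mul_pow, ← Real.rpow_natCast (freq ξ ^ (σ / 2)),
    ← Real.rpow_mul (freq_nonneg ξ)]
  congr 2; push_cast; ring

theorem Admissible.exists_integral_neg {s : ℝ} {m : ℕ} {N : ℝ → ℝ} (hs : 1 / 2 ≤ s)
    (hN : Admissible s m N) : ∃ v : L2R, SobFinite (2 * s) v ∧ ∫ x, N (v x) < 0 := by
  obtain ⟨r, hr⟩ := hN.neg
  obtain ⟨B, hB⟩ := (isCompact_Icc (a := -|r|) (b := |r|)).exists_bound_of_continuousOn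
    hN.continuous.continuousOn
  have hB0 : 0 ≤ B := (norm_nonneg _).trans (hB 0 ⟨by simp, by simp⟩)
  -- The plateau has length `2 * L` and contributes `2 * L * N r = -2 * (B + 1)`; the two ramps have
  -- total length `2` and cost at most `2 * B`.
  set L := (B + 1) / (-N r) with hL
  have hL0 : 0 < L := div_pos (by linarith) (by linarith)
  let f : ContDiffBump (0 : ℝ) := ⟨L, L + 1, hL0, by linarith⟩
  set φ : ℝ → ℝ := fun x => r * f x
  have hφ : IsTest φ := ⟨contDiff_const.mul f.contDiff, f.hasCompactSupport.mul_left⟩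
  refine ⟨(hφ.memLp 2).toLp φ, sobFinite_test hφ (by linarith), ?_⟩
  have hi := hN.integrable hs (sobFinite_test hφ (by linarith : 0 ≤ 2 * s))
  set S := Metric.ball (0 : ℝ) L
  set S' := Metric.ball (0 : ℝ) (L + 1) \ S
  have hS : volume.real S = 2 * L := by
    simp only [S, Measure.real, Real.volume_ball]
    exact ENNReal.toReal_ofReal (by linarith)
  have hS' : volume.real S' = 2 := by
    rw [measureReal_sdiff (Metric.ball_subset_ball (by linarith)) Metric.isOpen_ball.measurableSet, hS]
    simp only [Measure.real, Real.volume_ball]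
    rw [ENNReal.toReal_ofReal (by linarith)]; ring
  have hmS : MeasurableSet S := Metric.isOpen_ball.measurableSet
  have hmS' : MeasurableSet S' := Metric.isOpen_ball.measurableSet.diff hmS
  have hiS : Integrable (S.indicator fun _ => N r) :=
    (integrable_indicator_iff hmS).2 (integrableOn_const (measure_ball_lt_top).ne)
  have hiS' : Integrable (S'.indicator fun _ => B) :=
    (integrable_indicator_iff hmS').2 (integrableOn_const
      ((measure_mono sdiff_subset).trans_lt measure_ball_lt_top).ne)
  have hle : ∀ᵐ x, N ((hφ.memLp 2).toLp φ x) ≤ S.indicator (fun _ => N r) x + S'.indicator (fun _ => B) x := by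
    filter_upwards [(hφ.memLp 2).coeFn_toLp] with x hx
    rw [hx]
    by_cases h1 : x ∈ S
    · have : f x = 1 := f.one_of_mem_closedBall (Metric.ball_subset_closedBall h1)
      have h2 : x ∉ S' := fun h => h.2 h1
      simp [φ, this, h1, h2]
    · by_cases h3 : x ∈ Metric.ball (0 : ℝ) (L + 1)
      · have h2 : x ∈ S' := ⟨h3, h1⟩
        simp only [indicator_of_notMem h1, indicator_of_mem h2, zero_add]
        refine (le_abs_self _).trans (hB _ (_root_.abs_le.1 ?_))
        simp only [φ]
        rw [abs_mul, abs_of_nonneg f.nonneg]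
        exact mul_le_of_le_one_right (abs_nonneg r) f.le_one
      · have h2 : x ∉ S' := fun h => h3 h.1
        have : f x = 0 := f.zero_of_le_dist (by simpa using h3)
        simp [φ, this, h1, h2, hN.zero]
  calc ∫ x, N ((hφ.memLp 2).toLp φ x)
      ≤ ∫ x, (S.indicator (fun _ => N r) x + S'.indicator (fun _ => B) x) :=
        integral_mono_ae hi (hiS.add hiS') hle
    _ = 2 * L * N r + 2 * B := by
        rw [integral_add hiS hiS', integral_indicator hmS, integral_indicator hmS',
          setIntegral_const, setIntegral_const, hS, hS']; simp
    _ < 0 := by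
        have : L * N r = -(B + 1) := by
          rw [hL]; have := hr.ne; field_simp
        linarith

/-! ### The minimal energy -/

/-- The infimum of the energy among the states of charge `c`. -/
def minE (s : ℝ) (N : ℝ → ℝ) (c : ℝ) : ℝ :=
  sInf {x | ∃ v : L2R, SobFinite (2 * s) v ∧ charge v = c ∧ energy s N v = x}

theorem charge_nonneg (u : L2R) : 0 ≤ charge u := by rw [charge_eq]; positivity

namespace Admissible

variable {s : ℝ} {m : ℕ} {N : ℝ → ℝ}

/-- Coercivity at fixed charge bounds the energies from below, so that the real infimum is not a
default value. -/
theorem minE_le (hs : 1 / 2 ≤ s) (hN : Admissible s m N) {v : L2R} (hv : SobFinite (2 * s) v) :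
    minE s N (charge v) ≤ energy s N v := by
  obtain ⟨K, hK⟩ := hN.coercive hs (2 * charge v)
  refine csInf_le ⟨-K, ?_⟩ ⟨v, hv, rfl, rfl⟩
  rintro x ⟨w, hw, hc, rfl⟩
  have := hK w hw (by rw [← hc, charge_eq]; linarith)
  linarith [sob_nonneg (2 * s) w]

theorem integral_zero' (hN : Admissible s m N) : ∫ x, N ((0 : L2R) x) = 0 := by
  rw [← integral_zero ℝ ℝ]
  apply integral_congr_ae
  filter_upwards [Lp.coeFn_zero ℝ 2 (volume : Measure ℝ)] with x hx
  rw [hx, Pi.zero_apply, hN.zero]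

theorem charge_pos_of_integral_neg (hN : Admissible s m N) {v : L2R} (hv : ∫ x, N (v x) < 0) :
    0 < charge v := by
  rw [charge_eq]
  have : v ≠ 0 := by
    rintro rfl
    rw [hN.integral_zero'] at hv
    exact lt_irrefl _ hv
  have := norm_pos_iff.2 this
  positivity

theorem exists_charge_eq (hs : 1 / 2 ≤ s) (hN : Admissible s m N) {c : ℝ} (hc : 0 < c) :
    ∃ v : L2R, SobFinite (2 * s) v ∧ charge v = c := by
  obtain ⟨v, hv, hneg⟩ := hN.exists_integral_neg hs
  have h0 := hN.charge_pos_of_integral_neg hneg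
  have hθ : 0 < c / charge v := by positivity
  exact ⟨dilate hθ v, sobFinite_dilate hθ hv, by rw [charge_dilate, div_mul_cancel₀ _ h0.ne']⟩

theorem exists_energy_lt (hs : 1 / 2 ≤ s) (hN : Admissible s m N) {c e : ℝ} (hc : 0 < c)
    (he : minE s N c < e) :
    ∃ v : L2R, SobFinite (2 * s) v ∧ charge v = c ∧ energy s N v < e := by
  obtain ⟨v, hv, hvc⟩ := hN.exists_charge_eq hs hc
  obtain ⟨x, ⟨w, hw, hwc, rfl⟩, hx⟩ := exists_lt_of_csInf_lt (by exact ⟨_, v, hv, hvc, rfl⟩) he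
  exact ⟨w, hw, hwc, hx⟩

/-- Near-minimizers of charge `c` are stretched to charge `θ * c`. -/
theorem minE_mul_le (hs : 1 / 2 ≤ s) (hN : Admissible s m N) {c θ : ℝ} (hc : 0 < c) (hθ : 1 ≤ θ) :
    minE s N (θ * c) ≤ θ * minE s N c := by
  have hθ0 : 0 < θ := one_pos.trans_le hθ
  have key : minE s N (θ * c) / θ ≤ minE s N c := by
    apply le_of_forall_gt_imp_ge_of_dense
    intro e he
    obtain ⟨v, hv, hvc, hve⟩ := hN.exists_energy_lt hs hc he
    have h1 := hN.minE_le hs (sobFinite_dilate hθ0 hv)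
    rw [charge_dilate, hvc] at h1
    have h2 := energy_dilate_le hθ hs N v
    have h3 : 0 ≤ 1 / 2 * (θ - 1) * sob (2 * s) v :=
      mul_nonneg (by linarith) (sob_nonneg _ _)
    rw [div_le_iff₀ hθ0]
    nlinarith
  rw [div_le_iff₀ hθ0] at key
  linarith

theorem minE_div_le (hs : 1 / 2 ≤ s) (hN : Admissible s m N) {a c : ℝ} (ha : 0 < a) (hac : a ≤ c) :
    minE s N c / c ≤ minE s N a / a := by
  have := hN.minE_mul_le hs ha (one_le_div ha |>.2 hac)
  rw [div_mul_cancel₀ _ ha.ne'] at this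
  rw [div_le_iff₀ (ha.trans_le hac)]
  calc _ ≤ _ := this
    _ = _ := by ring

/-- If the energy at `a` is not negative, the signs decide. Otherwise near-minimizers of charge `a`
have seminorm at least a fixed `τ`, so stretching them gains a definite amount that beats the error
of near-minimality. -/
theorem minE_div_lt (hs : 1 / 2 ≤ s) (hN : Admissible s m N) {a c : ℝ} (ha : 0 < a) (hac : a < c)
    (hneg : minE s N c < 0) : minE s N c / c < minE s N a / a := by
  have hc : 0 < c := ha.trans hac
  rcases le_or_gt 0 (minE s N a) with h0 | h0
  · exact (div_neg_of_neg_of_pos hneg hc).trans_le (by positivity)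
  set θ := c / a with hθ
  have hθ1 : 1 < θ := (one_lt_div ha).2 hac
  have hθ0 : 0 < θ := one_pos.trans hθ1
  obtain ⟨K, hK⟩ := hN.coercive hs (2 * a)
  obtain ⟨τ, hτ, hle⟩ := hN.exists_le_sob hs (2 * a + 4 * K) (by linarith : 0 < -(minE s N a / 2))
  -- The tolerance for near-minimality: stretching multiplies it by `θ`, which is exactly the
  -- guaranteed gain.
  have hgap : 0 < 1 / 2 * (θ - 1) * τ / θ := by
    have : 0 < θ - 1 := by linarith
    positivity
  obtain ⟨v, hv, hvc, hve⟩ := hN.exists_energy_lt hs ha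
    (lt_min (by linarith : minE s N a < minE s N a / 2) (lt_add_of_pos_right _ hgap))
  have hv2 : ‖v‖ ^ 2 = 2 * a := by rw [← hvc, charge_eq]; ring
  have h1 := hve.trans_le (min_le_left _ _)
  have h2 := hve.trans_le (min_le_right _ _)
  have h3 := hK v hv hv2.le
  have h4 : hsq s v ≤ 2 * a + 4 * K := by rw [hsq, hv2]; linarith
  have h5 : ∫ x, N (v x) ≤ -(-(minE s N a / 2)) := by
    rw [energy_eq] at h1
    linarith [sob_nonneg (2 * s) v]
  have h6 := hle v hv h4 h5
  have h7 := hN.minE_le hs (sobFinite_dilate hθ0 hv)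
  have hθa : θ * a = c := div_mul_cancel₀ _ ha.ne'
  rw [charge_dilate, hvc, hθa] at h7
  have h8 := energy_dilate_le hθ1.le hs N v
  have h9 : 1 / 2 * (θ - 1) * τ ≤ 1 / 2 * (θ - 1) * sob (2 * s) v :=
    mul_le_mul_of_nonneg_left h6 (by linarith)
  have h10 : θ * energy s N v < θ * minE s N a + 1 / 2 * (θ - 1) * τ := by
    have := mul_lt_mul_of_pos_left h2 hθ0
    rwa [mul_add, mul_div_cancel₀ _ hθ0.ne'] at this
  have h11 : minE s N c < θ * minE s N a := by linarith
  rw [div_lt_iff₀ hc]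
  calc _ < _ := h11
    _ = _ := by rw [hθ]; ring

theorem exists_minE_neg (hs : 1 / 2 ≤ s) (hN : Admissible s m N) :
    ∃ c₀, 0 < c₀ ∧ ∀ c, c₀ ≤ c → minE s N c < 0 := by
  obtain ⟨v, hv, hneg⟩ := hN.exists_integral_neg hs
  have h0 := hN.charge_pos_of_integral_neg hneg
  -- Chosen so that `θ * ∫ N(v) = ∫ N(v) - sob (2 * s) v`, which outweighs the kinetic term of at
  -- most half the seminorm.
  set θ := 1 + sob (2 * s) v / (-∫ x, N (v x)) with hθ
  have hq : 0 ≤ sob (2 * s) v / (-∫ x, N (v x)) := div_nonneg (sob_nonneg _ _) (by linarith)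
  have hθ1 : 1 ≤ θ := by linarith
  have hθ0 : 0 < θ := one_pos.trans_le hθ1
  have h1 : energy s N (dilate hθ0 v) < 0 := by
    rw [energy_dilate]
    have h2 : θ ^ (1 - 2 * s) ≤ 1 := Real.rpow_le_one_of_one_le_of_nonpos hθ1 (by linarith)
    have h3 : θ * ∫ x, N (v x) = (∫ x, N (v x)) - sob (2 * s) v := by
      rw [hθ, add_mul]
      have := hneg.ne
      field_simp
      ring
    nlinarith [sob_nonneg (2 * s) v]
  have h2 := (hN.minE_le hs (sobFinite_dilate hθ0 hv)).trans_lt h1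
  have hc0 : 0 < charge (dilate hθ0 v) := by rw [charge_dilate]; positivity
  refine ⟨charge (dilate hθ0 v), hc0, fun c hc => ?_⟩
  have h3 := hN.minE_div_le hs hc0 hc
  have h4 := h3.trans_lt (div_neg_of_neg_of_pos h2 hc0)
  by_contra hcon
  exact absurd h4 (not_lt.2 (div_nonneg (not_lt.1 hcon) (hc0.le.trans hc)))

end Admissible

/-! ### Compactness of minimizing sequences -/

theorem hsq_sub_le {s : ℝ} {u v : L2R} (hu : SobFinite (2 * s) u) (hv : SobFinite (2 * s) v) :
    hsq s (u - v) ≤ 2 * hsq s u + 2 * hsq s v := by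
  rw [← norm_lift_sq hu, ← norm_lift_sq hv, ← norm_lift_sq (sobFinite_sub hu hv), lift_sub hu hv]
  have := norm_sub_le (lift hu) (lift hv)
  nlinarith [sq_nonneg (‖lift hu‖ - ‖lift hv‖), norm_nonneg (lift hu - lift hv)]

/-- The concentration-compactness step. Vanishing is excluded by the low-frequency peak and
splitting by `minE_div_lt`. The charges need only converge to `c`, as the stability argument
requires. -/
theorem Admissible.exists_tendsto {s : ℝ} {m : ℕ} {N : ℝ → ℝ} (hs : 1 / 2 ≤ s)
    (hN : Admissible s m N) {c : ℝ} (hc : 0 < c) (hneg : minE s N c < 0) {u : ℕ → L2R}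
    (hu : ∀ n, SobFinite (2 * s) (u n)) (huc : Tendsto (fun n => charge (u n)) atTop (𝓝 c))
    (hue : Tendsto (fun n => energy s N (u n)) atTop (𝓝 (minE s N c))) :
    ∃ φ : ℕ → ℕ, StrictMono φ ∧ ∃ (a : ℕ → ℝ) (v : L2R), SobFinite (2 * s) v ∧ charge v = c ∧
      energy s N v = minE s N c ∧
      Tendsto (fun n => hsq s (translate (a n) (u (φ n)) - v)) atTop (𝓝 0) := by
  obtain ⟨K, hK⟩ := hN.coercive hs (2 * (c + 1))
  set M := 2 * (c + 1) + 4 * K with hM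
  -- Beyond `n₀` the energy is at most `minE s N c / 2 < 0`, and so is the potential energy, since
  -- the kinetic part is nonnegative.
  obtain ⟨n₀, hn₀⟩ := eventually_atTop.1 ((huc.eventually_le_const (lt_add_one c)).and
    (hue.eventually_le_const (by linarith : minE s N c < minE s N c / 2)))
  obtain ⟨k, κ, hk, hκ, hlow⟩ := hN.exists_le_norm_low hs M (by linarith : 0 < -(minE s N c / 2))
  have hbd : ∀ n, hsq s (u (n + n₀)) ≤ M ∧ ∃ x, κ ≤ ‖low k (u (n + n₀)) x‖ := by
    intro n
    obtain ⟨h1, h2⟩ := hn₀ (n + n₀) (by omega)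
    have h3 : ‖u (n + n₀)‖ ^ 2 ≤ 2 * (c + 1) := by rw [charge_eq] at h1; linarith
    have h4 := hK _ (hu (n + n₀)) h3
    have h5 : hsq s (u (n + n₀)) ≤ M := by rw [hsq, hM]; linarith
    refine ⟨h5, hlow _ (hu _) h5 ?_⟩
    rw [energy_eq] at h2
    linarith [sob_nonneg (2 * s) (u (n + n₀))]
  choose hbM x hx using hbd
  set t : ℕ → L2R := fun n => translate (-x n) (u (n + n₀)) with ht
  have htf : ∀ n, SobFinite (2 * s) (t n) := fun n => sobFinite_translate _ (hu _)
  have htM : ∀ n, hsq s (t n) ≤ M := fun n => by simp only [ht, hsq_translate]; exact hbM n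
  obtain ⟨φ, hφ, v, hv, hl, hn, hh⟩ := exists_weak_subseq htf htM
  set w : ℕ → L2R := fun n => t (φ n) - v with hw
  have hwf : ∀ n, SobFinite (2 * s) (w n) := fun n => sobFinite_sub (htf _) hv
  have hwM : ∀ n, hsq s (w n) ≤ 2 * M + 2 * hsq s v := fun n =>
    (hsq_sub_le (htf _) hv).trans (by linarith [htM (φ n)])
  -- The low part at the origin has modulus at least `κ` after translation, and it converges, so the
  -- weak limit cannot vanish.
  have hv0 : 0 < charge v := by
    rw [charge_eq]
    have : v ≠ 0 := by
      rintro rfl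
      have h1 := (hl k 0).norm
      simp only [sub_zero, norm_zero] at h1
      have h2 := ge_of_tendsto' h1 (b := κ) fun n => by
        simp only [ht, low_translate, zero_sub, neg_neg]
        exact hx (φ n)
      linarith
    have := norm_pos_iff.2 this
    positivity
  have hsplit := hN.tendsto_split hs hv (fun n => htf (φ n)) hwM hl
  have hphi : Tendsto (fun n => φ n + n₀) atTop atTop :=
    (tendsto_add_atTop_nat n₀).comp hφ.tendsto_atTop
  have hwc : Tendsto (fun n => charge (w n)) atTop (𝓝 (c - charge v)) := by
    have h1 := ((huc.comp hphi).sub_const (charge v)).sub (hn.const_mul (1 / 2))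
    rw [mul_zero, sub_zero] at h1
    refine h1.congr fun n => ?_
    simp only [Function.comp, hw, ht, charge_eq, norm_translate]
    ring
  have hwe : Tendsto (fun n => energy s N (w n)) atTop (𝓝 (minE s N c - energy s N v)) := by
    have h1 := (((hue.comp hphi).sub_const (energy s N v)).sub
      ((hh.sub hn).const_mul (1 / 2))).sub hsplit
    simp only [sub_zero, mul_zero] at h1
    refine h1.congr fun n => ?_
    have e : energy s N (u (φ n + n₀)) = energy s N (t (φ n)) := by
      simp only [ht, energy_translate]
    simp only [Function.comp, e, hw, hsq, energy_eq]
    ring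
  have hle : charge v ≤ c := by
    have := ge_of_tendsto' hwc fun n => charge_nonneg (w n)
    linarith
  have hEv := hN.minE_le hs hv
  have hceq : charge v = c := by
    by_contra hne
    have hlt : charge v < c := lt_of_le_of_ne hle hne
    set a := charge v with ha
    -- An intermediate charge strictly between `c - a` and `c`: eventually the remainder has charge
    -- at most `b`, so its energy per charge is at least `minE s N b / b`, strictly above the value
    -- at `c`. Then `v` and the remainder together would need more than `minE s N c`.
    set b := c - a / 2 with hb
    have hb0 : 0 < b := by linarith
    have h1 : (c - a) * (minE s N b / b) ≤ minE s N c - energy s N v := by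
      refine le_of_tendsto_of_tendsto (hwc.mul_const _) hwe ?_
      filter_upwards [hwc.eventually_const_lt (by linarith : 0 < c - a),
        hwc.eventually_le_const (by linarith : c - a < b)] with n h1 h2
      have h3 := hN.minE_div_le hs h1 h2
      rw [le_div_iff₀ h1] at h3
      have h4 := hN.minE_le hs (hwf n)
      linarith
    have h2 := hN.minE_div_lt hs hb0 (by linarith : b < c) hneg
    have h3 := hN.minE_div_le hs hv0 hle
    rw [le_div_iff₀ hv0] at h3
    have h4 := mul_lt_mul_of_pos_left h2 (by linarith : 0 < c - a)
    have h5 : minE s N c / c * a + (c - a) * (minE s N c / c) = minE s N c := by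
      field_simp; ring
    linarith
  have hnw : Tendsto (fun n => ‖w n‖ ^ 2) atTop (𝓝 0) := by
    have h1 := hwc.const_mul 2
    rw [hceq, sub_self, mul_zero] at h1
    refine h1.congr fun n => ?_
    rw [charge_eq]; ring
  have hnw1 : Tendsto (fun n => ‖w n‖) atTop (𝓝 0) := by
    have := (Real.continuous_sqrt.tendsto 0).comp hnw
    simpa [Function.comp_def, Real.sqrt_sq (norm_nonneg _)] using this
  have hNw : Tendsto (fun n => ∫ x, N (w n x)) atTop (𝓝 0) := by
    obtain ⟨C, hC, h⟩ := hN.abs_integral_sub_le hs (2 * M + 2 * hsq s v)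
    have h0 : SobFinite (2 * s) 0 := by simpa using sobFinite_sub hv hv
    have hM0 : hsq s 0 ≤ 2 * M + 2 * hsq s v := by
      have e : fourierL2 0 = 0 := by simpa using fourierL2_sub 0 0
      have : hsq s 0 = 0 := by
        rw [← norm_lift_sq h0]
        have := lift_sub hv hv
        have h3 : lift h0 = 0 := by
          have h2 := lift_sub h0 h0
          have h4 : lift (sobFinite_sub h0 h0) = lift h0 := by congr 1; simp
          rw [← h4, h2, sub_self]
        rw [h3]; simp
      rw [this]; exact (hsq_nonneg _ _).trans (hwM 0)
    refine squeeze_zero_norm (fun n => ?_) (by simpa using hnw1.const_mul C)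
    have := h (w n) 0 (hwf n) h0 (hwM n) hM0
    rwa [hN.integral_zero', sub_zero, sub_zero] at this
  have hsw : Tendsto (fun n => sob (2 * s) (w n)) atTop (𝓝 (2 * (minE s N c - energy s N v))) := by
    have h1 := (hwe.sub hNw).const_mul 2
    rw [sub_zero] at h1
    refine h1.congr fun n => ?_
    rw [energy_eq]; ring
  -- As a limit of seminorms this is nonnegative, whereas `v` is a competitor of charge `c`; hence
  -- the limit is zero and the convergence is strong in `H^s`.
  have hge : 0 ≤ 2 * (minE s N c - energy s N v) :=
    ge_of_tendsto' hsw fun n => sob_nonneg _ _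
  rw [hceq] at hEv
  have heq : energy s N v = minE s N c := by linarith
  refine ⟨fun n => φ n + n₀, fun i j hij => by have := hφ hij; simp only; omega,
    fun n => -x (φ n), v, hv, hceq, heq, ?_⟩
  rw [heq, sub_self, mul_zero] at hsw
  simpa [hsq] using hnw.add hsw


/-! ### The Euler-Lagrange equation -/

/-- The bilinear form of `sob σ`. -/
def sobInner (σ : ℝ) (u v : L2R) : ℝ :=
  ∫ ξ, freq ξ ^ σ * (fourierL2 u ξ * (starRingEnd ℂ) (fourierL2 v ξ)).re

theorem integrable_sobInner {σ : ℝ} {u v : L2R} (hu : SobFinite σ u) (hv : SobFinite σ v) :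
    Integrable fun ξ => freq ξ ^ σ * (fourierL2 u ξ * (starRingEnd ℂ) (fourierL2 v ξ)).re := by
  have hm : Measurable fun ξ => freq ξ ^ σ * (fourierL2 u ξ * (starRingEnd ℂ) (fourierL2 v ξ)).re :=
    (measurable_freq_rpow σ).mul (Complex.measurable_re.comp ((measurable_fourierL2 u).mul
      (Complex.continuous_conj.measurable.comp (measurable_fourierL2 v))))
  refine (Integrable.add hu hv).mono' hm.aestronglyMeasurable (Eventually.of_forall fun ξ => ?_)
  rw [norm_mul, Real.norm_of_nonneg (freq_rpow_nonneg _ _), Pi.add_apply, ← mul_add]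
  refine mul_le_mul_of_nonneg_left ?_ (freq_rpow_nonneg _ _)
  refine (Complex.abs_re_le_norm _).trans ?_
  rw [norm_mul, RCLike.norm_conj]
  nlinarith [sq_nonneg (‖fourierL2 u ξ‖ - ‖fourierL2 v ξ‖), norm_nonneg (fourierL2 u ξ),
    norm_nonneg (fourierL2 v ξ)]

theorem sob_add_smul {σ : ℝ} {u v : L2R} (hu : SobFinite σ u) (hv : SobFinite σ v) (t : ℝ) :
    sob σ (u + t • v) = sob σ u + 2 * t * sobInner σ u v + t ^ 2 * sob σ v := by
  have h1 := integrable_sobInner hu hv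
  have h2 : Integrable fun ξ => freq ξ ^ σ * ‖fourierL2 u ξ‖ ^ 2
      + 2 * t * (freq ξ ^ σ * (fourierL2 u ξ * (starRingEnd ℂ) (fourierL2 v ξ)).re) :=
    Integrable.add hu (h1.const_mul _)
  rw [sob, sob, sob, sobInner, ← integral_const_mul, ← integral_const_mul,
    ← integral_add hu (h1.const_mul _), ← integral_add h2 (Integrable.const_mul hv _)]
  apply integral_congr_ae
  filter_upwards [Lp.coeFn_add (fourierL2 u) ((t : ℂ) • fourierL2 v),
    Lp.coeFn_smul (t : ℂ) (fourierL2 v)] with ξ h1 h2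
  rw [fourierL2_add, fourierL2_smul, h1, Pi.add_apply, h2, Pi.smul_apply, ← Complex.normSq_eq_norm_sq,
    Complex.normSq_add, Complex.normSq_eq_norm_sq, Complex.normSq_eq_norm_sq, norm_smul,
    Complex.norm_real, mul_pow, Real.norm_eq_abs, sq_abs, smul_eq_mul, map_mul, Complex.conj_ofReal,
    mul_left_comm, Complex.re_ofReal_mul]
  ring

theorem Admissible.memLp_deriv {s : ℝ} {m : ℕ} {N : ℝ → ℝ} (hs : 1 / 2 ≤ s)
    (hN : Admissible s m N) {u : L2R} (hu : SobFinite (2 * s) u) :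
    MemLp (fun x => deriv N (u x)) 2 := by
  obtain ⟨C, hC, h⟩ := hN.deriv_le 1 one_pos
  have h1 : MemLp (fun x => 1 * |u x| + C * |u x| ^ m) 2 :=
    ((Lp.memLp u).norm.const_mul 1).add ((memLp_pow hs (by have := hN.two_le; omega) hu).const_mul C)
  refine h1.of_le (hN.continuous_deriv.comp_aestronglyMeasurable (Lp.aestronglyMeasurable u))
    (Eventually.of_forall fun x => ?_)
  rw [Real.norm_eq_abs]
  exact (h _).trans (le_abs_self _)

theorem Admissible.hasDerivAt_integral {s : ℝ} {m : ℕ} {N : ℝ → ℝ} (hs : 1 / 2 ≤ s)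
    (hN : Admissible s m N) {u v : L2R} (hu : SobFinite (2 * s) u) (hv : SobFinite (2 * s) v) :
    HasDerivAt (fun t : ℝ => ∫ x, N ((u + t • v) x)) (∫ x, deriv N (u x) * v x) 0 := by
  obtain ⟨C, hC, h⟩ := hN.deriv_le 1 one_pos
  have hm := hN.two_le
  have e : (fun t : ℝ => ∫ x, N ((u + t • v) x)) = fun t : ℝ => ∫ x, N (u x + t * v x) := by
    ext t
    apply integral_congr_ae
    filter_upwards [Lp.coeFn_add u (t • v), Lp.coeFn_smul t v] with x h1 h2
    rw [h1, Pi.add_apply, h2]; rfl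
  rw [e]
  set bound : ℝ → ℝ := fun x => (|u x| + |v x|) * |v x|
    + C * (2 ^ (m - 1) * (|u x| ^ m + |v x| ^ m)) * |v x| with hbound
  have hvm : MemLp (fun x => |v x|) 2 := (Lp.memLp v).norm
  have b1 : Integrable fun x => (|u x| + |v x|) * |v x| :=
    ((Lp.memLp u).norm.add hvm).integrable_mul hvm
  have b2 : Integrable fun x => C * (2 ^ (m - 1) * (|u x| ^ m + |v x| ^ m)) * |v x| :=
    ((((memLp_pow hs (by omega) hu).add (memLp_pow hs (by omega) hv)).const_mul
      (2 ^ (m - 1))).const_mul C).integrable_mul hvm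
  have hmeas : ∀ t : ℝ, AEStronglyMeasurable (fun x => u x + t * v x) volume := fun t =>
    (Lp.aestronglyMeasurable u).add ((Lp.aestronglyMeasurable v).const_mul t)
  have key := hasDerivAt_integral_of_dominated_loc_of_deriv_le (μ := volume) (𝕜 := ℝ)
    (F := fun t x => N (u x + t * v x)) (F' := fun t x => deriv N (u x + t * v x) * v x)
    (x₀ := 0) (s := Metric.ball 0 1) (bound := bound) (Metric.ball_mem_nhds 0 one_pos)
    (Eventually.of_forall fun t => hN.continuous.comp_aestronglyMeasurable (hmeas t))
    (by simpa using hN.integrable hs hu)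
    ((hN.continuous_deriv.comp_aestronglyMeasurable (hmeas 0)).mul (Lp.aestronglyMeasurable v))
    (Eventually.of_forall fun x t ht => ?_) (b1.add b2)
    (Eventually.of_forall fun x t _ => ?_)
  · simpa using key.2
  · have ht : |t| ≤ 1 := by
      rw [mem_ball_zero_iff, Real.norm_eq_abs] at ht; exact ht.le
    have h1 : |u x + t * v x| ≤ |u x| + |v x| := by
      refine (abs_add_le _ _).trans ?_
      rw [abs_mul]
      have := mul_le_mul_of_nonneg_right ht (abs_nonneg (v x))
      linarith
    have h2 : |u x + t * v x| ^ m ≤ 2 ^ (m - 1) * (|u x| ^ m + |v x| ^ m) :=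
      (pow_le_pow_left₀ (abs_nonneg _) h1 m).trans (add_pow_le (abs_nonneg _) (abs_nonneg _) m)
    rw [norm_mul, Real.norm_eq_abs, Real.norm_eq_abs]
    simp only [hbound]
    rw [← add_mul]
    refine mul_le_mul_of_nonneg_right ((h _).trans ?_) (abs_nonneg _)
    rw [one_mul]
    gcongr
  · have h1 : HasDerivAt (fun t : ℝ => u x + t * v x) (v x) t := by
      simpa using ((hasDerivAt_id t).mul_const (v x)).const_add (u x)
    exact (hN.differentiable _).hasDerivAt.comp t h1

theorem charge_add_smul (u v : L2R) (t : ℝ) :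
    charge (u + t • v) = charge u + t * inner ℝ u v + t ^ 2 * charge v := by
  rw [charge_eq, charge_eq, charge_eq, norm_add_sq_real, inner_smul_right, norm_smul, mul_pow,
    Real.norm_eq_abs, sq_abs]
  ring

/-- The constraint is kept exactly by stretching `u + t • v` back to charge `c`, so the energy
becomes a function of one real variable with a local minimum at `0`. -/
theorem Admissible.eulerLagrange {s : ℝ} {m : ℕ} {N : ℝ → ℝ} (hs : 1 / 2 ≤ s)
    (hN : Admissible s m N) {u : L2R} (hu : SobFinite (2 * s) u) (hc : 0 < charge u)
    (hmin : energy s N u = minE s N (charge u)) :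
    ∃ μ : ℝ, ∀ v : L2R, SobFinite (2 * s) v →
      sobInner (2 * s) u v + ∫ x, deriv N (u x) * v x = μ * inner ℝ u v := by
  set c := charge u with hcdef
  -- The multiplier is the derivative of the energy in the stretching factor at `θ = 1`, divided by
  -- `c`; the factor itself has derivative `-b / c` at `t = 0`.
  refine ⟨((1 - 2 * s) / 2 * sob (2 * s) u + ∫ x, N (u x)) / c, fun v hv => ?_⟩
  set b := (inner ℝ u v : ℝ)
  set q : ℝ → ℝ := fun t => charge (u + t • v) with hq
  set θ : ℝ → ℝ := fun t => c / q t with hθ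
  have hq0 : q 0 = c := by simp [hq, hcdef]
  have hθ0 : θ 0 = 1 := by simp only [hθ, hq0]; exact div_self hc.ne'
  have dq : HasDerivAt q b 0 := by
    have h1 : HasDerivAt (fun t : ℝ => c + t * b + t ^ 2 * charge v) (1 * b + (2 * 0 ^ 1 * 1) * charge v) 0 := by
      have := (((hasDerivAt_id (0 : ℝ)).mul_const b).const_add c).add
        (((hasDerivAt_id (0 : ℝ)).pow 2).mul_const (charge v))
      exact this.congr_deriv (by simp)
    have h2 : q = fun t : ℝ => c + t * b + t ^ 2 * charge v := by
      ext t; exact charge_add_smul u v t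
    rw [h2]; simpa using h1
  have dθ : HasDerivAt θ (-b / c) 0 := by
    have h1 := (hasDerivAt_const (0 : ℝ) c).div dq (by rw [hq0]; exact hc.ne')
    rw [hq0] at h1
    refine h1.congr_deriv ?_
    field_simp
    ring
  have dT : HasDerivAt (fun t : ℝ => sob (2 * s) (u + t • v)) (2 * sobInner (2 * s) u v) 0 := by
    have h2 : (fun t : ℝ => sob (2 * s) (u + t • v)) =
        fun t => sob (2 * s) u + t * (2 * sobInner (2 * s) u v) + t ^ 2 * sob (2 * s) v := by
      ext t; rw [sob_add_smul hu hv]; ring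
    rw [h2]
    have := (((hasDerivAt_id (0 : ℝ)).mul_const (2 * sobInner (2 * s) u v)).const_add
      (sob (2 * s) u)).add (((hasDerivAt_id (0 : ℝ)).pow 2).mul_const (sob (2 * s) v))
    exact this.congr_deriv (by simp)
  have dN := hN.hasDerivAt_integral hs hu hv
  have dp : HasDerivAt (fun t => θ t ^ (1 - 2 * s)) (-b / c * (1 - 2 * s)) 0 := by
    have := dθ.rpow_const (p := 1 - 2 * s) (Or.inl (by rw [hθ0]; exact one_ne_zero))
    simpa [hθ0] using this
  have dK := ((dp.mul dT).const_mul (1 / 2)).add (dθ.mul dN)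
  have hloc : IsLocalMin (fun t => 1 / 2 * (θ t ^ (1 - 2 * s) * sob (2 * s) (u + t • v))
      + θ t * ∫ x, N ((u + t • v) x)) 0 := by
    have hpos : ∀ᶠ t in 𝓝 (0 : ℝ), 0 < q t :=
      dq.continuousAt.eventually (lt_mem_nhds (by rw [hq0]; exact hc))
    filter_upwards [hpos] with t ht
    have hθt : 0 < θ t := div_pos hc ht
    have h1 := hN.minE_le hs (sobFinite_dilate hθt (sobFinite_add hu (sobFinite_smul t hv)))
    have h2 : θ t * charge (u + t • v) = c := div_mul_cancel₀ _ ht.ne'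
    rw [charge_dilate, h2, energy_dilate, ← hmin, energy_eq] at h1
    simpa [hθ0] using h1
  have h0 := hloc.hasDerivAt_eq_zero dK
  rw [hθ0] at h0
  simp only [Real.one_rpow, zero_smul, add_zero] at h0
  field_simp
  field_simp at h0
  linarith

/-- The stationary equation `D^{2s} u + N'(u) = μ u`, on the Fourier side. -/
def IsProfile (s : ℝ) (N : ℝ → ℝ) (μ : ℝ) (u : L2R) : Prop :=
  ∃ f : L2R, (∀ᵐ x, f x = μ * u x - deriv N (u x)) ∧
    ∀ᵐ ξ, ((freq ξ ^ (2 * s) : ℝ) : ℂ) * fourierL2 u ξ = fourierL2 f ξ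

/-- The weak equation is available only against `H^s`. The residual on the Fourier side, cut off at
frequency `k`, is Hermitian and in `L²`, hence the transform of a real admissible test function;
testing the equation with it shows that it vanishes. -/
theorem Admissible.exists_isProfile {s : ℝ} {m : ℕ} {N : ℝ → ℝ} (hs : 1 / 2 ≤ s)
    (hN : Admissible s m N) {u : L2R} (hu : SobFinite (2 * s) u) (hc : 0 < charge u)
    (hmin : energy s N u = minE s N (charge u)) : ∃ μ, IsProfile s N μ u := by
  obtain ⟨μ, hμ⟩ := hN.eulerLagrange hs hu hc hmin
  have hf : MemLp (fun x => μ * u x - deriv N (u x)) 2 :=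
    ((Lp.memLp u).const_mul μ).sub (hN.memLp_deriv hs hu)
  set f : L2R := hf.toLp _ with hfdef
  refine ⟨μ, f, hf.coeFn_toLp, ?_⟩
  have hEL : ∀ v : L2R, SobFinite (2 * s) v →
      sobInner (2 * s) u v = (∫ ξ, fourierL2 f ξ * (starRingEnd ℂ) (fourierL2 v ξ)).re := by
    intro v hv
    rw [← integral_mul_eq_fourierL2]
    have h1 : ∫ x, f x * v x = ∫ x, (μ * (u x * v x) - deriv N (u x) * v x) := by
      apply integral_congr_ae
      filter_upwards [hf.coeFn_toLp] with x hx
      rw [hx]; ring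
    have i1 : Integrable fun x => u x * v x := (Lp.memLp u).integrable_mul (Lp.memLp v)
    have i2 : Integrable fun x => deriv N (u x) * v x :=
      (hN.memLp_deriv hs hu).integrable_mul (Lp.memLp v)
    rw [h1, integral_sub (i1.const_mul μ) i2, integral_const_mul, ← inner_L2R]
    linarith [hμ v hv]
  set g : ℝ → ℂ := fun ξ => ((freq ξ ^ (2 * s) : ℝ) : ℂ) * fourierL2 u ξ - fourierL2 f ξ with hg
  have hgm : Measurable g :=
    ((Complex.measurable_ofReal.comp (measurable_freq_rpow _)).mul (measurable_fourierL2 u)).sub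
      (measurable_fourierL2 f)
  have hgh : ∀ᵐ ξ, g (-ξ) = (starRingEnd ℂ) (g ξ) := by
    filter_upwards [fourierL2_hermitian u, fourierL2_hermitian f] with ξ h1 h2
    simp only [hg]
    rw [h1, h2, freq_neg, map_sub, map_mul, Complex.conj_ofReal]
  have key : ∀ k : ℕ, ∀ᵐ ξ, ξ ∈ lowSet k → g ξ = 0 := by
    intro k
    have hb : MemLp (fun ξ => (lowSet k).indicator (fun ξ => ((freq ξ ^ (2 * s) : ℝ) : ℂ)) ξ
        * fourierL2 u ξ) 2 := by
      refine (Lp.memLp (fourierL2 u)).of_le_mul (c := (k : ℝ) ^ (2 * s)) ?_ ?_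
      · exact (((Complex.measurable_ofReal.comp (measurable_freq_rpow _)).indicator
          (measurableSet_lowSet k)).mul (measurable_fourierL2 u)).aestronglyMeasurable
      · refine Eventually.of_forall fun ξ => ?_
        rw [norm_mul]
        refine mul_le_mul_of_nonneg_right ?_ (norm_nonneg _)
        by_cases h : ξ ∈ lowSet k
        · rw [indicator_of_mem h, Complex.norm_real, Real.norm_of_nonneg (freq_rpow_nonneg _ _)]
          exact Real.rpow_le_rpow (freq_nonneg ξ) (le_of_lt h) (by linarith)
        · rw [indicator_of_notMem h, norm_zero]
          positivity
    have hG : MemLp ((lowSet k).indicator g) 2 := by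
      have := hb.sub ((Lp.memLp (fourierL2 f)).indicator (measurableSet_lowSet k))
      refine this.ae_eq (Eventually.of_forall fun ξ => ?_)
      by_cases h : ξ ∈ lowSet k <;> simp [h, hg]
    have hGae := hG.coeFn_toLp
    have hherm : ∀ᵐ ξ, hG.toLp _ (-ξ) = (starRingEnd ℂ) (hG.toLp _ ξ) := by
      filter_upwards [hGae, ae_comp_neg hGae, hgh] with ξ h1 h2 h3
      rw [h1, h2]
      have hiff : -ξ ∈ lowSet k ↔ ξ ∈ lowSet k := by simp [lowSet, freq_neg]
      by_cases h : ξ ∈ lowSet k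
      · rw [indicator_of_mem h, indicator_of_mem (hiff.2 h), h3]
      · rw [indicator_of_notMem h, indicator_of_notMem (fun h' => h (hiff.1 h')), map_zero]
    obtain ⟨v, hv⟩ := exists_fourierL2_eq hherm
    have hvae : fourierL2 v =ᵐ[volume] (lowSet k).indicator g := by rw [hv]; exact hGae
    have hvf : SobFinite (2 * s) v := by
      refine ((integrable_norm_sq (fourierL2 v)).const_mul ((k : ℝ) ^ (2 * s))).mono'
        (aestronglyMeasurable_sob _ _) ?_
      filter_upwards [hvae] with ξ h
      rw [Real.norm_of_nonneg (mul_nonneg (freq_rpow_nonneg _ _) (sq_nonneg _)), h]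
      by_cases h : ξ ∈ lowSet k
      · refine mul_le_mul_of_nonneg_right ?_ (sq_nonneg _)
        exact Real.rpow_le_rpow (freq_nonneg ξ) (le_of_lt h) (by linarith)
      · simp [h]
    have h1 := hEL v hvf
    have hint : Integrable fun ξ => fourierL2 f ξ * (starRingEnd ℂ) (fourierL2 v ξ) := by
      have := L2.integrable_inner (𝕜 := ℂ) (fourierL2 v) (fourierL2 f)
      simpa only [RCLike.inner_apply] using this
    have h2 : (∫ ξ, fourierL2 f ξ * (starRingEnd ℂ) (fourierL2 v ξ)).re
        = ∫ ξ, (fourierL2 f ξ * (starRingEnd ℂ) (fourierL2 v ξ)).re :=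
      (integral_re hint).symm
    have hre : Integrable fun ξ => (fourierL2 f ξ * (starRingEnd ℂ) (fourierL2 v ξ)).re := hint.re
    rw [h2, sobInner, ← sub_eq_zero, ← integral_sub (integrable_sobInner hu hvf) hre] at h1
    -- With `v` equal to the truncated residual, the pairing in `h1` is the square of its own norm.
    have h3 : ∫ ξ, ‖(lowSet k).indicator g ξ‖ ^ 2 = 0 := by
      rw [← h1]
      apply integral_congr_ae
      filter_upwards [hvae] with ξ h
      rw [h]
      by_cases h : ξ ∈ lowSet k
      · rw [indicator_of_mem h, ← Complex.re_ofReal_mul, ← mul_assoc,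
          ← Complex.sub_re, ← sub_mul]
        change ‖g ξ‖ ^ 2 = (g ξ * (starRingEnd ℂ) (g ξ)).re
        rw [Complex.mul_conj, Complex.ofReal_re, Complex.normSq_eq_norm_sq]
      · simp [h]
    rw [integral_eq_zero_iff_of_nonneg (fun ξ => sq_nonneg _)] at h3
    · filter_upwards [h3] with ξ h4 h5
      simpa [indicator_of_mem h5] using h4
    · exact (hG.integrable_norm_pow (by norm_num))
  filter_upwards [ae_all_iff.2 key] with ξ h
  obtain ⟨k, hk⟩ := exists_nat_gt (freq ξ)
  exact sub_eq_zero.1 (h k hk)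

/-- The regularity gain: `freq ^ (2 * s) * fourierL2 u` is the transform of an `L²` function. -/
theorem IsProfile.sobFinite {s : ℝ} {N : ℝ → ℝ} {μ : ℝ} {u : L2R} (h : IsProfile s N μ u) :
    SobFinite (2 * (2 * s)) u := by
  obtain ⟨f, _, hf⟩ := h
  refine (integrable_norm_sq (fourierL2 f)).congr ?_
  filter_upwards [hf] with ξ hξ
  rw [← hξ, norm_mul, Complex.norm_real, Real.norm_of_nonneg (freq_rpow_nonneg _ _), mul_pow,
    ← Real.rpow_natCast (freq ξ ^ (2 * s)), ← Real.rpow_mul (freq_nonneg ξ)]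
  congr 2; push_cast; ring

theorem IsProfile.translate {s : ℝ} {N : ℝ → ℝ} {μ : ℝ} {u : L2R} (h : IsProfile s N μ u) (a : ℝ) :
    IsProfile s N μ (translate a u) := by
  obtain ⟨f, h1, h2⟩ := h
  refine ⟨FKdV.translate a f, ?_, ?_⟩
  · filter_upwards [translate_ae a f, translate_ae a u, ae_comp_sub a h1] with x h3 h4 h5
    rw [h3, h4, h5]
  · filter_upwards [fourierL2_translate a f, fourierL2_translate a u, h2] with ξ h3 h4 h5
    rw [h3, h4, ← h5]; ring

/-! ### Weak form of the equation -/

theorem IsTest.deriv {φ : ℝ → ℝ} (hφ : IsTest φ) : IsTest (_root_.deriv φ) :=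
  ⟨(contDiff_infty_iff_deriv.1 hφ.1).2, hφ.2.deriv⟩

theorem fourier_deriv_test {φ : ℝ → ℝ} (hφ : IsTest φ) (ξ : ℝ) :
    𝓕 (fun x => ((deriv φ x : ℝ) : ℂ)) ξ = 2 * Real.pi * Complex.I * ξ * 𝓕 (fun x => (φ x : ℂ)) ξ := by
  have hd : ∀ x, HasDerivAt (fun x => (φ x : ℂ)) ((deriv φ x : ℝ) : ℂ) x := fun x =>
    ((hφ.1.differentiable (by norm_num) x).hasDerivAt).ofReal_comp
  have e : (fun x => ((deriv φ x : ℝ) : ℂ)) = deriv (fun x => (φ x : ℂ)) := by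
    ext x; exact (hd x).deriv.symm
  have h := Real.fourier_deriv (f := fun x => (φ x : ℂ)) hφ.integrable.ofReal
    (fun x => (hd x).differentiableAt) (by rw [← e]; exact hφ.deriv.integrable.ofReal)
  rw [e, h]; rfl

/-- Differentiation commutes with the multiplier, since all powers of the frequency times the
transform of a test function are integrable. It allows the weak equation to be tested with `D^σ` of
the test function `deriv φ`. -/
theorem deriv_fracD {σ : ℝ} (hσ : 0 ≤ σ) {φ : ℝ → ℝ} (hφ : IsTest φ) (x : ℝ) :
    deriv (fracD σ φ) x = (𝓕⁻ (fun ξ : ℝ => ((freq ξ ^ σ : ℝ) : ℂ) *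
      𝓕 (fun y => ((deriv φ y : ℝ) : ℂ)) ξ) x).re := by
  obtain ⟨ψ, hψ⟩ := exists_schwartz hφ
  obtain ⟨ψ', hψ'⟩ := exists_schwartz hφ.deriv
  have e : (fun y => (φ y : ℂ)) = ψ := by ext y; rw [hψ]
  have e' : (fun y => ((deriv φ y : ℝ) : ℂ)) = ψ' := by ext y; rw [hψ']
  set g : ℝ → ℂ := fun ξ => ((freq ξ ^ σ : ℝ) : ℂ) * 𝓕 (fun y => (φ y : ℂ)) ξ with hg
  set g' : ℝ → ℂ := fun ξ => ((freq ξ ^ σ : ℝ) : ℂ) * 𝓕 (fun y => ((deriv φ y : ℝ) : ℂ)) ξ with hg'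
  have hint : ∀ χ : SchwartzMap ℝ ℂ, Integrable fun ξ => ((freq ξ ^ σ : ℝ) : ℂ) * 𝓕 (χ : ℝ → ℂ) ξ := by
    intro χ
    rw [← SchwartzMap.fourier_coe]
    have hm : Measurable fun ξ => ((freq ξ ^ σ : ℝ) : ℂ) * (𝓕 χ : SchwartzMap ℝ ℂ) ξ :=
      (Complex.measurable_ofReal.comp (measurable_freq_rpow σ)).mul (𝓕 χ).continuous.measurable
    refine (integrable_freq_rpow_mul_schwartz (𝓕 χ) hσ).mono' hm.aestronglyMeasurable
      (Eventually.of_forall fun ξ => ?_)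
    rw [norm_mul, Complex.norm_real, Real.norm_of_nonneg (freq_rpow_nonneg _ _)]
  have hgi : Integrable g := by rw [hg, e]; exact hint ψ
  have hgi' : Integrable g' := by rw [hg', e']; exact hint ψ'
  have hgg : ∀ ξ, g' ξ = 2 * Real.pi * Complex.I * ξ * g ξ := fun ξ => by
    simp only [hg, hg']
    rw [fourier_deriv_test hφ]; ring
  have hxg : Integrable fun ξ : ℝ => ξ • g ξ := by
    refine (hgi'.const_mul ((2 * Real.pi * Complex.I)⁻¹)).congr (Eventually.of_forall fun ξ => ?_)
    simp only [hgg, Complex.real_smul]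
    have : (Real.pi : ℂ) ≠ 0 := by exact_mod_cast Real.pi_ne_zero
    field_simp [Complex.I_ne_zero]
  have h1 := (Real.hasDerivAt_fourier hgi hxg (-x)).scomp x (hasDerivAt_neg x)
  have h2 : HasDerivAt (𝓕⁻ g) (𝓕⁻ g' x) x := by
    have e1 : 𝓕⁻ g = fun y => 𝓕 g (-y) := by ext y; exact Real.fourierInv_eq_fourier_neg g y
    rw [e1, Real.fourierInv_eq_fourier_neg]
    refine h1.congr_deriv ?_
    rw [neg_one_smul, fourier_eq_phase, fourier_eq_phase, ← integral_neg]
    congr 1; ext ξ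
    rw [hgg, smul_eq_mul]; ring
  have h3 : HasDerivAt (fun y => (𝓕⁻ g y).re) (𝓕⁻ g' x).re x :=
    Complex.reCLM.hasFDerivAt.comp_hasDerivAt x h2
  exact h3.deriv

/-- Plancherel's identity moves the real multiplier from `deriv φ` to `u`. The function `D^(2s) φ'`
need not have compact support, but it lies in `L²`, which gives the integrability. -/
theorem integral_mul_deriv_fracD {s : ℝ} (hs : 0 ≤ s) {u f : L2R}
    (hf : ∀ᵐ ξ, ((freq ξ ^ (2 * s) : ℝ) : ℂ) * fourierL2 u ξ = fourierL2 f ξ) {φ : ℝ → ℝ}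
    (hφ : IsTest φ) :
    Integrable (fun x => u x * deriv (fracD (2 * s) φ) x) ∧
      ∫ x, u x * deriv (fracD (2 * s) φ) x = ∫ x, f x * deriv φ x := by
  obtain ⟨ψ, hψ⟩ := exists_schwartz hφ.deriv
  have e : (fun y => ((deriv φ y : ℝ) : ℂ)) = ψ := by ext y; rw [hψ]
  set g : ℝ → ℂ := fun ξ => ((freq ξ ^ (2 * s) : ℝ) : ℂ) * 𝓕 (fun y => ((deriv φ y : ℝ) : ℂ)) ξ with hg
  have hgψ : ∀ ξ, g ξ = ((freq ξ ^ (2 * s) : ℝ) : ℂ) * (𝓕 ψ) ξ := fun ξ => by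
    rw [hg, e, SchwartzMap.fourier_coe]
  have hgn : ∀ ξ, ‖g ξ‖ = freq ξ ^ (2 * s) * ‖(𝓕 ψ) ξ‖ := fun ξ => by
    rw [hgψ, norm_mul, Complex.norm_real, Real.norm_of_nonneg (freq_rpow_nonneg _ _)]
  have hm : Measurable g := by
    have : g = fun ξ => ((freq ξ ^ (2 * s) : ℝ) : ℂ) * (𝓕 ψ) ξ := funext hgψ
    rw [this]
    exact (Complex.measurable_ofReal.comp (measurable_freq_rpow _)).mul (𝓕 ψ).continuous.measurable
  have hg1 : Integrable g :=
    (integrable_freq_rpow_mul_schwartz (𝓕 ψ) (by linarith : 0 ≤ 2 * s)).mono' hm.aestronglyMeasurable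
      (Eventually.of_forall fun ξ => (hgn ξ).le)
  have hg2 : MemLp g 2 :=
    (memLp_freq_rpow_mul_schwartz (𝓕 ψ) (by linarith : 0 ≤ 2 * s)).of_le hm.aestronglyMeasurable
      (Eventually.of_forall fun ξ => (hgn ξ).le.trans (le_abs_self _))
  set G : L2C := hg2.toLp g with hG
  have hder : ∀ x, deriv (fracD (2 * s) φ) x = (𝓕⁻ g x).re := deriv_fracD (by linarith) hφ
  have hinv := fourierInv_toLp_ae hg1 hg2
  have hi : Integrable fun x => ((𝓕⁻ G : L2C) x) * (starRingEnd ℂ) (toC u x) := by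
    have := L2.integrable_inner (𝕜 := ℂ) (toC u) (𝓕⁻ G : L2C)
    simpa only [RCLike.inner_apply] using this
  have hae : ∀ᵐ x, RCLike.re ((𝓕⁻ G : L2C) x * (starRingEnd ℂ) (toC u x))
      = u x * deriv (fracD (2 * s) φ) x := by
    filter_upwards [hinv, toC_ae u] with x h1 h2
    rw [hG, h1, h2, hder, Complex.conj_ofReal, mul_comm]
    simp
  refine ⟨hi.re.congr hae, ?_⟩
  rw [← integral_congr_ae hae, integral_re hi, ← inner_L2C]
  have h1 : inner ℂ (toC u) (𝓕⁻ G : L2C) = inner ℂ (fourierL2 u) G := by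
    rw [← Lp.inner_fourier_eq, FourierTransform.fourier_fourierInv_eq, fourierL2_def]
  set p : L2R := (hφ.deriv.memLp 2).toLp _ with hp
  have h2 : inner ℂ (fourierL2 u) G = inner ℂ (fourierL2 f) (fourierL2 p) := by
    rw [inner_L2C, inner_L2C]
    apply integral_congr_ae
    filter_upwards [hf, hg2.coeFn_toLp, fourierL2_toLp_ae hφ.deriv.integrable (hφ.deriv.memLp 2)]
      with ξ h3 h4 h5
    rw [h4, h5, ← h3, map_mul, Complex.conj_ofReal]
    simp only [hg]; ring
  rw [h1, h2, inner_fourierL2, inner_L2R]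
  simp only [RCLike.re_to_complex, Complex.ofReal_re]
  apply integral_congr_ae
  filter_upwards [(hφ.deriv.memLp 2).coeFn_toLp] with x hx
  rw [hp, hx]

theorem Admissible.isWeakProfile {s : ℝ} {m : ℕ} {N W : ℝ → ℝ} (hs : 1 / 2 ≤ s)
    (hN : Admissible s m N) {e : ℝ} (hW : ∀ r, deriv W r = 2 * e * r + deriv N r) {u : L2R}
    (hu : SobFinite (2 * s) u) {μ : ℝ} (h : IsProfile s N μ u) :
    IsWeakProfile s W (μ + 2 * e) u := by
  intro φ hφ
  obtain ⟨f, h1, h2⟩ := h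
  obtain ⟨i1, h3⟩ := integral_mul_deriv_fracD (by linarith) h2 hφ
  have hd := hφ.deriv.memLp 2
  have i2 : Integrable fun x => u x * deriv φ x := (Lp.memLp u).integrable_mul hd
  have i3 : Integrable fun x => deriv N (u x) * deriv φ x := (hN.memLp_deriv hs hu).integrable_mul hd
  have h4 : ∫ x, f x * deriv φ x = μ * (∫ x, u x * deriv φ x) - ∫ x, deriv N (u x) * deriv φ x := by
    rw [← integral_const_mul, ← integral_sub (i2.const_mul μ) i3]
    apply integral_congr_ae
    filter_upwards [h1] with x hx
    rw [hx]; ring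
  have h5 : ∀ x, u x * deriv (fracD (2 * s) φ) x + deriv W (u x) * deriv φ x
      = u x * deriv (fracD (2 * s) φ) x
        + (2 * e * (u x * deriv φ x) + deriv N (u x) * deriv φ x) := fun x => by
    rw [hW]; ring
  have i4 : Integrable fun x => 2 * e * (u x * deriv φ x) + deriv N (u x) * deriv φ x :=
    (i2.const_mul _).add i3
  simp only [h5]
  rw [integral_add i1 i4, integral_add (i2.const_mul _) i3, integral_const_mul, h3, h4]
  ring

/-! ### Travelling waves -/

/-- A translation is a phase on the Fourier side, and `|phase a ξ - phase b ξ| ^ 2 ≤ 4` allows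
dominated convergence. -/
theorem tendsto_sob_translate_sub {σ : ℝ} {u : L2R} (hu : SobFinite σ u) (b : ℝ) :
    Tendsto (fun a => sob σ (translate a u - translate b u)) (𝓝 b) (𝓝 0) := by
  have e : ∀ a, sob σ (translate a u - translate b u)
      = ∫ ξ, ‖phase a ξ - phase b ξ‖ ^ 2 * (freq ξ ^ σ * ‖fourierL2 u ξ‖ ^ 2) := by
    intro a
    apply integral_congr_ae
    filter_upwards [fourierL2_translate a u, fourierL2_translate b u,
      Lp.coeFn_sub (fourierL2 (translate a u)) (fourierL2 (translate b u))] with ξ h1 h2 h3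
    rw [fourierL2_sub, h3, Pi.sub_apply, h1, h2, ← sub_mul, norm_mul]; ring
  simp only [e]
  have hph : ∀ a, Measurable (phase a) := fun a =>
    (continuous_phase.comp (by fun_prop : Continuous fun ξ : ℝ => (a, ξ))).measurable
  have h0 : (0 : ℝ) = ∫ ξ, ‖phase b ξ - phase b ξ‖ ^ 2 * (freq ξ ^ σ * ‖fourierL2 u ξ‖ ^ 2) := by
    simp
  rw [h0]
  apply tendsto_integral_filter_of_dominated_convergence
    (fun ξ => 4 * (freq ξ ^ σ * ‖fourierL2 u ξ‖ ^ 2))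
  · exact Eventually.of_forall fun a =>
      (((hph a).sub (hph b)).norm.pow_const 2).aestronglyMeasurable.mul (aestronglyMeasurable_sob σ u)
  · refine Eventually.of_forall fun a => Eventually.of_forall fun ξ => ?_
    have h1 := mul_nonneg (freq_rpow_nonneg σ ξ) (sq_nonneg ‖fourierL2 u ξ‖)
    rw [norm_mul, Real.norm_of_nonneg h1, Real.norm_of_nonneg (sq_nonneg _)]
    refine mul_le_mul_of_nonneg_right ?_ h1
    have h2 := norm_sub_le (phase a ξ) (phase b ξ)
    rw [norm_phase, norm_phase] at h2
    nlinarith [norm_nonneg (phase a ξ - phase b ξ)]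
  · exact Integrable.const_mul hu 4
  · refine Eventually.of_forall fun ξ => ?_
    have hc : Continuous fun a => ‖phase a ξ - phase b ξ‖ ^ 2 * (freq ξ ^ σ * ‖fourierL2 u ξ‖ ^ 2) := by
      have : Continuous fun a => phase a ξ :=
        continuous_phase.comp (by fun_prop : Continuous fun a : ℝ => (a, ξ))
      fun_prop
    exact hc.tendsto b

theorem tendsto_sobolevNorm_of_hsq {ι : Type*} {l : Filter ι} {s : ℝ} {u : ι → L2R}
    (hu : ∀ i, SobFinite (2 * s) (u i)) (h : Tendsto (fun i => hsq s (u i)) l (𝓝 0)) :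
    Tendsto (fun i => sobolevNorm s (u i)) l (𝓝 0) := by
  have h1 := ENNReal.tendsto_ofReal ((Real.continuous_sqrt.tendsto 0).comp h)
  simp only [Real.sqrt_zero, ENNReal.ofReal_zero] at h1
  exact h1.congr fun i => (sobolevNorm_eq (hu i)).symm

theorem tendsto_sobolevNorm_translate_sub {s : ℝ} {u : L2R} (hu : SobFinite (2 * s) u) (b : ℝ) :
    Tendsto (fun a => sobolevNorm s (translate a u - translate b u)) (𝓝 b) (𝓝 0) := by
  apply tendsto_sobolevNorm_of_hsq fun a =>
    sobFinite_sub (sobFinite_translate a hu) (sobFinite_translate b hu)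
  have := (tendsto_sob_translate_sub (sobFinite_zero u) b).add (tendsto_sob_translate_sub hu b)
  simpa only [hsq, sob_zero, add_zero] using this

/-- For `u` merely in `L²` the derivative must fall on `φ`: the integral is the convolution of the
reflected `u` with `φ`. -/
theorem hasDerivAt_integral_translate_mul (u : L2R) {φ : ℝ → ℝ} (hφ : IsTest φ) (a : ℝ) :
    HasDerivAt (fun a => ∫ x, translate a u x * φ x) (∫ x, translate a u x * deriv φ x) a := by
  set f : ℝ → ℝ := fun x => u (-x)
  have hf : LocallyIntegrable f volume :=
    ((Lp.memLp u).comp_measurePreserving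
      (Measure.measurePreserving_neg (volume : Measure ℝ))).locallyIntegrable (by norm_num)
  have e : ∀ (g : ℝ → ℝ) (a : ℝ), (∫ x, translate a u x * g x)
      = (convolution f g (ContinuousLinearMap.mul ℝ ℝ) volume) a := by
    intro g a
    rw [convolution_def,
      ← integral_sub_left_eq_self (fun t => ContinuousLinearMap.mul ℝ ℝ (f t) (g (a - t))) volume a]
    apply integral_congr_ae
    filter_upwards [translate_ae a u] with x hx
    rw [hx]; simp [f]
  have h := HasCompactSupport.hasDerivAt_convolution_right (ContinuousLinearMap.mul ℝ ℝ) hf hφ.2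
    (hφ.1.of_le (by norm_num)) a
  simp only [e]
  exact h

/-- Every translate is again a profile, so the right side of the evolution equation is the speed
times `∫ u φ'`, which the chain rule yields as the time derivative. -/
theorem Admissible.isSolution_translate {s : ℝ} {m : ℕ} {N W : ℝ → ℝ} (hs : 1 / 2 ≤ s)
    (hN : Admissible s m N) {e : ℝ} (hW : ∀ r, deriv W r = 2 * e * r + deriv N r) {u : L2R}
    (hu : SobFinite (2 * s) u) {μ : ℝ} (h : IsProfile s N μ u) :
    IsSolution s W univ (fun t => translate ((μ + 2 * e) * t) u) := by
  refine ⟨fun t _ => mem_H_iff.2 (sobFinite_translate _ hu), fun t _ => ?_, fun φ hφ t _ => ?_⟩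
  · rw [nhdsWithin_univ]
    have hc : Continuous fun t' : ℝ => (μ + 2 * e) * t' := by fun_prop
    exact (tendsto_sobolevNorm_translate_sub hu ((μ + 2 * e) * t)).comp (hc.tendsto t)
  · rw [hasDerivWithinAt_univ, hN.isWeakProfile hs hW (sobFinite_translate _ hu) (h.translate _) φ hφ]
    have h1 := hasDerivAt_integral_translate_mul u hφ ((μ + 2 * e) * t)
    have h2 : HasDerivAt (fun t' : ℝ => (μ + 2 * e) * t') (μ + 2 * e) t := by
      simpa using (hasDerivAt_id t).const_mul (μ + 2 * e)
    exact (h1.comp t h2).congr_deriv (mul_comm _ _)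


/-! ### The nonlinear part of the potential -/

section NonlinearPart

variable {W : ℝ → ℝ}

theorem contDiff_nonlinearPart (hW : ContDiff ℝ 2 W) : ContDiff ℝ 1 (nonlinearPart W) := by
  have h : ContDiff ℝ 1 W := hW.of_le (by norm_num)
  unfold nonlinearPart
  fun_prop

theorem deriv_eq_nonlinearPart (hW : ContDiff ℝ 2 W) (r : ℝ) :
    deriv W r = 2 * (1 / 2 * iteratedDeriv 2 W 0) * r + deriv (nonlinearPart W) r := by
  have h1 : HasDerivAt W (deriv W r) r := (hW.differentiable (by norm_num) r).hasDerivAt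
  have h2 := h1.sub (((hasDerivAt_id r).pow 2).const_mul (1 / 2 * iteratedDeriv 2 W 0))
  have h3 : deriv (nonlinearPart W) r = _ := HasDerivAt.deriv h2
  rw [h3]
  simp
  ring

theorem rpow_le_of_two_lt {q ε : ℝ} {m : ℕ} (hq : 2 < q) (hm : q ≤ m) (hε : 0 < ε) :
    ∃ C, 0 ≤ C ∧ ∀ r : ℝ, |r| ^ (q - 1) ≤ ε * |r| + C * |r| ^ m := by
  obtain ⟨C, hC, h⟩ := exists_rpow_le_add_mul (β := q - 2) (σ := (m : ℝ) - 1) (ε := ε)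
    (by linarith) (by linarith) hε
  refine ⟨C, hC, fun r => ?_⟩
  have h1 : |r| ^ (q - 1) = |r| ^ (q - 2) * |r| := by
    rw [← Real.rpow_add_one' (abs_nonneg r) (by linarith)]; ring_nf
  have h2 : |r| ^ m = |r| ^ ((m : ℝ) - 1) * |r| := by
    rw [← Real.rpow_add_one' (abs_nonneg r) (by linarith), sub_add_cancel, Real.rpow_natCast]
  rw [h1, h2]
  have := mul_le_mul_of_nonneg_right (h |r| (abs_nonneg r)) (abs_nonneg r)
  linarith

/-- The condition `q₁ > 2` gives the arbitrarily small linear term in the bound on the derivative,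
and a natural exponent `m ≥ q₂` controls the growth. The lower bound for large `|r|` is extended to
all `r` by a quadratic term. -/
theorem exists_admissible {s : ℝ} (hW : ContDiff ℝ 2 W) (hW0 : W 0 = 0)
    (hW1 : ∃ r₀ : ℝ, nonlinearPart W r₀ < 0)
    (hW2 : ∃ q₁ q₂ c₁ : ℝ, 2 < q₁ ∧ q₁ ≤ q₂ ∧
      ∀ r : ℝ, |deriv (nonlinearPart W) r| ≤ c₁ * (|r| ^ (q₁ - 1) + |r| ^ (q₂ - 1)))
    (hW3 : ∃ p c R : ℝ, 2 < p ∧ p < 4 * s + 2 ∧ 0 ≤ c ∧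
      ∀ r : ℝ, R ≤ |r| → -c * |r| ^ p ≤ nonlinearPart W r) :
    ∃ m, Admissible s m (nonlinearPart W) := by
  obtain ⟨q₁, q₂, c₁, hq1, hq2, h2⟩ := hW2
  have h0 : nonlinearPart W 0 = 0 := by simp [nonlinearPart, hW0]
  have hc := contDiff_nonlinearPart hW
  set N := nonlinearPart W
  set m : ℕ := max 2 ⌈q₂⌉₊ with hm
  have hqm : q₂ ≤ m := (Nat.le_ceil q₂).trans (by exact_mod_cast le_max_right _ _)
  have h2m : 2 ≤ m := le_max_left _ _
  have hd : ∀ ε > 0, ∃ C, 0 ≤ C ∧ ∀ r, |deriv N r| ≤ ε * |r| + C * |r| ^ m := by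
    intro ε hε
    have hε' : 0 < ε / (2 * (|c₁| + 1)) := by positivity
    obtain ⟨C₁, hC₁, k1⟩ := rpow_le_of_two_lt hq1 (hq2.trans hqm) hε'
    obtain ⟨C₂, hC₂, k2⟩ := rpow_le_of_two_lt (hq1.trans_le hq2) hqm hε'
    refine ⟨|c₁| * (C₁ + C₂), by positivity, fun r => ?_⟩
    have e1 : |c₁| * (2 * (ε / (2 * (|c₁| + 1)))) ≤ ε := by
      rw [show |c₁| * (2 * (ε / (2 * (|c₁| + 1)))) = ε * (|c₁| / (|c₁| + 1)) by field_simp]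
      refine mul_le_of_le_one_right hε.le ((div_le_one (by positivity)).2 (by linarith))
    calc |deriv N r| ≤ c₁ * (|r| ^ (q₁ - 1) + |r| ^ (q₂ - 1)) := h2 r
      _ ≤ |c₁| * (|r| ^ (q₁ - 1) + |r| ^ (q₂ - 1)) :=
        mul_le_mul_of_nonneg_right (le_abs_self _) (by positivity)
      _ ≤ |c₁| * ((ε / (2 * (|c₁| + 1)) * |r| + C₁ * |r| ^ m)
          + (ε / (2 * (|c₁| + 1)) * |r| + C₂ * |r| ^ m)) :=
        mul_le_mul_of_nonneg_left (add_le_add (k1 r) (k2 r)) (abs_nonneg _)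
      _ = |c₁| * (2 * (ε / (2 * (|c₁| + 1)))) * |r| + |c₁| * (C₁ + C₂) * |r| ^ m := by ring
      _ ≤ _ := by gcongr
  refine ⟨m, hc, h0, h2m, hd, ?_, hW1⟩
  obtain ⟨p, c, R, hp, hp2, hc0, h3⟩ := hW3
  obtain ⟨C, hC, k⟩ := hd 1 one_pos
  refine ⟨p, c + (1 + C * |R| ^ (m - 1)), hp, hp2, by positivity, fun r => ?_⟩
  have hx : 0 ≤ |r| ^ p := by positivity
  have hy : 0 ≤ |r| ^ 2 := by positivity
  have hz : 0 ≤ C * |R| ^ (m - 1) := by positivity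
  rcases le_or_gt R |r| with h | h
  · nlinarith [h3 r h, mul_nonneg hc0 hy, mul_nonneg hz hx, mul_nonneg hz hy]
  -- For `|r| < R` the mean value inequality from `N 0 = 0` bounds `|N r|` by `(1 + C * |R| ^ (m -
  -- 1)) * |r| ^ 2`.
  · have hb : ∀ x ∈ uIcc 0 r, ‖deriv N x‖ ≤ |r| + C * |r| ^ m := by
      intro x hx
      have hxr : |x| ≤ |r| := by simpa using abs_sub_left_of_mem_uIcc hx
      rw [Real.norm_eq_abs]
      refine (k x).trans ?_
      rw [one_mul]
      gcongr
    have hmv := Convex.norm_image_sub_le_of_norm_deriv_le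
      (fun x _ => hc.differentiable (by norm_num) x) hb (convex_uIcc 0 r) left_mem_uIcc right_mem_uIcc
    rw [h0, sub_zero, sub_zero, Real.norm_eq_abs, Real.norm_eq_abs] at hmv
    have e : |r| ^ m = |r| ^ (m - 1) * |r| := by
      rw [← pow_succ]; congr 1; omega
    have h5 : |r| ^ (m - 1) ≤ |R| ^ (m - 1) :=
      pow_le_pow_left₀ (abs_nonneg _) (h.le.trans (le_abs_self _)) _
    have h6 := mul_le_mul_of_nonneg_right (mul_le_mul_of_nonneg_left h5 hC) hy
    rw [e] at hmv
    have h7 : (|r| + C * (|r| ^ (m - 1) * |r|)) * |r| = |r| ^ 2 + C * |r| ^ (m - 1) * |r| ^ 2 := by ring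
    nlinarith [neg_abs_le (N r), mul_nonneg hc0 hx, mul_nonneg hc0 hy, mul_nonneg hz hx]

end NonlinearPart

theorem Admissible.energy_add_sq {s : ℝ} {m : ℕ} {N W : ℝ → ℝ} (hs : 1 / 2 ≤ s)
    (hN : Admissible s m N) {e : ℝ} (hW : ∀ r, W r = N r + e * r ^ 2) {u : L2R}
    (hu : SobFinite (2 * s) u) : energy s W u = energy s N u + 2 * e * charge u := by
  have h : ∫ x, W (u x) = (∫ x, N (u x)) + e * ∫ x, u x ^ 2 := by
    simp only [hW]
    rw [← integral_const_mul, integral_add (hN.integrable hs hu)]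
    exact (Lp.memLp u).integrable_sq.const_mul e
  rw [energy, energy, charge, h]
  ring

/-! ### Minimizers -/

theorem Admissible.exists_minimizer {s : ℝ} {m : ℕ} {N : ℝ → ℝ} (hs : 1 / 2 ≤ s)
    (hN : Admissible s m N) {c : ℝ} (hc : 0 < c) (hneg : minE s N c < 0) :
    ∃ v : L2R, SobFinite (2 * s) v ∧ charge v = c ∧ energy s N v = minE s N c := by
  choose u h1 h2 h3 using fun n : ℕ => hN.exists_energy_lt hs hc
    (lt_add_of_pos_right (minE s N c) (Nat.one_div_pos_of_nat (n := n) (α := ℝ)))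
  have hlim : Tendsto (fun n => energy s N (u n)) atTop (𝓝 (minE s N c)) := by
    refine tendsto_of_tendsto_of_tendsto_of_le_of_le tendsto_const_nhds
      (by simpa using (tendsto_one_div_add_atTop_nhds_zero_nat (𝕜 := ℝ)).const_add (minE s N c))
      (fun n => ?_) (fun n => (h3 n).le)
    have := hN.minE_le hs (h1 n)
    rwa [h2] at this
  obtain ⟨_, _, _, v, hv, hvc, hve, _⟩ :=
    hN.exists_tendsto hs hc hneg h1 (by simp only [h2]; exact tendsto_const_nhds) hlim
  exact ⟨v, hv, hvc, hve⟩

theorem abs_hsq_sub_le {s : ℝ} {u v : L2R} (hu : SobFinite (2 * s) u) (hv : SobFinite (2 * s) v) :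
    |hsq s u - hsq s v| ≤
      Real.sqrt (hsq s (u - v)) * (2 * Real.sqrt (hsq s v) + Real.sqrt (hsq s (u - v))) := by
  rw [← norm_lift_sq hu, ← norm_lift_sq hv, ← norm_lift_sq (sobFinite_sub hu hv), lift_sub hu hv,
    Real.sqrt_sq (norm_nonneg _), Real.sqrt_sq (norm_nonneg _), sq_sub_sq, abs_mul, mul_comm]
  have h1 := abs_norm_sub_norm_le (lift hu) (lift hv)
  have h2 := norm_sub_norm_le (lift hu) (lift hv)
  rw [abs_of_nonneg (by positivity : 0 ≤ ‖lift hu‖ + ‖lift hv‖)]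
  exact mul_le_mul h1 (by linarith) (by positivity) (norm_nonneg _)

theorem abs_norm_sq_sub_le (u v : L2R) :
    |‖u‖ ^ 2 - ‖v‖ ^ 2| ≤ ‖u - v‖ * (2 * ‖v‖ + ‖u - v‖) := by
  rw [sq_sub_sq, abs_mul, mul_comm, abs_of_nonneg (by positivity : 0 ≤ ‖u‖ + ‖v‖)]
  have h2 := norm_sub_norm_le u v
  exact mul_le_mul (abs_norm_sub_norm_le u v) (by linarith) (by positivity) (norm_nonneg _)

/-- The reference states `v n` vary, so continuity must be uniform over the level set: coercivity
bounds it in `H^s`, and the estimates used are uniform on balls. -/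
theorem Admissible.tendsto_of_tendsto_hsq_sub {s : ℝ} {m : ℕ} {N : ℝ → ℝ} (hs : 1 / 2 ≤ s)
    (hN : Admissible s m N) {c e : ℝ} {u v : ℕ → L2R} (hu : ∀ n, SobFinite (2 * s) (u n))
    (hv : ∀ n, SobFinite (2 * s) (v n)) (hc : ∀ n, charge (v n) = c)
    (he : ∀ n, energy s N (v n) = e) (h : Tendsto (fun n => hsq s (u n - v n)) atTop (𝓝 0)) :
    Tendsto (fun n => charge (u n)) atTop (𝓝 c) ∧
      Tendsto (fun n => energy s N (u n)) atTop (𝓝 e) := by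
  obtain ⟨K, hK⟩ := hN.coercive hs (2 * c)
  have hvn : ∀ n, ‖v n‖ ^ 2 = 2 * c := fun n => by rw [← hc n, charge_eq]; ring
  set M := 2 * c + 4 * (e + K) with hM
  have hvM : ∀ n, hsq s (v n) ≤ M := fun n => by
    have := hK (v n) (hv n) (hvn n).le
    rw [he] at this
    rw [hsq, hvn, hM]; linarith
  have hM0 : 0 ≤ M := (hsq_nonneg s (v 0)).trans (hvM 0)
  set d : ℕ → ℝ := fun n => Real.sqrt (hsq s (u n - v n)) with hd
  have hd0 : Tendsto d atTop (𝓝 0) := by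
    have := (Real.continuous_sqrt.tendsto 0).comp h
    rwa [Real.sqrt_zero] at this
  have hb : Tendsto (fun n => d n * (2 * Real.sqrt M + d n)) atTop (𝓝 0) := by
    simpa using hd0.mul (hd0.const_add (2 * Real.sqrt M))
  have hnd : ∀ n, ‖u n - v n‖ ≤ d n := fun n => Real.le_sqrt_of_sq_le (norm_sq_le_hsq _ _)
  have hnorm : Tendsto (fun n => ‖u n‖ ^ 2 - ‖v n‖ ^ 2) atTop (𝓝 0) := by
    refine squeeze_zero_norm (fun n => ?_) hb
    rw [Real.norm_eq_abs]
    refine (abs_norm_sq_sub_le _ _).trans ?_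
    have h1 : ‖v n‖ ≤ Real.sqrt M := Real.le_sqrt_of_sq_le ((norm_sq_le_hsq _ _).trans (hvM n))
    have h2 := hnd n
    gcongr
  have hh : Tendsto (fun n => hsq s (u n) - hsq s (v n)) atTop (𝓝 0) := by
    refine squeeze_zero_norm (fun n => ?_) hb
    rw [Real.norm_eq_abs]
    refine (abs_hsq_sub_le (hu n) (hv n)).trans ?_
    have h1 := Real.sqrt_le_sqrt (hvM n)
    gcongr
  have hint : Tendsto (fun n => (∫ x, N (u n x)) - ∫ x, N (v n x)) atTop (𝓝 0) := by
    obtain ⟨C, hC, k⟩ := hN.abs_integral_sub_le hs (M + 1)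
    have hlim : Tendsto (fun n => C * d n) atTop (𝓝 0) := by simpa using hd0.const_mul C
    refine squeeze_zero_norm' ?_ hlim
    filter_upwards [hh.eventually (gt_mem_nhds one_pos)] with n hn
    rw [Real.norm_eq_abs]
    exact (k _ _ (hu n) (hv n) (by linarith [hvM n]) (by linarith [hvM n])).trans
      (mul_le_mul_of_nonneg_left (hnd n) hC)
  constructor
  · have := (hnorm.const_mul (1 / 2)).add_const c
    simp only [mul_zero, zero_add] at this
    refine this.congr fun n => ?_
    rw [charge_eq, hvn]; ring
  · have := ((((hh.sub hnorm).const_mul (1 / 2)).add hint).add_const e)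
    simp only [sub_zero, mul_zero, zero_add] at this
    refine this.congr fun n => ?_
    rw [← he n, energy_eq, energy_eq, hsq, hsq]; ring

/-! ### Evolution -/

theorem flow_spec {s : ℝ} {W : ℝ → ℝ} {u : L2R} {t : ℝ} (ht : 0 ≤ t)
    (h : ENNReal.ofReal t < lifespan s W u) :
    flow s W t u ∈ H s ∧ energy s W (flow s W t u) = energy s W u ∧
      charge (flow s W t u) = charge u := by
  obtain ⟨τ, h1⟩ := lt_iSup_iff.1 h
  obtain ⟨⟨⟨w, hw⟩, _⟩, h2⟩ := lt_iSup_iff.1 h1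
  have h3 : t < τ := by
    have := (ENNReal.ofReal_lt_iff_lt_toReal ht ENNReal.coe_ne_top).1 h2
    simpa using this
  -- The trajectory behind the chosen value of `flow` may differ from `w`; its own conservation laws
  -- suffice.
  have hex : ∃ v, ∃ τ > t, ∃ w, IsTrajectory s W u τ w ∧ w t = v := ⟨w t, τ, h3, w, hw, rfl⟩
  rw [flow, dif_pos hex]
  obtain ⟨τ', h4, w', h5, h6⟩ := hex.choose_spec
  rw [← h6]
  exact ⟨h5.solves.1 t ⟨ht, h4⟩, h5.energy_const t ⟨ht, h4⟩, h5.charge_const t ⟨ht, h4⟩⟩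

theorem isInvariant_levelSet (s : ℝ) (W : ℝ → ℝ) (e c : ℝ) : IsInvariant s W (levelSet s W e c) := by
  rintro u ⟨_, h2, h3⟩ t ht h
  obtain ⟨k1, k2, k3⟩ := flow_spec ht h
  exact ⟨k1, k2.trans h2, by rw [k3, h3]⟩

section Minimizers

variable {s : ℝ} {m : ℕ} {N W : ℝ → ℝ} {e c : ℝ}

theorem Admissible.mem_levelSet_iff (hs : 1 / 2 ≤ s) (hN : Admissible s m N)
    (hW : ∀ r, W r = N r + e * r ^ 2) {u : L2R} :
    u ∈ levelSet s W (minE s N c + 2 * e * c) c ↔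
      SobFinite (2 * s) u ∧ energy s N u = minE s N c ∧ charge u = c := by
  constructor
  · rintro ⟨h1, h2, h3⟩
    rw [abs_of_nonneg (charge_nonneg u)] at h3
    rw [hN.energy_add_sq hs hW (mem_H_iff.1 h1), h3] at h2
    exact ⟨mem_H_iff.1 h1, by linarith, h3⟩
  · rintro ⟨h1, h2, h3⟩
    refine ⟨mem_H_iff.2 h1, ?_, ?_⟩
    · rw [hN.energy_add_sq hs hW h1, h2, h3]
    · rw [abs_of_nonneg (charge_nonneg u), h3]

theorem Admissible.isMinEnergy (hs : 1 / 2 ≤ s) (hN : Admissible s m N)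
    (hW : ∀ r, W r = N r + e * r ^ 2) (hc : 0 < c) (hneg : minE s N c < 0) :
    IsMinEnergy s W c (minE s N c + 2 * e * c) := by
  constructor
  · obtain ⟨v, h1, h2, h3⟩ := hN.exists_minimizer hs hc hneg
    have h4 := (hN.mem_levelSet_iff hs hW).2 ⟨h1, h3, h2⟩
    exact ⟨v, h4.1, h4.2.2, h4.2.1⟩
  · rintro x ⟨v, hv, h1, rfl⟩
    rw [abs_of_nonneg (charge_nonneg v)] at h1
    have := hN.minE_le hs (mem_H_iff.1 hv)
    rw [hN.energy_add_sq hs hW (mem_H_iff.1 hv), h1]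
    rw [h1] at this
    linarith

theorem Admissible.levelSet_subset (hs : 1 / 2 ≤ s) (hN : Admissible s m N)
    (hW : ∀ r, W r = N r + e * r ^ 2) (hc : 0 < c) :
    levelSet s W (minE s N c + 2 * e * c) c ⊆ H (2 * s) := by
  intro u hu
  obtain ⟨h1, h2, h3⟩ := (hN.mem_levelSet_iff hs hW).1 hu
  obtain ⟨μ, h⟩ := hN.exists_isProfile hs h1 (by rwa [h3]) (by rw [h2, h3])
  exact mem_H_iff.2 h.sobFinite

theorem Admissible.isCompactUpToTranslations (hs : 1 / 2 ≤ s) (hN : Admissible s m N)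
    (hW : ∀ r, W r = N r + e * r ^ 2) (hc : 0 < c) (hneg : minE s N c < 0) :
    IsCompactUpToTranslations s (levelSet s W (minE s N c + 2 * e * c) c) := by
  intro u hu
  have hu' := fun n => (hN.mem_levelSet_iff hs hW).1 (hu n)
  obtain ⟨φ, hφ, a, v, hv, _, _, hlim⟩ := hN.exists_tendsto hs hc hneg (fun n => (hu' n).1)
    (tendsto_const_nhds.congr fun n => (hu' n).2.2.symm)
    (tendsto_const_nhds.congr fun n => (hu' n).2.1.symm)
  exact ⟨φ, hφ, a, v, mem_H_iff.2 hv, tendsto_sobolevNorm_of_hsq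
    (fun n => sobFinite_sub (sobFinite_translate _ (hu' _).1) hv) hlim⟩

/-- The argument of Cazenave and Lions: a violation of stability gives initial data approaching `Γ`
whose evolutions stay away from it. By conservation these evolutions form a minimizing sequence, so
some of them come close to a translate of a minimizer, which belongs to `Γ`. -/
theorem Admissible.isStable (hs : 1 / 2 ≤ s) (hN : Admissible s m N)
    (hW : ∀ r, W r = N r + e * r ^ 2) (hc : 0 < c) (hneg : minE s N c < 0) :
    IsStable s W (levelSet s W (minE s N c + 2 * e * c) c) := by
  set Γ := levelSet s W (minE s N c + 2 * e * c) c with hΓ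
  intro ε hε
  by_contra! hcon
  choose u hu hd t ht hl hbad using fun n : ℕ => hcon (ENNReal.ofReal (1 / ((n : ℝ) + 1)))
    (ENNReal.ofReal_pos.2 Nat.one_div_pos_of_nat)
  -- The distance is an infimum that need not be attained; the factor `2` leaves room to choose `v`.
  have hv : ∀ n, ∃ v ∈ Γ, sobolevNorm s (u n - v) < ENNReal.ofReal (2 * (1 / ((n : ℝ) + 1))) := by
    intro n
    have h0 : 0 < 1 / ((n : ℝ) + 1) := Nat.one_div_pos_of_nat
    have h1 : distToSet s (u n) Γ < ENNReal.ofReal (2 * (1 / ((n : ℝ) + 1))) :=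
      (hd n).trans_lt ((ENNReal.ofReal_lt_ofReal_iff (by linarith)).2 (by linarith))
    obtain ⟨v, h2⟩ := iInf_lt_iff.1 h1
    obtain ⟨h3, h4⟩ := iInf_lt_iff.1 h2
    exact ⟨v, h3, h4⟩
  choose v hvΓ hvn using hv
  have hu' := fun n => mem_H_iff.1 (hu n)
  have hv' := fun n => (hN.mem_levelSet_iff hs hW).1 (hvΓ n)
  have hlim : Tendsto (fun n => hsq s (u n - v n)) atTop (𝓝 0) := by
    have h1 : Tendsto (fun n : ℕ => (2 * (1 / ((n : ℝ) + 1))) ^ 2) atTop (𝓝 0) := by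
      simpa using ((tendsto_one_div_add_atTop_nhds_zero_nat (𝕜 := ℝ)).const_mul 2).pow 2
    refine squeeze_zero (fun n => hsq_nonneg _ _) (fun n => ?_) h1
    have h0 : 0 < 1 / ((n : ℝ) + 1) := Nat.one_div_pos_of_nat
    have h2 := hvn n
    rw [sobolevNorm_eq (sobFinite_sub (hu' n) (hv' n).1),
      ENNReal.ofReal_lt_ofReal_iff (by linarith)] at h2
    exact (Real.sqrt_le_left (by linarith)).1 h2.le
  obtain ⟨hcl, hel⟩ := hN.tendsto_of_tendsto_hsq_sub hs hu' (fun n => (hv' n).1)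
    (fun n => (hv' n).2.2) (fun n => (hv' n).2.1) hlim
  set w : ℕ → L2R := fun n => flow s W (t n) (u n) with hw
  have hspec := fun n => flow_spec (ht n) (hl n)
  have hw' : ∀ n, SobFinite (2 * s) (w n) := fun n => mem_H_iff.1 (hspec n).1
  have hwe : ∀ n, energy s N (w n) = energy s N (u n) := fun n => by
    have h1 := (hspec n).2.1
    rw [hN.energy_add_sq hs hW (hw' n), hN.energy_add_sq hs hW (hu' n), (hspec n).2.2] at h1
    linarith
  obtain ⟨φ, hφ, a, z, hz, hzc, hze, hzlim⟩ := hN.exists_tendsto hs hc hneg hw'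
    (hcl.congr fun n => ((hspec n).2.2).symm) (hel.congr fun n => (hwe n).symm)
  have hzlim' := tendsto_sobolevNorm_of_hsq
    (fun n => sobFinite_sub (sobFinite_translate (a n) (hw' (φ n))) hz) hzlim
  obtain ⟨n, hn⟩ := (hzlim'.eventually (gt_mem_nhds hε)).exists
  -- The limit is moved back instead of the evolved state: `Γ` is translation invariant and
  -- translations are isometries of `H^s`.
  have hmem : translate (-a n) z ∈ Γ := (hN.mem_levelSet_iff hs hW).2
    ⟨sobFinite_translate _ hz, by rw [energy_translate, hze], by rw [charge_translate, hzc]⟩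
  have hle : distToSet s (w (φ n)) Γ ≤ sobolevNorm s (w (φ n) - translate (-a n) z) :=
    iInf₂_le _ hmem
  have heq : sobolevNorm s (w (φ n) - translate (-a n) z)
      = sobolevNorm s (translate (a n) (w (φ n)) - z) := by
    rw [sobolevNorm_eq (sobFinite_sub (hw' _) (sobFinite_translate _ hz)),
      sobolevNorm_eq (sobFinite_sub (sobFinite_translate _ (hw' _)) hz),
      ← hsq_translate s (a n) (w (φ n) - translate (-a n) z), translate_sub, translate_translate,
      add_neg_cancel, translate_zero]
  exact (hbad (φ n)).not_ge (hle.trans (heq.trans_le hn.le))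

end Minimizers

end FKdV

end


/-! ### Proof of the theorem -/

theorem mainTheorem2 (s : ℝ) (hs : 1 / 2 ≤ s) (W : ℝ → ℝ) (hW : ContDiff ℝ 2 W)
    (hW0 : W 0 = 0 ∧ deriv W 0 = 0)
    (hW1 : ∃ r₀ : ℝ, FKdV.nonlinearPart W r₀ < 0)
    (hW2 : ∃ q₁ q₂ c₁ : ℝ, 2 < q₁ ∧ q₁ ≤ q₂ ∧
      ∀ r : ℝ, |deriv (FKdV.nonlinearPart W) r| ≤ c₁ * (|r| ^ (q₁ - 1) + |r| ^ (q₂ - 1)))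
    (hW3 : ∃ p c R : ℝ, 2 < p ∧ p < 4 * s + 2 ∧ 0 ≤ c ∧
      ∀ r : ℝ, R ≤ |r| → -c * |r| ^ p ≤ FKdV.nonlinearPart W r) :
    ∃ δinf : ℝ, 0 < δinf ∧ ∃ (u : ℝ → FKdV.L2R) (lam : ℝ → ℝ),
      StrictAntiOn (fun δ => FKdV.charge (u δ)) (Set.Ioo 0 δinf) ∧
      ∀ δ ∈ Set.Ioo 0 δinf,
        0 < FKdV.charge (u δ) ∧
        u δ ∈ FKdV.H (2 * s) ∧
        -- the energy minimizers with the charge of `u δ`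
        FKdV.IsMinEnergy s W (FKdV.charge (u δ)) (FKdV.energy s W (u δ)) ∧
        (∀ Γ : Set FKdV.L2R,
          Γ = FKdV.levelSet s W (FKdV.energy s W (u δ)) (FKdV.charge (u δ)) →
          Γ ⊆ FKdV.H (2 * s) ∧ FKdV.IsInvariant s W Γ ∧ FKdV.IsStable s W Γ ∧
            FKdV.IsCompactUpToTranslations s Γ) ∧
        -- global well-posedness in `H^(2s)` is used only for `Γ ⊆ X₀`
        (FKdV.H (2 * s) ⊆ FKdV.globalStates s W → FKdV.IsHylomorphicSoliton s W (u δ)) ∧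
        FKdV.IsWeakProfile s W (lam δ) (u δ) ∧
        FKdV.IsSolution s W Set.univ (fun t => FKdV.translate (lam δ * t) (u δ)) := by
  obtain ⟨m, hN⟩ := FKdV.exists_admissible hW hW0.1 hW1 hW2 hW3
  have hdW := FKdV.deriv_eq_nonlinearPart hW
  set e := 1 / 2 * iteratedDeriv 2 W 0 with he
  have hWN : ∀ r, W r = FKdV.nonlinearPart W r + e * r ^ 2 := fun r => by
    rw [FKdV.nonlinearPart, he]; ring
  set N := FKdV.nonlinearPart W
  obtain ⟨c₀, hc₀, hneg⟩ := hN.exists_minE_neg hs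
  have hpos : ∀ δ : ℝ, 0 < δ → 0 < c₀ + 1 / δ := fun δ hδ => by positivity
  have hneg' : ∀ δ : ℝ, 0 < δ → FKdV.minE s N (c₀ + 1 / δ) < 0 := fun δ hδ =>
    hneg _ (le_add_of_nonneg_right (by positivity))
  -- The charge `c₀ + 1 / δ` is strictly decreasing in `δ` and stays in the range of negative
  -- minimal energy for every `δ > 0`.
  choose! u hu using fun (δ : ℝ) (hδ : 0 < δ) => hN.exists_minimizer hs (hpos δ hδ) (hneg' δ hδ)
  choose! μ hμ using fun (δ : ℝ) (hδ : 0 < δ) => hN.exists_isProfile hs (hu δ hδ).1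
    (by rw [(hu δ hδ).2.1]; exact hpos δ hδ) (by rw [(hu δ hδ).2.1]; exact (hu δ hδ).2.2)
  -- Any positive bound on `δ` would serve. The quadratic part of `W` contributes `2 * e * u` to the
  -- equation, hence the shift of the multiplier.
  refine ⟨1, one_pos, u, fun δ => μ δ + 2 * e, ?_, ?_⟩
  · intro a ha b hb hab
    simp only [(hu a ha.1).2.1, (hu b hb.1).2.1]
    have := one_div_lt_one_div_of_lt ha.1 hab
    linarith
  · rintro δ ⟨hδ, -⟩
    obtain ⟨h1, h2, h3⟩ := hu δ hδ
    have hen : FKdV.energy s W (u δ) = FKdV.minE s N (c₀ + 1 / δ) + 2 * e * (c₀ + 1 / δ) := by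
      rw [hN.energy_add_sq hs hWN h1, h2, h3]
    have hmin := hN.isMinEnergy hs hWN (hpos δ hδ) (hneg' δ hδ)
    have hsub := hN.levelSet_subset hs hWN (hpos δ hδ)
    have hst := hN.isStable hs hWN (hpos δ hδ) (hneg' δ hδ)
    have hcpt := hN.isCompactUpToTranslations hs hWN (hpos δ hδ) (hneg' δ hδ)
    have hmem := (hN.mem_levelSet_iff hs hWN).2 ⟨h1, h3, h2⟩
    rw [hen, h2]
    refine ⟨hpos δ hδ, FKdV.mem_H_iff.2 (hμ δ hδ).sobFinite, hmin, ?_, fun hgwp => ?_,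
      hN.isWeakProfile hs hdW h1 (hμ δ hδ), hN.isSolution_translate hs hdW h1 (hμ δ hδ)⟩
    · rintro Γ rfl
      exact ⟨hsub, FKdV.isInvariant_levelSet s W _ _, hst, hcpt⟩
    · exact ⟨_, _, hmin, hmem, hsub.trans hgwp, FKdV.isInvariant_levelSet s W _ _, hst, hcpt⟩
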